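/- Let $d\ge 2$ and let $\Omega\subset\mathbb R^d$ be a bounded open set with $C^1$ boundary, outward unit normal $n(x)$ and surface measure $\pi$ on $\partial\Omega$. Let $\varpi:[0,\infty)\to[0,\infty)$ be measurable, $\boldsymbol m(\mathrm dv)=\varpi(|v|)\,\mathrm dv$, and let $V$ be the support of $\boldsymbol m$. Put $$\Gamma_\pm=\{(x,v)\in\partial\Omega\times V:\ \pm v\cdot n(x)>0\},\qquad \Gamma_\pm(x)=\{v:(x,v)\in\Gamma_\pm\},\qquad \boldsymbol\mu_x(\mathrm dv)=|v\cdot n(x)|\,\boldsymbol m(\mathrm dv),$$ and $L^1_\pm=L^1(\Gamma_\pm,\ |v\cdot n(x)|\,\pi(\mathrm dx)\otimes\boldsymbol m(\mathrm dv))$ (complex-valued). For $(x,v)\in\Gamma_+$ let $\tau_-(x,v)=\inf\{s>0:\ x-sv\notin\Omega\}$. For $\lambda\in\mathbb C$ with $\operatorname{Re}\lambda\ge 0$ the formula $$\mathsf M_\lambda u(x,v)=u\big(x-\tau_-(x,v)v,\,v\big)\,e^{-\lambda\tau_-(x,v)},\qquad (x,v)\in\Gamma_+,$$ defines a bounded operator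 $\mathsf M_\lambda:L^1_-\to L^1_+$. Let $\mathsf H:L^1_+\to L^1_-$ be a stochastic diffuse boundary operator, i.e. $$\mathsf H\psi(x,v)=\int_{\Gamma_+(x)}\boldsymbol h(x,v,v')\,\psi(x,v')\,\boldsymbol\mu_x(\mathrm dv'),\qquad (x,v)\in\Gamma_-,$$ with $\boldsymbol h:\partial\Omega\times V\times V\to[0,\infty)$ measurable and $\int_{\Gamma_-(x)}\boldsymbol h(x,v,v')\,\boldsymbol\mu_x(\mathrm dv)=1$ for all $(x,v')\in\Gamma_+$. For $x\in\partial\Omega$ let $\mathsf K(x)$ be the integral operator on $L^1(V,\boldsymbol m)$ with kernel $k(x,v,v')=|v\cdot n(x)|\,\boldsymbol h(x,v,v')$, that is $\mathsf K(x)\varphi(v)=\int_V k(x,v,v')\varphi(v')\,\boldsymbol m(\mathrm dv')$, and assume that each $\mathsf K(x)$ is bounded and that 1. $\{\mathsf K(x):x\in\partial\Omega\}$ is collectively compact, i.e. $\bigcup_{x\in\partial\Omega}\mathsf K(x)\{\varphi\in L^1(V,\boldsymbol m):\|\varphi\|\le 1\}$ is relatively compact in $L^1(V,\boldsymbol m)$;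 2. for every $\psi\in L^\infty(V,\boldsymbol m)$ the set $\{\mathsf K(x)^\star\psi:x\in\partial\Omega\}$ is relatively compact in $L^\infty(V,\boldsymbol m)$. Then $$\lim_{|s|\to\infty}\big\|(\mathsf M_{\varepsilon+is}\mathsf H)^2\big\|_{\mathscr B(L^1_+)}=0\qquad\text{for every }\varepsilon\ge 0 .$$ -/

import Mathlib

open MeasureTheory Filter Topology
open scoped NNReal ENNReal RealInnerProductSpace

noncomputable section

namespace Kinetic

/-- Points and velocities live in `ℝ^d` with the Euclidean norm. -/
abbrev E (d : ℕ) : Type := EuclideanSpace ℝ (Fin d)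

variable {d : ℕ}

/-! ### The spatial domain -/

/-- `φ` is a `C¹` defining function of `Ω` at the boundary point `x`: it is `C¹` near `x`, vanishes
at `x` with nonzero gradient, and `Ω = {φ < 0}` near `x`. -/
structure IsDefiningFunction (Ω : Set (E d)) (x : E d) (φ : E d → ℝ) : Prop where
  contDiffAt : ContDiffAt ℝ 1 φ x
  map_eq_zero : φ x = 0
  gradient_ne_zero : gradient φ x ≠ 0
  mem_iff : ∀ᶠ y in 𝓝 x, (y ∈ Ω ↔ φ y < 0)

/-- `Ω` has a boundary of class `C¹`, with `Ω` locally on one side of it. -/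
def HasC1Boundary (Ω : Set (E d)) : Prop :=
  ∀ x ∈ frontier Ω, ∃ φ, IsDefiningFunction Ω x φ

open Classical in
/-- The outward unit normal `n(x) = ∇φ(x) / |∇φ(x)|`, for any defining function `φ` of `Ω` at `x`
(the value does not depend on `φ`); it is `0` at points where there is none. -/
def outwardNormal (Ω : Set (E d)) (x : E d) : E d :=
  if h : ∃ φ, IsDefiningFunction Ω x φ then
    ‖gradient h.choose x‖⁻¹ • gradient h.choose x
  else 0

/-- The Lebesgue surface measure `π` on `∂Ω`: the `(d - 1)`-dimensional Hausdorff measure, with the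
Lebesgue normalization, restricted to `∂Ω`. -/
def surfaceMeasure (Ω : Set (E d)) : Measure (E d) :=
  (μHE[d - 1] : Measure (E d)).restrict (frontier Ω)

/-- The backward travel time `τ₋(x, v) = inf {s > 0 : x - s v ∉ Ω}`. -/
def travelTime (Ω : Set (E d)) (x v : E d) : ℝ :=
  sInf {s : ℝ | 0 < s ∧ x - s • v ∉ Ω}

/-! ### Velocities and phase-space boundary -/

/-- The radial velocity measure `m(dv) = ϖ(|v|) dv` on `ℝ^d`. -/
def velocityMeasure (d : ℕ) (ϖ : ℝ → ℝ≥0) : Measure (E d) :=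
  volume.withDensity fun v => (ϖ ‖v‖ : ℝ≥0∞)

/-- `Γ₊(x) = {v : v · n(x) > 0}`. -/
def outgoing (Ω : Set (E d)) (x : E d) : Set (E d) :=
  {v | 0 < ⟪v, outwardNormal Ω x⟫}

/-- `Γ₋(x) = {v : v · n(x) < 0}`. -/
def incoming (Ω : Set (E d)) (x : E d) : Set (E d) :=
  {v | ⟪v, outwardNormal Ω x⟫ < 0}

/-- `Γ₊ = {(x, v) : x ∈ ∂Ω, v · n(x) > 0}`. -/
def GammaPlus (Ω : Set (E d)) : Set (E d × E d) :=
  {p | p.1 ∈ frontier Ω ∧ p.2 ∈ outgoing Ω p.1}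

/-- `Γ₋ = {(x, v) : x ∈ ∂Ω, v · n(x) < 0}`. -/
def GammaMinus (Ω : Set (E d)) : Set (E d × E d) :=
  {p | p.1 ∈ frontier Ω ∧ p.2 ∈ incoming Ω p.1}

/-- `μ_x(dv) = |v · n(x)| m(dv)`. -/
def fluxMeasure (Ω : Set (E d)) (m : Measure (E d)) (x : E d) : Measure (E d) :=
  m.withDensity fun v => ENNReal.ofReal |⟪v, outwardNormal Ω x⟫|

/-- `μ(dx, dv) = |v · n(x)| π(dx) ⊗ m(dv)`. -/
def boundaryFlux (Ω : Set (E d)) (m : Measure (E d)) : Measure (E d × E d) :=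
  ((surfaceMeasure Ω).prod m).withDensity fun p =>
    ENNReal.ofReal |⟪p.2, outwardNormal Ω p.1⟫|

/-- `μ₊`: the measure `μ` on `Γ₊`. -/
def fluxPlus (Ω : Set (E d)) (m : Measure (E d)) : Measure (E d × E d) :=
  (boundaryFlux Ω m).restrict (GammaPlus Ω)

/-- `μ₋`: the measure `μ` on `Γ₋`. -/
def fluxMinus (Ω : Set (E d)) (m : Measure (E d)) : Measure (E d × E d) :=
  (boundaryFlux Ω m).restrict (GammaMinus Ω)

/-- The trace space `L¹₊ = L¹(Γ₊, dμ₊)`. -/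
abbrev L1Plus (Ω : Set (E d)) (m : Measure (E d)) := Lp ℂ 1 (fluxPlus Ω m)

/-- The trace space `L¹₋ = L¹(Γ₋, dμ₋)`. -/
abbrev L1Minus (Ω : Set (E d)) (m : Measure (E d)) := Lp ℂ 1 (fluxMinus Ω m)

/-! ### Operators -/

/-- `M` is the operator `M_λ : L¹₋ → L¹₊`,
`(M_λ u)(x, v) = u(x - τ₋(x, v) v, v) exp (-λ τ₋(x, v))`,
the formula being valid for every representative `f` of the class `u`. -/
def IsTransferOperator (Ω : Set (E d)) (m : Measure (E d)) (l : ℂ)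
    (M : L1Minus Ω m →L[ℂ] L1Plus Ω m) : Prop :=
  ∀ (u : L1Minus Ω m) (f : E d × E d → ℂ), u =ᵐ[fluxMinus Ω m] f →
    M u =ᵐ[fluxPlus Ω m] fun p =>
      f (p.1 - travelTime Ω p.1 p.2 • p.2, p.2) * Complex.exp (-l * (travelTime Ω p.1 p.2 : ℂ))

/-- `H : L¹₊ → L¹₋` is a stochastic diffuse boundary operator with kernel `h(x, v, v')`. -/
structure IsStochasticDiffuse (Ω : Set (E d)) (m : Measure (E d)) (h : E d → E d → E d → ℝ)
    (H : L1Plus Ω m →L[ℂ] L1Minus Ω m) : Prop where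
  measurable : Measurable fun p : E d × E d × E d => h p.1 p.2.1 p.2.2
  nonneg : ∀ x v v', 0 ≤ h x v v'
  integral_eq_one : ∀ x ∈ frontier Ω, ∀ᵐ v' ∂m, v' ∈ outgoing Ω x →
    ∫ v in incoming Ω x, h x v v' ∂(fluxMeasure Ω m x) = 1
  apply_eq : ∀ ψ : L1Plus Ω m, H ψ =ᵐ[fluxMinus Ω m] fun p =>
    ∫ v' in outgoing Ω p.1, h p.1 p.2 v' • ψ (p.1, v') ∂(fluxMeasure Ω m p.1)

/-- The kernel `k(x, v, v') = |v · n(x)| h(x, v, v')`. -/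
def kernelK (Ω : Set (E d)) (h : E d → E d → E d → ℝ) (x v v' : E d) : ℝ :=
  |⟪v, outwardNormal Ω x⟫| * h x v v'

/-- `T` is the integral operator on `L¹(m)` with kernel `κ(v, v')`. -/
def IsIntegralOperator (m : Measure (E d)) (κ : E d → E d → ℝ)
    (T : Lp ℂ 1 m →L[ℂ] Lp ℂ 1 m) : Prop :=
  ∀ ψ : Lp ℂ 1 m,
    (∀ᵐ v ∂m, Integrable (fun v' => κ v v' • ψ v') m) ∧
      T ψ =ᵐ[m] fun v => ∫ v', κ v v' • ψ v' ∂m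

/-- The family `{K(x) : x ∈ S}` is collectively compact: the union of the images of the unit ball is
relatively compact. -/
def CollectivelyCompact {α X : Type*} [NormedAddCommGroup X] [NormedSpace ℂ X]
    (S : Set α) (K : α → X →L[ℂ] X) : Prop :=
  IsCompact (closure (⋃ x ∈ S, K x '' Metric.closedBall (0 : X) 1))

/-- `g = T* ψ`, for the adjoint `T* : L^∞(m) → L^∞(m)` of a bounded operator `T` on `L¹(m)`. -/
def IsAdjointImage {m : Measure (E d)} (T : Lp ℂ 1 m →L[ℂ] Lp ℂ 1 m) (ψ g : Lp ℂ ∞ m) : Prop :=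
  ∀ φ : Lp ℂ 1 m, ∫ v, T φ v * ψ v ∂m = ∫ v, φ v * g v ∂m

/-- For every `ψ ∈ L^∞(m)`, the set `{K(x)* ψ : x ∈ S}` is relatively compact in `L^∞(m)`. -/
def DualImagesRelCompact {α : Type*} {m : Measure (E d)} (S : Set α)
    (K : α → Lp ℂ 1 m →L[ℂ] Lp ℂ 1 m) : Prop :=
  ∀ ψ : Lp ℂ ∞ m, IsCompact (closure {g : Lp ℂ ∞ m | ∃ x ∈ S, IsAdjointImage (K x) ψ g})

end Kinetic

end

noncomputable section

namespace Kinetic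

variable {d : ℕ}

/-! ### The outward normal -/

namespace IsDefiningFunction

variable {Ω : Set (E d)} {x : E d} {φ ψ : E d → ℝ}

theorem hasFDerivAt (h : IsDefiningFunction Ω x φ) : HasFDerivAt φ (fderiv ℝ φ x) x :=
  (h.contDiffAt.differentiableAt one_ne_zero).hasFDerivAt

theorem hasDerivAt_line (h : IsDefiningFunction Ω x φ) (v : E d) :
    HasDerivAt (fun t : ℝ => φ (x + t • v)) ⟪v, gradient φ x⟫ 0 := by
  have h1 : HasDerivAt (fun t : ℝ => x + t • v) v 0 := by
    simpa using ((hasDerivAt_id (0 : ℝ)).smul_const v).const_add x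
  have h2 : HasFDerivAt φ (fderiv ℝ φ x) (x + (0 : ℝ) • v) := by simpa using h.hasFDerivAt
  have h3 := h2.comp_hasDerivAt (0 : ℝ) h1
  have h4 : ⟪v, gradient φ x⟫ = fderiv ℝ φ x v := by
    rw [real_inner_comm, ← toDual_gradient, InnerProductSpace.toDual_apply_apply]
  rw [h4]
  exact h3

theorem tendsto_line (x v : E d) : Tendsto (fun t : ℝ => x + t • v) (𝓝[>] 0) (𝓝 x) := by
  have : Continuous fun t : ℝ => x + t • v := by fun_prop
  simpa using (this.tendsto 0).mono_left nhdsWithin_le_nhds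

theorem eventually_mem (h : IsDefiningFunction Ω x φ) {v : E d} (hv : ⟪v, gradient φ x⟫ < 0) :
    ∀ᶠ t in 𝓝[>] (0 : ℝ), x + t • v ∈ Ω := by
  have h1 := (hasDerivAt_iff_tendsto_slope.1 (h.hasDerivAt_line v)).mono_left
    (nhdsWithin_mono (0 : ℝ) (fun t (ht : 0 < t) => ht.ne'))
  filter_upwards [h1.eventually_lt_const hv, (tendsto_line x v).eventually h.mem_iff,
    self_mem_nhdsWithin] with t ht1 ht2 ht3
  rw [ht2]
  simp only [slope, zero_smul, add_zero, h.map_eq_zero, vsub_eq_sub, sub_zero, smul_eq_mul] at ht1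
  have ht3 : 0 < t := ht3
  by_contra! hc
  have : 0 ≤ t⁻¹ * φ (x + t • v) := by positivity
  linarith

theorem eventually_notMem (h : IsDefiningFunction Ω x φ) {v : E d} (hv : 0 < ⟪v, gradient φ x⟫) :
    ∀ᶠ t in 𝓝[>] (0 : ℝ), x + t • v ∉ Ω := by
  have h1 := (hasDerivAt_iff_tendsto_slope.1 (h.hasDerivAt_line v)).mono_left
    (nhdsWithin_mono (0 : ℝ) (fun t (ht : 0 < t) => ht.ne'))
  filter_upwards [h1.eventually_const_lt hv, (tendsto_line x v).eventually h.mem_iff,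
    self_mem_nhdsWithin] with t ht1 ht2 ht3
  rw [ht2]
  simp only [slope, zero_smul, add_zero, h.map_eq_zero, vsub_eq_sub, sub_zero, smul_eq_mul] at ht1
  have ht3 : 0 < t := ht3
  intro hc
  have : t⁻¹ * φ (x + t • v) ≤ 0 := mul_nonpos_of_nonneg_of_nonpos (by positivity) hc.le
  linarith

theorem normalized_gradient_eq (h : IsDefiningFunction Ω x φ) (h' : IsDefiningFunction Ω x ψ) :
    ‖gradient φ x‖⁻¹ • gradient φ x = ‖gradient ψ x‖⁻¹ • gradient ψ x := by
  have ha := h.gradient_ne_zero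
  have hb := h'.gradient_ne_zero
  set a := gradient φ x with hadef
  set b := gradient ψ x with hbdef
  have hapos : 0 < ‖a‖ := norm_pos_iff.2 ha
  have key : ∀ v : E d, ⟪v, a⟫ < 0 → ⟪v, b⟫ ≤ 0 := by
    intro v hv
    by_contra! hc
    obtain ⟨t, ht1, ht2⟩ := ((h.eventually_mem hv).and (h'.eventually_notMem hc)).exists
    exact ht2 ht1
  have key' : ∀ v : E d, ⟪v, a⟫ ≤ 0 → ⟪v, b⟫ ≤ 0 := by
    intro v hv
    have hc : Tendsto (fun t : ℝ => ⟪v - t • a, b⟫) (𝓝[>] 0) (𝓝 ⟪v, b⟫) := by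
      have : Continuous fun t : ℝ => ⟪v - t • a, b⟫ := by fun_prop
      simpa using (this.tendsto 0).mono_left nhdsWithin_le_nhds
    refine le_of_tendsto hc ?_
    filter_upwards [self_mem_nhdsWithin] with t ht
    apply key
    have ht : 0 < t := ht
    rw [inner_sub_left, inner_smul_left, real_inner_self_eq_norm_sq]
    simp only [conj_trivial]
    have : 0 < t * ‖a‖ ^ 2 := by positivity
    linarith
  set c : ℝ := ⟪b, a⟫ / ‖a‖ ^ 2 with hc
  have hperp : ⟪b - c • a, a⟫ = 0 := by
    rw [inner_sub_left, inner_smul_left, real_inner_self_eq_norm_sq, hc]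
    simp only [conj_trivial]
    field_simp
    ring
  have h1 := key' (b - c • a) hperp.le
  have h2 := key' (-(b - c • a)) (by rw [inner_neg_left, hperp, neg_zero])
  rw [inner_neg_left] at h2
  have h3 : ⟪b - c • a, b - c • a⟫ = 0 := by
    rw [inner_sub_right, inner_smul_right, hperp]
    linarith
  have hbc : b = c • a := sub_eq_zero.1 (inner_self_eq_zero.1 h3)
  have hc0 : 0 ≤ c := by
    have h4 := key' (-a) (by
      rw [inner_neg_left, real_inner_self_eq_norm_sq]
      have := sq_nonneg ‖a‖
      linarith)
    rw [inner_neg_left, real_inner_comm] at h4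
    exact div_nonneg (by linarith) (by positivity)
  have hcpos : 0 < c := lt_of_le_of_ne hc0 (fun h0 => hb (by rw [hbc, ← h0, zero_smul]))
  rw [hbc, norm_smul, smul_smul, Real.norm_of_nonneg hc0]
  congr 1
  field_simp

theorem outwardNormal_eq (h : IsDefiningFunction Ω x φ) :
    outwardNormal Ω x = ‖gradient φ x‖⁻¹ • gradient φ x := by
  have hex : ∃ φ, IsDefiningFunction Ω x φ := ⟨φ, h⟩
  rw [outwardNormal, dif_pos hex]
  exact hex.choose_spec.normalized_gradient_eq h

theorem inner_outwardNormal (h : IsDefiningFunction Ω x φ) (v : E d) :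
    ⟪v, outwardNormal Ω x⟫ = ‖gradient φ x‖⁻¹ * ⟪v, gradient φ x⟫ := by
  rw [h.outwardNormal_eq, inner_smul_right]

theorem inner_gradient (φ : E d → ℝ) (x v : E d) : ⟪v, gradient φ x⟫ = fderiv ℝ φ x v := by
  rw [real_inner_comm, ← toDual_gradient, InnerProductSpace.toDual_apply_apply]

theorem inner_outwardNormal_neg_iff (h : IsDefiningFunction Ω x φ) (v : E d) :
    ⟪v, outwardNormal Ω x⟫ < 0 ↔ ⟪v, gradient φ x⟫ < 0 := by
  rw [h.inner_outwardNormal]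
  have hp := inv_pos.2 (norm_pos_iff.2 h.gradient_ne_zero)
  refine ⟨fun h1 => ?_, fun h1 => mul_neg_of_pos_of_neg hp h1⟩
  by_contra! hc
  exact absurd (mul_nonneg hp.le hc) (not_le.2 h1)

theorem inner_outwardNormal_pos_iff (h : IsDefiningFunction Ω x φ) (v : E d) :
    0 < ⟪v, outwardNormal Ω x⟫ ↔ 0 < ⟪v, gradient φ x⟫ := by
  rw [h.inner_outwardNormal]
  exact mul_pos_iff_of_pos_left (inv_pos.2 (norm_pos_iff.2 h.gradient_ne_zero))

theorem mem_frontier (hΩ : IsOpen Ω) (h : IsDefiningFunction Ω x φ) : x ∈ frontier Ω := by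
  rw [hΩ.frontier_eq]
  refine ⟨?_, fun hx => ?_⟩
  · have h1 := h.eventually_mem (v := -gradient φ x) (by
      rw [inner_neg_left, real_inner_self_eq_norm_sq]
      have := norm_pos_iff.2 h.gradient_ne_zero
      have : 0 < ‖gradient φ x‖ ^ 2 := by positivity
      linarith)
    exact mem_closure_of_tendsto (tendsto_line x _) h1
  · have := h.mem_iff.self_of_nhds.1 hx
    rw [h.map_eq_zero] at this
    exact this.false

theorem eventually_eq_zero (hΩ : IsOpen Ω) (h : IsDefiningFunction Ω x φ) :
    ∀ᶠ y in 𝓝 x, y ∈ frontier Ω → φ y = 0 := by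
  have h1 : ∀ᶠ y in 𝓝 x, ContinuousAt φ y :=
    (h.contDiffAt.eventually (by simp)).mono fun y hy => hy.continuousAt
  filter_upwards [h1, h.mem_iff.eventually_nhds] with y hy1 hy2 hy3
  rw [hΩ.frontier_eq] at hy3
  refine le_antisymm ?_ ?_
  · by_contra! hc
    have h2 : ∀ᶠ z in 𝓝 y, z ∉ Ω := by
      filter_upwards [hy2, hy1.eventually (lt_mem_nhds hc)] with z hz1 hz2
      rw [hz1]
      exact not_lt.2 (le_of_lt hz2)
    exact (mem_closure_iff_frequently.1 hy3.1) h2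
  · by_contra! hc
    exact hy3.2 (hy2.self_of_nhds.2 hc)

theorem continuousAt_fderiv (h : IsDefiningFunction Ω x φ) : ContinuousAt (fderiv ℝ φ) x :=
  (h.contDiffAt.fderiv_right (m := 0) (by simp)).continuousAt

theorem continuousAt_gradient (h : IsDefiningFunction Ω x φ) : ContinuousAt (gradient φ) x :=
  (InnerProductSpace.toDual ℝ (E d)).symm.continuous.continuousAt.comp h.continuousAt_fderiv

theorem eventually (h : IsDefiningFunction Ω x φ) :
    ∀ᶠ y in 𝓝 x, φ y = 0 → IsDefiningFunction Ω y φ := by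
  filter_upwards [h.contDiffAt.eventually (by simp), h.mem_iff.eventually_nhds,
    h.continuousAt_gradient.eventually_ne h.gradient_ne_zero] with y h1 h2 h3 h4
  exact ⟨h1, h4, h3, h2⟩

theorem continuousWithinAt_outwardNormal (hΩ : IsOpen Ω) (h : IsDefiningFunction Ω x φ) :
    ContinuousWithinAt (outwardNormal Ω) (frontier Ω) x := by
  have h1 : ContinuousAt (fun y => ‖gradient φ y‖⁻¹ • gradient φ y) x :=
    (h.continuousAt_gradient.norm.inv₀ (norm_ne_zero_iff.2 h.gradient_ne_zero)).smul
      h.continuousAt_gradient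
  refine h1.continuousWithinAt.congr_of_eventuallyEq ?_ h.outwardNormal_eq
  rw [EventuallyEq, eventually_nhdsWithin_iff]
  filter_upwards [h.eventually, h.eventually_eq_zero hΩ] with y h1 h2 h3
  exact (h1 (h2 h3)).outwardNormal_eq

end IsDefiningFunction

section Normal

variable {Ω : Set (E d)}

theorem continuousOn_outwardNormal (hΩ : IsOpen Ω) (hC : HasC1Boundary Ω) :
    ContinuousOn (outwardNormal Ω) (frontier Ω) := fun x hx => by
  obtain ⟨φ, hφ⟩ := hC x hx
  exact hφ.continuousWithinAt_outwardNormal hΩ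

theorem outwardNormal_eq_zero (hΩ : IsOpen Ω) {x : E d} (hx : x ∉ frontier Ω) :
    outwardNormal Ω x = 0 := by
  rw [outwardNormal, dif_neg]
  rintro ⟨φ, hφ⟩
  exact hx (hφ.mem_frontier hΩ)

theorem measurable_outwardNormal (hΩ : IsOpen Ω) (hC : HasC1Boundary Ω) :
    Measurable (outwardNormal Ω) := by
  classical
  have h : outwardNormal Ω = (frontier Ω).piecewise (outwardNormal Ω) (fun _ => 0) := by
    ext1 x
    by_cases hx : x ∈ frontier Ω
    · simp [hx]
    · simp [hx, outwardNormal_eq_zero hΩ hx]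
  rw [h]
  exact (continuousOn_outwardNormal hΩ hC).measurable_piecewise continuousOn_const
    isClosed_frontier.measurableSet

theorem norm_outwardNormal (hC : HasC1Boundary Ω) {x : E d} (hx : x ∈ frontier Ω) :
    ‖outwardNormal Ω x‖ = 1 := by
  obtain ⟨φ, hφ⟩ := hC x hx
  rw [hφ.outwardNormal_eq, norm_smul, norm_inv, norm_norm]
  exact inv_mul_cancel₀ (norm_ne_zero_iff.2 hφ.gradient_ne_zero)

theorem eventually_mem_of_inner_neg (hC : HasC1Boundary Ω) {x v : E d} (hx : x ∈ frontier Ω)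
    (hv : ⟪v, outwardNormal Ω x⟫ < 0) : ∀ᶠ t in 𝓝[>] (0 : ℝ), x + t • v ∈ Ω := by
  obtain ⟨φ, hφ⟩ := hC x hx
  exact hφ.eventually_mem ((hφ.inner_outwardNormal_neg_iff v).1 hv)

theorem eventually_notMem_of_inner_pos (hC : HasC1Boundary Ω) {x v : E d} (hx : x ∈ frontier Ω)
    (hv : 0 < ⟪v, outwardNormal Ω x⟫) : ∀ᶠ t in 𝓝[>] (0 : ℝ), x + t • v ∉ Ω := by
  obtain ⟨φ, hφ⟩ := hC x hx
  exact hφ.eventually_notMem ((hφ.inner_outwardNormal_pos_iff v).1 hv)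

end Normal

/-! ### The travel time -/

section TravelTime

variable {Ω : Set (E d)}

theorem travelTime_bddBelow (x v : E d) : BddBelow {s : ℝ | 0 < s ∧ x - s • v ∉ Ω} :=
  ⟨0, fun _ hs => hs.1.le⟩

theorem travelTime_nonneg (x v : E d) : 0 ≤ travelTime Ω x v :=
  Real.sInf_nonneg fun _ hs => hs.1.le

theorem travelTime_set_nonempty (hb : Bornology.IsBounded Ω) (x : E d) {v : E d} (hv : v ≠ 0) :
    {s : ℝ | 0 < s ∧ x - s • v ∉ Ω}.Nonempty := by
  obtain ⟨R, hR⟩ := hb.subset_closedBall x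
  have hv' : 0 < ‖v‖ := norm_pos_iff.2 hv
  refine ⟨(|R| + 1) / ‖v‖, by positivity, fun hmem => ?_⟩
  have h1 := hR hmem
  rw [Metric.mem_closedBall, dist_eq_norm, sub_sub_cancel_left, norm_neg, norm_smul,
    Real.norm_of_nonneg (by positivity), div_mul_cancel₀ _ hv'.ne'] at h1
  have := le_abs_self R
  linarith

open scoped Pointwise in
theorem travelTime_smul (x v : E d) {c : ℝ} (hc : 0 < c) :
    travelTime Ω x (c • v) = travelTime Ω x v / c := by
  have h : {s : ℝ | 0 < s ∧ x - s • c • v ∉ Ω} = c⁻¹ • {s : ℝ | 0 < s ∧ x - s • v ∉ Ω} := by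
    ext s
    rw [Set.mem_inv_smul_set_iff₀ hc.ne']
    simp [smul_smul, mul_comm s c, hc]
  rw [travelTime, h, Real.sInf_smul_of_nonneg (by positivity), travelTime, smul_eq_mul,
    div_eq_inv_mul]

theorem sub_travelTime_smul (x v : E d) {c : ℝ} (hc : 0 < c) :
    x - travelTime Ω x (c • v) • c • v = x - travelTime Ω x v • v := by
  rw [travelTime_smul x v hc, smul_smul, div_mul_cancel₀ _ hc.ne']

theorem travelTime_zero_right (x : E d) : travelTime Ω x 0 = 0 := by
  rw [travelTime]
  by_cases hx : x ∈ Ω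
  · simp [hx]
  · have : {s : ℝ | 0 < s ∧ x - s • (0 : E d) ∉ Ω} = Set.Ioi 0 := by
      ext s; simp [hx]
    rw [this, csInf_Ioi]

theorem mem_of_lt_travelTime {x v : E d} {s : ℝ} (hs : 0 < s) (hs' : s < travelTime Ω x v) :
    x - s • v ∈ Ω := by
  by_contra hc
  exact absurd (csInf_le (travelTime_bddBelow x v) ⟨hs, hc⟩) (not_le.2 hs')

theorem travelTime_pos (hb : Bornology.IsBounded Ω) (hC : HasC1Boundary Ω) {x v : E d}
    (hx : x ∈ frontier Ω) (hv : 0 < ⟪v, outwardNormal Ω x⟫) : 0 < travelTime Ω x v := by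
  have hv0 : v ≠ 0 := by rintro rfl; simp at hv
  have h1 := eventually_mem_of_inner_neg hC hx (v := -v) (by rw [inner_neg_left]; linarith)
  obtain ⟨t, ht, ht'⟩ := mem_nhdsGT_iff_exists_Ioo_subset.1 h1
  have ht : 0 < t := ht
  refine lt_of_lt_of_le ht (le_csInf (travelTime_set_nonempty hb x hv0) fun s hs => ?_)
  by_contra! hc
  have := ht' ⟨hs.1, hc⟩
  simp only [Set.mem_ofPred_eq, smul_neg, ← sub_eq_add_neg] at this
  exact hs.2 this

theorem sub_travelTime_notMem (hΩ : IsOpen Ω) (hb : Bornology.IsBounded Ω) {x v : E d}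
    (hv : v ≠ 0) : x - travelTime Ω x v • v ∉ Ω := by
  intro hmem
  have hcont : Continuous fun s : ℝ => x - s • v := by fun_prop
  obtain ⟨t, ht, ht'⟩ := exists_Ico_subset_of_mem_nhds
    ((hΩ.preimage hcont).mem_nhds hmem) (exists_gt (travelTime Ω x v))
  have h1 : t ≤ travelTime Ω x v := le_csInf (travelTime_set_nonempty hb x hv) fun s hs => by
    by_contra! hc
    rcases lt_or_ge s (travelTime Ω x v) with h2 | h2
    · exact hs.2 (mem_of_lt_travelTime hs.1 h2)
    · exact hs.2 (ht' ⟨h2, hc⟩)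
  exact absurd ht (not_lt.2 h1)

theorem sub_travelTime_mem_closure {x v : E d} (hpos : 0 < travelTime Ω x v) :
    x - travelTime Ω x v • v ∈ closure Ω := by
  have hcont : Continuous fun s : ℝ => x - s • v := by fun_prop
  have h1 : Tendsto (fun s : ℝ => x - s • v) (𝓝[<] travelTime Ω x v)
      (𝓝 (x - travelTime Ω x v • v)) := (hcont.tendsto _).mono_left nhdsWithin_le_nhds
  refine mem_closure_of_tendsto h1 ?_
  filter_upwards [Ioo_mem_nhdsLT hpos] with s hs
  exact mem_of_lt_travelTime hs.1 hs.2

/-- The foot of the backward characteristic issued from `(x, v)`. -/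
def backFoot (Ω : Set (E d)) (x v : E d) : E d := x - travelTime Ω x v • v

theorem backFoot_mem_frontier (hΩ : IsOpen Ω) (hb : Bornology.IsBounded Ω) (hC : HasC1Boundary Ω)
    {x v : E d} (hx : x ∈ frontier Ω) (hv : 0 < ⟪v, outwardNormal Ω x⟫) :
    backFoot Ω x v ∈ frontier Ω := by
  have hv0 : v ≠ 0 := by rintro rfl; simp at hv
  have hpos := travelTime_pos hb hC hx hv
  rw [hΩ.frontier_eq]
  exact ⟨sub_travelTime_mem_closure hpos, sub_travelTime_notMem hΩ hb hv0⟩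

theorem inner_outwardNormal_backFoot_nonpos (hΩ : IsOpen Ω) (hb : Bornology.IsBounded Ω)
    (hC : HasC1Boundary Ω) {x v : E d} (hx : x ∈ frontier Ω)
    (hv : 0 < ⟪v, outwardNormal Ω x⟫) : ⟪v, outwardNormal Ω (backFoot Ω x v)⟫ ≤ 0 := by
  by_contra! hc
  have hpos := travelTime_pos hb hC hx hv
  have h1 := eventually_notMem_of_inner_pos hC (backFoot_mem_frontier hΩ hb hC hx hv) hc
  obtain ⟨t, ht, ht'⟩ := (h1.and (Ioo_mem_nhdsGT hpos)).exists
  refine ht ?_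
  have h2 : backFoot Ω x v + t • v = x - (travelTime Ω x v - t) • v := by
    rw [backFoot, sub_smul]; abel
  rw [h2]
  exact mem_of_lt_travelTime (by linarith [ht'.2]) (by linarith [ht'.1])

theorem travelTime_backFoot_neg (hΩ : IsOpen Ω) (hb : Bornology.IsBounded Ω)
    (hC : HasC1Boundary Ω) {x v : E d} (hx : x ∈ frontier Ω)
    (hv : 0 < ⟪v, outwardNormal Ω x⟫) :
    travelTime Ω (backFoot Ω x v) (-v) = travelTime Ω x v := by
  have hv0 : v ≠ 0 := by rintro rfl; simp at hv
  have hpos := travelTime_pos hb hC hx hv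
  have hx' : x ∉ Ω := by rw [hΩ.frontier_eq] at hx; exact hx.2
  refine le_antisymm (csInf_le (travelTime_bddBelow _ _) ⟨hpos, ?_⟩)
    (le_csInf (travelTime_set_nonempty hb _ (neg_ne_zero.2 hv0)) fun s hs => ?_)
  · simpa [backFoot] using hx'
  · by_contra! hc
    refine hs.2 ?_
    have h2 : backFoot Ω x v - s • -v = x - (travelTime Ω x v - s) • v := by
      rw [backFoot, sub_smul, smul_neg]; abel
    rw [h2]
    exact mem_of_lt_travelTime (by linarith) (by linarith [hs.1])

theorem measurable_travelTime (hΩ : IsOpen Ω) (hb : Bornology.IsBounded Ω) :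
    Measurable fun p : E d × E d => travelTime Ω p.1 p.2 := by
  refine measurable_of_Iio fun c => ?_
  have h : (fun p : E d × E d => travelTime Ω p.1 p.2) ⁻¹' Set.Iio c =
      ({p | p.2 = 0} ∩ {_p | 0 < c}) ∪ ({p | p.2 ≠ 0} ∩
        ⋃ n : ℕ, {p | ∃ s ∈ Set.Icc (1 / (n + 1 : ℝ)) (c - 1 / (n + 1 : ℝ)), p.1 - s • p.2 ∉ Ω}) := by
    ext ⟨x, v⟩
    simp only [Set.mem_preimage, Set.mem_Iio, Set.mem_union, Set.mem_inter_iff, Set.mem_ofPred_eq,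
      Set.mem_iUnion]
    by_cases hv : v = 0
    · subst hv
      simp [travelTime_zero_right]
    · simp only [hv, false_and, ne_eq, not_false_eq_true, true_and, false_or]
      constructor
      · intro hlt
        obtain ⟨s, hs, hsc⟩ := exists_lt_of_csInf_lt (travelTime_set_nonempty hb x hv) hlt
        obtain ⟨n, hn⟩ := exists_nat_one_div_lt (lt_min hs.1 (sub_pos.2 hsc))
        exact ⟨n, s, ⟨(hn.trans_le (min_le_left _ _)).le,
          by linarith [hn.trans_le (min_le_right s (c - s))]⟩, hs.2⟩
      · rintro ⟨n, s, ⟨hs1, hs2⟩, hs3⟩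
        have hn : (0 : ℝ) < 1 / (n + 1 : ℝ) := by positivity
        exact (csInf_le (travelTime_bddBelow x v) ⟨hn.trans_le hs1, hs3⟩).trans_lt (by linarith)
  rw [h]
  have h0 : MeasurableSet {p : E d × E d | p.2 = 0} :=
    measurable_snd (measurableSet_singleton 0)
  refine (h0.inter (MeasurableSet.const _)).union (h0.compl.inter (MeasurableSet.iUnion fun n => ?_))
  refine IsClosed.measurableSet ?_
  have h1 : {p : E d × E d | ∃ s ∈ Set.Icc (1 / (n + 1 : ℝ)) (c - 1 / (n + 1 : ℝ)),
      p.1 - s • p.2 ∉ Ω} = Prod.snd '' ((fun q : Set.Icc (1 / (n + 1 : ℝ)) (c - 1 / (n + 1 : ℝ)) ×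
        (E d × E d) => q.2.1 - (q.1 : ℝ) • q.2.2) ⁻¹' Ωᶜ) := by
    ext p
    simp
  rw [h1]
  refine isClosedMap_snd_of_compactSpace _ (hΩ.isClosed_compl.preimage ?_)
  fun_prop

theorem measurable_backFoot (hΩ : IsOpen Ω) (hb : Bornology.IsBounded Ω) :
    Measurable fun p : E d × E d => backFoot Ω p.1 p.2 :=
  measurable_fst.sub ((measurable_travelTime hΩ hb).smul measurable_snd)

end TravelTime

/-! ### Charts of the boundary -/

/-- The parameter space of a hypersurface in `ℝ^d`. -/
abbrev W (d : ℕ) : Type := Fin (d - 1) → ℝ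

/-- The derivative, in the coordinates `e`, of the cylinder map `(z, t) ↦ γ z + t v`, where `A` is
the derivative of `γ`. -/
def cylinderDeriv (e : E d ≃L[ℝ] W d × ℝ) (A : W d →L[ℝ] E d) (v : E d) :
    W d × ℝ →L[ℝ] W d × ℝ :=
  (e : E d →L[ℝ] W d × ℝ).comp (A.comp (ContinuousLinearMap.fst ℝ (W d) ℝ) +
    (ContinuousLinearMap.snd ℝ (W d) ℝ).smulRight v)

/-- A bi-Lipschitz differentiable parametrization `γ : Z → U ∩ ∂Ω` for which the Jacobian of
`(z, t) ↦ γ z + t v` is comparable to `|v · n(γ z)|`. -/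
structure BoundaryChart (Ω : Set (E d)) where
  U : Set (E d)
  Z : Set (W d)
  γ : W d → E d
  γ' : W d → W d →L[ℝ] E d
  K : ℝ≥0
  e : E d ≃L[ℝ] W d × ℝ
  c : ℝ≥0
  isOpen_U : IsOpen U
  isOpen_Z : IsOpen Z
  bijOn : Set.BijOn γ Z (U ∩ frontier Ω)
  hasFDerivAt : ∀ z ∈ Z, HasFDerivAt γ (γ' z) z
  lipschitz : LipschitzOnWith K γ Z
  dist_le : ∀ z ∈ Z, ∀ z' ∈ Z, dist z z' ≤ K * dist (γ z) (γ z')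
  det_le : ∀ z ∈ Z, ∀ v, |(cylinderDeriv e (γ' z) v).det| ≤ c * |⟪v, outwardNormal Ω (γ z)⟫|
  le_det : ∀ z ∈ Z, ∀ v, |⟪v, outwardNormal Ω (γ z)⟫| ≤ c * |(cylinderDeriv e (γ' z) v).det|

theorem exists_continuousLinearEquiv_snd_eq (hd : 1 ≤ d) (l : E d →L[ℝ] ℝ) (hl : l ≠ 0) :
    ∃ e : E d ≃L[ℝ] W d × ℝ, ∀ x, (e x).2 = l x := by
  obtain ⟨w, hw⟩ : ∃ w, l w = 1 := by
    obtain ⟨u, hu⟩ := DFunLike.ne_iff.1 hl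
    exact ⟨(l u)⁻¹ • u, by simpa using inv_mul_cancel₀ hu⟩
  have hsurj : Function.Surjective (l : E d →ₗ[ℝ] ℝ) := fun t => ⟨t • w, by simp [hw]⟩
  have hfin : Module.finrank ℝ (LinearMap.ker (l : E d →ₗ[ℝ] ℝ)) = Module.finrank ℝ (W d) := by
    have h1 := LinearMap.finrank_range_add_finrank_ker (l : E d →ₗ[ℝ] ℝ)
    rw [LinearMap.range_eq_top.2 hsurj, finrank_top] at h1
    simp only [Module.finrank_self, finrank_euclideanSpace, Fintype.card_fin,
      Module.finrank_pi] at h1 ⊢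
    omega
  let κ := LinearEquiv.ofFinrankEq _ _ hfin
  let f : E d ≃ₗ[ℝ] W d × ℝ :=
    { toFun := fun x => (κ ⟨x - l x • w, by simp [hw]⟩, l x)
      map_add' := fun x y => by
        refine Prod.ext ?_ (map_add l x y)
        rw [Prod.fst_add, ← map_add]
        refine congrArg κ (Subtype.ext ?_)
        simp only [map_add, add_smul, Submodule.coe_add]
        abel
      map_smul' := fun c x => by
        refine Prod.ext ?_ (map_smul l c x)
        rw [RingHom.id_apply, Prod.smul_fst, ← map_smul κ]
        refine congrArg κ (Subtype.ext ?_)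
        simp [smul_sub, smul_smul]
      invFun := fun p => (κ.symm p.1 : E d) + p.2 • w
      left_inv := fun x => by simp
      right_inv := fun p => by
        have h0 : l (κ.symm p.1 : E d) = 0 := (κ.symm p.1).2
        ext1
        · simp [h0, hw]
        · simp [h0, hw] }
  exact ⟨f.toContinuousLinearEquiv, fun x => rfl⟩

theorem det_id_add_smulRight (b : W d × ℝ) :
    ((ContinuousLinearMap.inl ℝ (W d) ℝ).comp (ContinuousLinearMap.fst ℝ (W d) ℝ) +
      (ContinuousLinearMap.snd ℝ (W d) ℝ).smulRight b).det = b.2 := by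
  have h := LinearMap.transvection.det (LinearMap.snd ℝ (W d) ℝ) (b - (0, 1))
  have h1 : (((ContinuousLinearMap.inl ℝ (W d) ℝ).comp (ContinuousLinearMap.fst ℝ (W d) ℝ) +
      (ContinuousLinearMap.snd ℝ (W d) ℝ).smulRight b : W d × ℝ →L[ℝ] W d × ℝ) :
      W d × ℝ →ₗ[ℝ] W d × ℝ) = LinearMap.transvection (LinearMap.snd ℝ (W d) ℝ) (b - (0, 1)) := by
    refine LinearMap.ext fun p => ?_
    rw [LinearMap.transvection.apply]
    ext1
    · simp
    · simp [mul_sub]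
  rw [ContinuousLinearMap.det, h1, h]
  simp

theorem det_cylinderDeriv_comp (e : E d ≃L[ℝ] W d × ℝ) (L : W d × ℝ →L[ℝ] E d)
    (D : E d →L[ℝ] W d × ℝ) (hLD : L.comp D = ContinuousLinearMap.id ℝ (E d)) (v : E d) :
    (cylinderDeriv e (L.comp (ContinuousLinearMap.inl ℝ (W d) ℝ)) v).det =
      ((e : E d →L[ℝ] W d × ℝ).comp L).det * (D v).2 := by
  have h : cylinderDeriv e (L.comp (ContinuousLinearMap.inl ℝ (W d) ℝ)) v =
      ((e : E d →L[ℝ] W d × ℝ).comp L).comp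
        ((ContinuousLinearMap.inl ℝ (W d) ℝ).comp (ContinuousLinearMap.fst ℝ (W d) ℝ) +
      (ContinuousLinearMap.snd ℝ (W d) ℝ).smulRight (D v)) := by
    refine ContinuousLinearMap.ext fun p => ?_
    have h1 : L (D v) = v := congrArg (fun A : E d →L[ℝ] E d => A v) hLD
    simp [cylinderDeriv, h1]
  rw [h, ← det_id_add_smulRight (D v)]
  exact LinearMap.det_comp _ _

theorem IsDefiningFunction.exists_boundaryChart (hd : 1 ≤ d) {Ω : Set (E d)} (hΩ : IsOpen Ω)
    {x₀ : E d} {φ : E d → ℝ} (h : IsDefiningFunction Ω x₀ φ) :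
    ∃ C : BoundaryChart Ω, x₀ ∈ C.U := by
  have hl : fderiv ℝ φ x₀ ≠ 0 := by
    intro h0
    apply h.gradient_ne_zero
    rw [gradient, h0, map_zero]
  obtain ⟨e, he⟩ := exists_continuousLinearEquiv_snd_eq hd _ hl
  set A : E d →L[ℝ] W d := (ContinuousLinearMap.fst ℝ (W d) ℝ).comp (e : E d →L[ℝ] W d × ℝ) with hA
  set Φ : E d → W d × ℝ := fun x => (A x, φ x) with hΦ
  have hΦd : ∀ y, ContDiffAt ℝ 1 φ y → HasFDerivAt Φ (A.prod (fderiv ℝ φ y)) y := fun y hy =>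
    A.hasFDerivAt.prodMk (hy.differentiableAt one_ne_zero).hasFDerivAt
  have hΦc : ContDiffAt ℝ 1 Φ x₀ := A.contDiff.contDiffAt.prodMk h.contDiffAt
  have heq : A.prod (fderiv ℝ φ x₀) = (e : E d →L[ℝ] W d × ℝ) := by
    refine ContinuousLinearMap.ext fun x => ?_
    ext1
    · simp [hA]
    · simp [he]
  have hΦ0 : HasFDerivAt Φ (e : E d →L[ℝ] W d × ℝ) x₀ := heq ▸ hΦd x₀ h.contDiffAt
  set G := hΦc.toOpenPartialHomeomorph Φ hΦ0 one_ne_zero with hG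
  have hGΦ : ∀ x, G x = Φ x := fun x => rfl
  have hx₀s : x₀ ∈ G.source := hΦc.mem_toOpenPartialHomeomorph_source hΦ0 one_ne_zero
  have hp₀t : Φ x₀ ∈ G.target := hΦc.image_mem_toOpenPartialHomeomorph_target hΦ0 one_ne_zero
  have hsymm0 : G.symm (Φ x₀) = x₀ := G.left_inv hx₀s
  have hΨc : ContDiffAt ℝ 1 G.symm (Φ x₀) := by
    refine G.contDiffAt_symm hp₀t (f₀' := e) ?_ ?_
    · rw [hsymm0]; exact hΦ0
    · rw [hsymm0]; exact hΦc
  obtain ⟨K₁, s, hs, hK₁⟩ := hΦc.exists_lipschitzOnWith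
  obtain ⟨K₂, t, ht, hK₂⟩ := hΨc.exists_lipschitzOnWith
  have hΦcont : ContinuousAt Φ x₀ := hΦc.continuousAt
  have hLD : ∀ y ∈ G.source, ContDiffAt ℝ 1 φ y → ContDiffAt ℝ 1 G.symm (Φ y) →
      (fderiv ℝ G.symm (Φ y)).comp (A.prod (fderiv ℝ φ y)) = ContinuousLinearMap.id ℝ (E d) := by
    intro y hy h1 h2
    have h3 : HasFDerivAt (G.symm ∘ Φ) _ y :=
      (h2.differentiableAt one_ne_zero).hasFDerivAt.comp y (hΦd y h1)
    refine h3.unique ((hasFDerivAt_id y).congr_of_eventuallyEq ?_)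
    filter_upwards [G.open_source.mem_nhds hy] with x hx
    exact G.left_inv hx
  have hdet0 : ((e : E d →L[ℝ] W d × ℝ).comp (fderiv ℝ G.symm (Φ x₀))).det = 1 := by
    have h1 := hLD x₀ hx₀s h.contDiffAt hΨc
    rw [heq] at h1
    have h2 : (e : E d →L[ℝ] W d × ℝ).comp (fderiv ℝ G.symm (Φ x₀)) =
        ContinuousLinearMap.id ℝ (W d × ℝ) := by
      refine ContinuousLinearMap.ext fun p => ?_
      have h3 := congrArg (fun B : E d →L[ℝ] E d => B (e.symm p)) h1
      simp only [ContinuousLinearMap.comp_apply, ContinuousLinearEquiv.coe_coe,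
        ContinuousLinearEquiv.apply_symm_apply, ContinuousLinearMap.id_apply] at h3 ⊢
      rw [h3, ContinuousLinearEquiv.apply_symm_apply]
    rw [h2]
    exact LinearMap.det_id
  have hdetc : ContinuousAt (fun y =>
      |((e : E d →L[ℝ] W d × ℝ).comp (fderiv ℝ G.symm (Φ y))).det|) x₀ := by
    have h1 : ContinuousAt (fderiv ℝ G.symm) (Φ x₀) :=
      (hΨc.fderiv_right (m := 0) (by simp)).continuousAt
    have h2 : ContinuousAt (fun y => fderiv ℝ G.symm (Φ y)) x₀ :=
      ContinuousAt.comp (f := Φ) (g := fderiv ℝ G.symm) h1 hΦcont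
    have h3 : Continuous fun L : W d × ℝ →L[ℝ] E d =>
        |((e : E d →L[ℝ] W d × ℝ).comp L).det| :=
      continuous_abs.comp (ContinuousLinearMap.continuous_det.comp
        (ContinuousLinearMap.postcomp (W d × ℝ) (e : E d →L[ℝ] W d × ℝ)).continuous)
    exact h3.continuousAt.comp h2
  set a := ‖gradient φ x₀‖ with ha
  have hapos : 0 < a := norm_pos_iff.2 h.gradient_ne_zero
  have hgood : ∀ᶠ y in 𝓝 x₀, y ∈ G.source ∧ ContDiffAt ℝ 1 φ y ∧ ContDiffAt ℝ 1 G.symm (Φ y) ∧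
      y ∈ s ∧ Φ y ∈ t ∧ (φ y = 0 → IsDefiningFunction Ω y φ) ∧ (y ∈ frontier Ω → φ y = 0) ∧
      |((e : E d →L[ℝ] W d × ℝ).comp (fderiv ℝ G.symm (Φ y))).det| < 2 ∧
      1 / 2 < |((e : E d →L[ℝ] W d × ℝ).comp (fderiv ℝ G.symm (Φ y))).det| ∧
      ‖gradient φ y‖ < 2 * a ∧ a / 2 < ‖gradient φ y‖ := by
    have hn := h.continuousAt_gradient.norm
    have hs₁ : ∀ᶠ y in 𝓝 x₀, y ∈ G.source := G.open_source.mem_nhds hx₀s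
    have hs₂ : ∀ᶠ y in 𝓝 x₀, y ∈ s := hs
    refine hs₁.and <| (h.contDiffAt.eventually (by simp)).and <|
      (hΦcont.eventually (hΨc.eventually (by simp))).and <| hs₂.and <|
      (hΦcont.eventually (p := (· ∈ t)) ht).and <| h.eventually.and <| (h.eventually_eq_zero hΩ).and <|
      (hdetc.eventually (gt_mem_nhds ?_)).and <| (hdetc.eventually (lt_mem_nhds ?_)).and <|
      (hn.eventually (gt_mem_nhds ?_)).and <| hn.eventually (lt_mem_nhds ?_)
    · beta_reduce; rw [hdet0]; norm_num
    · beta_reduce; rw [hdet0]; norm_num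
    · linarith
    · linarith
  obtain ⟨U, hU, hUo, hxU⟩ := mem_nhds_iff.1 hgood
  set Z : Set (W d) := {z | (z, (0 : ℝ)) ∈ G.target ∧ G.symm (z, 0) ∈ U} with hZ
  have hzΦ : ∀ z ∈ Z, Φ (G.symm (z, 0)) = (z, 0) := fun z hz => G.right_inv hz.1
  have hfront : ∀ z ∈ Z, IsDefiningFunction Ω (G.symm (z, 0)) φ := fun z hz =>
    (hU hz.2).2.2.2.2.2.1 (congrArg Prod.snd (hzΦ z hz))
  have hdet : ∀ z ∈ Z, ∀ v,
      |(cylinderDeriv e ((fderiv ℝ G.symm (z, 0)).comp (ContinuousLinearMap.inl ℝ (W d) ℝ)) v).det| =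
      |((e : E d →L[ℝ] W d × ℝ).comp (fderiv ℝ G.symm (Φ (G.symm (z, 0))))).det| *
        (‖gradient φ (G.symm (z, 0))‖ * |⟪v, outwardNormal Ω (G.symm (z, 0))⟫|) := by
    intro z hz v
    have hy := hU hz.2
    have h1 := hLD _ hy.1 hy.2.1 hy.2.2.1
    have hg := norm_pos_iff.2 (hfront z hz).gradient_ne_zero
    have h2 := det_cylinderDeriv_comp e _ _ h1 v
    have h3 : ‖gradient φ (G.symm (z, 0))‖ * |⟪v, outwardNormal Ω (G.symm (z, 0))⟫| =
        |fderiv ℝ φ (G.symm (z, 0)) v| := by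
      rw [(hfront z hz).inner_outwardNormal, IsDefiningFunction.inner_gradient, abs_mul, abs_inv,
        abs_norm, mul_inv_cancel_left₀ hg.ne']
    rw [hzΦ z hz] at h2
    rw [h3, h2, abs_mul, hzΦ z hz]
    rfl
  refine ⟨{
    U := U
    Z := Z
    γ := fun z => G.symm (z, 0)
    γ' := fun z => (fderiv ℝ G.symm (z, 0)).comp (ContinuousLinearMap.inl ℝ (W d) ℝ)
    K := max K₁ K₂
    e := e
    c := Real.toNNReal (max (4 * a) (4 / a))
    isOpen_U := hUo
    isOpen_Z := ?_
    bijOn := ⟨?_, ?_, ?_⟩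
    hasFDerivAt := ?_
    lipschitz := ?_
    dist_le := ?_
    det_le := ?_
    le_det := ?_ }, hxU⟩
  · have h1 : IsOpen (G.target ∩ G.symm ⁻¹' U) := G.symm.isOpen_inter_preimage hUo
    exact h1.preimage (f := fun z : W d => (z, (0 : ℝ))) (by fun_prop)
  · exact fun z hz => ⟨hz.2, (hfront z hz).mem_frontier hΩ⟩
  · intro z hz z' hz' hzz
    have := (hzΦ z hz).symm.trans ((congrArg Φ hzz).trans (hzΦ z' hz'))
    exact congrArg Prod.fst this
  · intro y hy
    have hy1 := hU hy.1
    have h0 : Φ y = (A y, 0) := by rw [hΦ]; simp [hy1.2.2.2.2.2.2.1 hy.2]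
    have h1 : G.symm (A y, 0) = y := by rw [← h0]; exact G.left_inv hy1.1
    refine ⟨A y, ⟨?_, ?_⟩, h1⟩
    · rw [← h0]; exact G.map_source hy1.1
    · rw [h1]; exact hy.1
  · intro z hz
    have h1 := (hU hz.2).2.2.1
    rw [hzΦ z hz] at h1
    exact (h1.differentiableAt one_ne_zero).hasFDerivAt.comp z
      (ContinuousLinearMap.inl ℝ (W d) ℝ).hasFDerivAt
  · refine LipschitzOnWith.of_dist_le_mul fun z hz z' hz' => ?_
    have h1 := (hU hz.2).2.2.2.2.1
    have h2 := (hU hz'.2).2.2.2.2.1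
    rw [hzΦ z hz] at h1
    rw [hzΦ z' hz'] at h2
    refine (hK₂.dist_le_mul _ h1 _ h2).trans ?_
    rw [Prod.dist_eq, dist_self, max_eq_left dist_nonneg]
    gcongr
    exact le_max_right _ _
  · intro z hz z' hz'
    have h1 := hK₁.dist_le_mul _ (hU hz.2).2.2.2.1 _ (hU hz'.2).2.2.2.1
    rw [hzΦ z hz, hzΦ z' hz', Prod.dist_eq, dist_self, max_eq_left dist_nonneg] at h1
    refine h1.trans ?_
    gcongr
    exact le_max_left _ _
  · intro z hz v
    have hy := (hU hz.2).2.2.2.2.2.2.2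
    rw [hdet z hz, ← mul_assoc, Real.coe_toNNReal _ (by positivity)]
    gcongr
    refine le_trans ?_ (le_max_left _ _)
    calc _ ≤ 2 * (2 * a) := by gcongr; exacts [hy.1.le, hy.2.2.1.le]
      _ = 4 * a := by ring
  · intro z hz v
    have hy := (hU hz.2).2.2.2.2.2.2.2
    rw [hdet z hz, ← mul_assoc, ← mul_assoc, Real.coe_toNNReal _ (by positivity)]
    refine le_mul_of_one_le_left (abs_nonneg _) ?_
    calc (1 : ℝ) = 4 / a * (1 / 2) * (a / 2) := by field_simp; norm_num
      _ ≤ _ := by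
        gcongr
        exacts [le_max_right _ _, hy.2.1.le, hy.2.2.2.le]

/-! ### The surface measure in a chart -/

namespace BoundaryChart

variable {Ω : Set (E d)} (C : BoundaryChart Ω)

open Classical in
/-- The parametrization, extended by `0` off its domain. -/
def param : W d → E d := C.Z.piecewise C.γ (fun _ => 0)

theorem param_apply {z : W d} (hz : z ∈ C.Z) : C.param z = C.γ z := by
  classical exact Set.piecewise_eq_of_mem _ _ _ hz

theorem measurable_param : Measurable C.param := by
  classical
  have h1 : ContinuousOn C.γ C.Z := fun z hz =>
    (C.hasFDerivAt z hz).continuousAt.continuousWithinAt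
  exact h1.measurable_piecewise continuousOn_const C.isOpen_Z.measurableSet

/-- The image of the Lebesgue measure under the parametrization. -/
def paramMeasure : Measure (E d) := ((volume : Measure (W d)).restrict C.Z).map C.param

theorem paramMeasure_apply {B : Set (E d)} (hB : MeasurableSet B) :
    C.paramMeasure B = volume (C.Z ∩ C.γ ⁻¹' B) := by
  rw [paramMeasure, Measure.map_apply C.measurable_param hB,
    Measure.restrict_apply (C.measurable_param hB), Set.inter_comm]
  congr 1
  ext z
  simp only [Set.mem_inter_iff, Set.mem_preimage, and_congr_right_iff]
  intro hz
  rw [C.param_apply hz]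

theorem image_inter_preimage (B : Set (E d)) :
    C.γ '' (C.Z ∩ C.γ ⁻¹' B) = B ∩ C.U ∩ frontier Ω := by
  rw [Set.image_inter_preimage, C.bijOn.image_eq, Set.inter_comm, Set.inter_assoc]

theorem hausdorffMeasure_eq_volume (S : Set (W d)) :
    (μH[((d - 1 : ℕ) : ℝ)] : Measure (W d)) S = volume S := by
  have h := hausdorffMeasure_pi_real (ι := Fin (d - 1))
  rw [Fintype.card_fin] at h
  rw [h]

theorem hausdorffMeasure_le {B : Set (E d)} (hB : MeasurableSet B) :
    (μH[((d - 1 : ℕ) : ℝ)] : Measure (E d)) (B ∩ C.U ∩ frontier Ω) ≤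
      (C.K : ℝ≥0∞) ^ ((d - 1 : ℕ) : ℝ) * C.paramMeasure B := by
  rw [← C.image_inter_preimage, C.paramMeasure_apply hB, ← hausdorffMeasure_eq_volume]
  exact (C.lipschitz.mono Set.inter_subset_left).hausdorffMeasure_image_le (Nat.cast_nonneg _)

theorem le_hausdorffMeasure {B : Set (E d)} (hB : MeasurableSet B) :
    C.paramMeasure B ≤ (C.K : ℝ≥0∞) ^ ((d - 1 : ℕ) : ℝ) *
      (μH[((d - 1 : ℕ) : ℝ)] : Measure (E d)) (B ∩ C.U ∩ frontier Ω) := by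
  set S := C.Z ∩ C.γ ⁻¹' B with hS
  have hinv : ∀ z ∈ S, Function.invFunOn C.γ C.Z (C.γ z) = z := fun z hz =>
    C.bijOn.injOn.leftInvOn_invFunOn hz.1
  have hlip : LipschitzOnWith C.K (Function.invFunOn C.γ C.Z) (C.γ '' S) := by
    refine LipschitzOnWith.of_dist_le_mul ?_
    rintro _ ⟨z, hz, rfl⟩ _ ⟨z', hz', rfl⟩
    rw [hinv z hz, hinv z' hz']
    exact C.dist_le z hz.1 z' hz'.1
  have himg : Function.invFunOn C.γ C.Z '' (C.γ '' S) = S := by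
    rw [Set.image_image]
    exact (Set.image_congr hinv).trans (Set.image_id' S)
  rw [← C.image_inter_preimage, C.paramMeasure_apply hB, ← hausdorffMeasure_eq_volume, ← hS]
  conv_lhs => rw [← himg]
  exact hlip.hausdorffMeasure_image_le (Nat.cast_nonneg _)

theorem exists_surfaceMeasure_comparison :
    ∃ k : ℝ≥0, (surfaceMeasure Ω).restrict C.U ≤ k • C.paramMeasure ∧
      C.paramMeasure ≤ k • (surfaceMeasure Ω).restrict C.U := by
  set κ := Measure.addHaarScalarFactor (volume : Measure (EuclideanSpace ℝ (Fin (d - 1))))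
    μH[((d - 1 : ℕ) : ℝ)] with hκ
  have hκ0 : κ ≠ 0 := Measure.addHaarScalarFactor_volume_hausdorffMeasure_ne_zero (d - 1)
  have hπ : ∀ B : Set (E d), MeasurableSet B → (surfaceMeasure Ω).restrict C.U B =
      κ * (μH[((d - 1 : ℕ) : ℝ)] : Measure (E d)) (B ∩ C.U ∩ frontier Ω) := fun B hB => by
    rw [Measure.restrict_apply hB, surfaceMeasure,
      Measure.restrict_apply (hB.inter C.isOpen_U.measurableSet),
      Measure.euclideanHausdorffMeasure_def]
    rfl
  have hKpow : (C.K : ℝ≥0∞) ^ ((d - 1 : ℕ) : ℝ) = ((C.K ^ (d - 1) : ℝ≥0) : ℝ≥0∞) := by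
    rw [ENNReal.rpow_natCast, ENNReal.coe_pow]
  refine ⟨max (κ * C.K ^ (d - 1)) (κ⁻¹ * C.K ^ (d - 1)), Measure.le_iff.2 fun B hB => ?_,
    Measure.le_iff.2 fun B hB => ?_⟩
  · rw [hπ B hB]
    have h1 := C.hausdorffMeasure_le hB
    rw [hKpow] at h1
    calc _ ≤ (κ : ℝ≥0∞) * (((C.K ^ (d - 1) : ℝ≥0) : ℝ≥0∞) * C.paramMeasure B) := by gcongr
      _ = ((κ * C.K ^ (d - 1) : ℝ≥0) : ℝ≥0∞) * C.paramMeasure B := by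
        rw [ENNReal.coe_mul, mul_assoc]
      _ ≤ ((max (κ * C.K ^ (d - 1)) (κ⁻¹ * C.K ^ (d - 1)) : ℝ≥0) : ℝ≥0∞) * C.paramMeasure B := by
        gcongr
        exact le_max_left _ _
  · have h1 := C.le_hausdorffMeasure hB
    rw [hKpow] at h1
    refine h1.trans ?_
    calc _ = ((κ⁻¹ * C.K ^ (d - 1) : ℝ≥0) : ℝ≥0∞) * (surfaceMeasure Ω).restrict C.U B := by
          rw [hπ B hB, ← mul_assoc, ← ENNReal.coe_mul]
          congr 3
          field_simp
      _ ≤ ((max (κ * C.K ^ (d - 1)) (κ⁻¹ * C.K ^ (d - 1)) : ℝ≥0) : ℝ≥0∞) *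
          (surfaceMeasure Ω).restrict C.U B := by
        gcongr
        exact le_max_right _ _

theorem paramMeasure_univ_lt_top (hb : Bornology.IsBounded Ω) : C.paramMeasure Set.univ < ∞ := by
  rw [C.paramMeasure_apply MeasurableSet.univ]
  refine Bornology.IsBounded.measure_lt_top (Bornology.IsBounded.subset ?_ Set.inter_subset_left)
  have hbf : Bornology.IsBounded (frontier Ω) := hb.closure.subset frontier_subset_closure
  obtain ⟨R, hR⟩ := Metric.isBounded_iff.1 hbf
  refine Metric.isBounded_iff.2 ⟨C.K * R, fun z hz z' hz' => (C.dist_le z hz z' hz').trans ?_⟩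
  gcongr
  exact hR (C.bijOn.mapsTo hz).2 (C.bijOn.mapsTo hz').2

end BoundaryChart

section Cover

variable {Ω : Set (E d)}

theorem exists_finite_boundaryChart_cover (hd : 1 ≤ d) (hΩ : IsOpen Ω)
    (hb : Bornology.IsBounded Ω) (hC : HasC1Boundary Ω) :
    ∃ (N : ℕ) (C : Fin N → BoundaryChart Ω), frontier Ω ⊆ ⋃ i, (C i).U := by
  have hcpt : IsCompact (frontier Ω) :=
    Metric.isCompact_of_isClosed_isBounded isClosed_frontier
      (hb.closure.subset frontier_subset_closure)
  have h1 : ∀ x : frontier Ω, ∃ C : BoundaryChart Ω, (x : E d) ∈ C.U := fun x => by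
    obtain ⟨φ, hφ⟩ := hC x x.2
    exact hφ.exists_boundaryChart hd hΩ
  choose C hCx using h1
  obtain ⟨t, ht⟩ := hcpt.elim_finite_subcover (fun x : frontier Ω => (C x).U)
    (fun x => (C x).isOpen_U) (fun x hx => Set.mem_iUnion.2 ⟨⟨x, hx⟩, hCx ⟨x, hx⟩⟩)
  refine ⟨t.card, fun i => C (t.equivFin.symm i), fun x hx => ?_⟩
  obtain ⟨y, hy, hxy⟩ := Set.mem_iUnion₂.1 (ht hx)
  exact Set.mem_iUnion.2 ⟨t.equivFin ⟨y, hy⟩, by simpa using hxy⟩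

theorem isFiniteMeasure_surfaceMeasure (hd : 1 ≤ d) (hΩ : IsOpen Ω)
    (hb : Bornology.IsBounded Ω) (hC : HasC1Boundary Ω) : IsFiniteMeasure (surfaceMeasure Ω) := by
  obtain ⟨N, C, hcov⟩ := exists_finite_boundaryChart_cover hd hΩ hb hC
  refine ⟨?_⟩
  have h1 : surfaceMeasure Ω Set.univ ≤ ∑ i, surfaceMeasure Ω (C i).U := by
    calc surfaceMeasure Ω Set.univ = surfaceMeasure Ω (frontier Ω) := by
          rw [surfaceMeasure, Measure.restrict_apply_univ, Measure.restrict_apply_self]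
      _ ≤ surfaceMeasure Ω (⋃ i, (C i).U) := measure_mono hcov
      _ ≤ _ := measure_iUnion_fintype_le _ _
  refine h1.trans_lt (ENNReal.sum_lt_top.2 fun i _ => ?_)
  obtain ⟨k, hk, -⟩ := (C i).exists_surfaceMeasure_comparison
  have h2 := hk Set.univ
  rw [Measure.restrict_apply_univ] at h2
  exact h2.trans_lt (ENNReal.mul_lt_top ENNReal.coe_lt_top ((C i).paramMeasure_univ_lt_top hb))

end Cover

/-! ### Cylinders over pieces of the boundary -/

section Cylinder

/-- The part of the cylinder `B + ℝ v` in a slab orthogonal to `v`. -/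
def slab (v : E d) (B : Set (E d)) : Set (E d) :=
  {p | ∃ x ∈ B, ∃ t : ℝ, p = x + t • v ∧ 0 ≤ ⟪p, v⟫ ∧ ⟪p, v⟫ ≤ ‖v‖ ^ 2}

/-- Each line parallel to `v` meets `B` at most once. -/
def LineInjective (v : E d) (B : Set (E d)) : Prop :=
  ∀ x ∈ B, ∀ t : ℝ, x + t • v ∈ B → t = 0

theorem LineInjective.mono {v : E d} {B B' : Set (E d)} (h : LineInjective v B) (hB : B' ⊆ B) :
    LineInjective v B' := fun x hx t ht => h x (hB hx) t (hB ht)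

theorem slab_mono (v : E d) {B B' : Set (E d)} (h : B ⊆ B') : slab v B ⊆ slab v B' := by
  rintro p ⟨x, hx, t, ht⟩
  exact ⟨x, h hx, t, ht⟩

theorem slab_iUnion {ι : Sort*} (v : E d) (B : ι → Set (E d)) :
    slab v (⋃ i, B i) = ⋃ i, slab v (B i) := by
  ext p
  simp only [slab, Set.mem_ofPred_eq, Set.mem_iUnion]
  constructor
  · rintro ⟨x, ⟨i, hi⟩, t, ht⟩
    exact ⟨i, x, hi, t, ht⟩
  · rintro ⟨i, x, hi, t, ht⟩
    exact ⟨x, ⟨i, hi⟩, t, ht⟩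

theorem slab_image (v : E d) (B : Set (E d)) (s : E d → ℝ) :
    slab v ((fun x => x - s x • v) '' B) = slab v B := by
  ext p
  constructor
  · rintro ⟨_, ⟨x, hx, rfl⟩, t, ht, h⟩
    exact ⟨x, hx, t - s x, by simp only [ht, sub_smul]; abel, h⟩
  · rintro ⟨x, hx, t, ht, h⟩
    exact ⟨_, ⟨x, hx, rfl⟩, t + s x, by simp only [ht, add_smul]; abel, h⟩

/-- The density `|v · n(x)|`. -/
def fluxDensity (Ω : Set (E d)) (v x : E d) : ℝ≥0∞ := ENNReal.ofReal |⟪v, outwardNormal Ω x⟫|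

variable {Ω : Set (E d)}

theorem measurable_fluxDensity (hΩ : IsOpen Ω) (hC : HasC1Boundary Ω) :
    Measurable fun p : E d × E d => fluxDensity Ω p.2 p.1 :=
  ENNReal.measurable_ofReal.comp (continuous_abs.measurable.comp
    (measurable_snd.inner ((measurable_outwardNormal hΩ hC).comp measurable_fst)))

theorem measurable_fluxDensity_left (hΩ : IsOpen Ω) (hC : HasC1Boundary Ω) (v : E d) :
    Measurable (fluxDensity Ω v) :=
  Measurable.comp (g := fun p : E d × E d => fluxDensity Ω p.2 p.1) (f := fun x => (x, v))
    (measurable_fluxDensity hΩ hC) (measurable_id.prodMk measurable_const)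

namespace BoundaryChart

variable (C : BoundaryChart Ω)

/-- The parameters of the points of `slab v B`. -/
def slabParam (v : E d) (B : Set (E d)) : Set (W d × ℝ) :=
  {p | p.1 ∈ C.Z ∧ C.param p.1 ∈ B ∧ 0 ≤ ⟪C.param p.1, v⟫ + p.2 * ‖v‖ ^ 2 ∧
    ⟪C.param p.1, v⟫ + p.2 * ‖v‖ ^ 2 ≤ ‖v‖ ^ 2}

theorem measurableSet_slabParam (v : E d) {B : Set (E d)} (hB : MeasurableSet B) :
    MeasurableSet (C.slabParam v B) := by
  have h1 : Measurable fun p : W d × ℝ => C.param p.1 := C.measurable_param.comp measurable_fst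
  have h2 : Measurable fun p : W d × ℝ => ⟪C.param p.1, v⟫ + p.2 * ‖v‖ ^ 2 :=
    (h1.inner measurable_const).add (measurable_snd.mul measurable_const)
  exact (measurable_fst C.isOpen_Z.measurableSet).inter ((h1 hB).inter
    ((measurableSet_le measurable_const h2).inter (measurableSet_le h2 measurable_const)))

theorem image_slabParam (v : E d) {B : Set (E d)} (hB : B ⊆ C.U ∩ frontier Ω) :
    (fun p : W d × ℝ => C.e (C.γ p.1 + p.2 • v)) '' C.slabParam v B = C.e '' slab v B := by
  have hin : ∀ (x : E d) (t : ℝ), ⟪x + t • v, v⟫ = ⟪x, v⟫ + t * ‖v‖ ^ 2 := fun x t => by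
    rw [inner_add_left, inner_smul_left, real_inner_self_eq_norm_sq]
    simp
  ext q
  constructor
  · rintro ⟨⟨z, t⟩, ⟨hz, hzB, h1, h2⟩, rfl⟩
    simp only [C.param_apply hz] at hzB h1 h2
    exact ⟨_, ⟨C.γ z, hzB, t, rfl, by rwa [hin], by rwa [hin]⟩, rfl⟩
  · rintro ⟨_, ⟨x, hx, t, rfl, h1, h2⟩, rfl⟩
    obtain ⟨z, hz, rfl⟩ := C.bijOn.surjOn (hB hx)
    rw [hin] at h1 h2
    exact ⟨(z, t), ⟨hz, by simpa [C.param_apply hz] using hx, by simpa [C.param_apply hz] using h1,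
      by simpa [C.param_apply hz] using h2⟩, rfl⟩

theorem lintegral_slabParam (hΩ : IsOpen Ω) (hC1 : HasC1Boundary Ω) {v : E d} (hv : v ≠ 0)
    {B : Set (E d)} (hB : MeasurableSet B) :
    ∫⁻ p in C.slabParam v B, fluxDensity Ω v (C.param p.1) ∂(volume : Measure (W d × ℝ)) =
      ∫⁻ x in B, fluxDensity Ω v x ∂C.paramMeasure := by
  have hq := measurable_fluxDensity_left hΩ hC1 v
  have hv2 : 0 < ‖v‖ ^ 2 := by have := norm_pos_iff.2 hv; positivity
  have hm : Measurable ((C.slabParam v B).indicator fun p => fluxDensity Ω v (C.param p.1)) :=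
    (hq.comp (C.measurable_param.comp measurable_fst)).indicator (C.measurableSet_slabParam v hB)
  rw [← lintegral_indicator (C.measurableSet_slabParam v hB), Measure.volume_eq_prod,
    lintegral_prod _ hm.aemeasurable,
    paramMeasure, setLIntegral_map hB hq C.measurable_param,
    Measure.restrict_restrict (C.measurable_param hB),
    ← lintegral_indicator ((C.measurable_param hB).inter C.isOpen_Z.measurableSet)]
  refine lintegral_congr fun z => ?_
  have h1 : ∀ t : ℝ, (C.slabParam v B).indicator
      (fun p => fluxDensity Ω v (C.param p.1)) (z, t) =
      (C.param ⁻¹' B ∩ C.Z).indicator (fun z => fluxDensity Ω v (C.param z)) z *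
        (Set.Icc (-⟪C.param z, v⟫ / ‖v‖ ^ 2) (1 - ⟪C.param z, v⟫ / ‖v‖ ^ 2)).indicator 1 t := by
    intro t
    have h2 : (0 ≤ ⟪C.param z, v⟫ + t * ‖v‖ ^ 2 ∧ ⟪C.param z, v⟫ + t * ‖v‖ ^ 2 ≤ ‖v‖ ^ 2) ↔
        t ∈ Set.Icc (-⟪C.param z, v⟫ / ‖v‖ ^ 2) (1 - ⟪C.param z, v⟫ / ‖v‖ ^ 2) := by
      rw [Set.mem_Icc, div_le_iff₀ hv2, one_sub_div hv2.ne', le_div_iff₀ hv2]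
      constructor <;> rintro ⟨h3, h4⟩ <;> constructor <;> linarith
    by_cases hz : z ∈ C.param ⁻¹' B ∩ C.Z
    · by_cases ht : t ∈ Set.Icc (-⟪C.param z, v⟫ / ‖v‖ ^ 2) (1 - ⟪C.param z, v⟫ / ‖v‖ ^ 2)
      · have h3 : (z, t) ∈ C.slabParam v B := ⟨hz.2, hz.1, h2.2 ht⟩
        rw [Set.indicator_of_mem h3, Set.indicator_of_mem hz, Set.indicator_of_mem ht]
        simp
      · have h3 : (z, t) ∉ C.slabParam v B := fun h => ht (h2.1 h.2.2)
        rw [Set.indicator_of_notMem h3, Set.indicator_of_notMem ht, mul_zero]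
    · have h3 : (z, t) ∉ C.slabParam v B := fun h => hz ⟨h.2.1, h.1⟩
      rw [Set.indicator_of_notMem h3, Set.indicator_of_notMem hz, zero_mul]
  simp_rw [h1]
  rw [lintegral_const_mul _ (measurable_one.indicator measurableSet_Icc),
    lintegral_indicator_one measurableSet_Icc, Real.volume_Icc]
  have h4 : 1 - ⟪C.param z, v⟫ / ‖v‖ ^ 2 - -⟪C.param z, v⟫ / ‖v‖ ^ 2 = 1 := by ring
  rw [h4, ENNReal.ofReal_one, mul_one]

theorem exists_slab_comparison (hΩ : IsOpen Ω) (hC1 : HasC1Boundary Ω) :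
    ∃ k : ℝ≥0, ∀ v : E d, v ≠ 0 → ∀ B : Set (E d), MeasurableSet B → B ⊆ C.U ∩ frontier Ω →
      volume (slab v B) ≤ k * ∫⁻ x in B, fluxDensity Ω v x ∂(surfaceMeasure Ω) ∧
      (LineInjective v B →
        ∫⁻ x in B, fluxDensity Ω v x ∂(surfaceMeasure Ω) ≤ k * volume (slab v B)) := by
  obtain ⟨k, hk1, hk2⟩ := C.exists_surfaceMeasure_comparison
  set μ : Measure (W d × ℝ) := (volume : Measure (E d)).map C.e with hμ
  have : (volume : Measure (W d × ℝ)).IsAddHaarMeasure := by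
    rw [Measure.volume_eq_prod]; infer_instance
  have : μ.IsAddHaarMeasure := C.e.isAddHaarMeasure_map _
  set a := Measure.addHaarScalarFactor μ (volume : Measure (W d × ℝ)) with ha
  have hμa : μ = a • (volume : Measure (W d × ℝ)) := Measure.isAddLeftInvariant_eq_smul _ _
  have ha0 : a ≠ 0 := (Measure.addHaarScalarFactor_pos_of_isAddHaarMeasure _ _).ne'
  have hvol : ∀ S : Set (E d), μ (C.e '' S) = volume S := fun S => by
    have h1 := C.e.toHomeomorph.toMeasurableEquiv.map_apply (μ := (volume : Measure (E d)))
      (C.e '' S)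
    refine h1.trans ?_
    congr 1
    exact Set.preimage_image_eq S C.e.injective
  refine ⟨max (a * C.c * k) (k * a⁻¹ * C.c), fun v hv B hB hBU => ?_⟩
  have hq := measurable_fluxDensity_left hΩ hC1 v
  set D := C.slabParam v B with hD
  have hDm : MeasurableSet D := C.measurableSet_slabParam v hB
  set I := ∫⁻ x in B, fluxDensity Ω v x ∂(surfaceMeasure Ω) with hI
  set J := ∫⁻ x in B, fluxDensity Ω v x ∂C.paramMeasure with hJ
  have hres : (surfaceMeasure Ω).restrict B = ((surfaceMeasure Ω).restrict C.U).restrict B := by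
    rw [Measure.restrict_restrict hB, Set.inter_eq_left.2 (hBU.trans Set.inter_subset_left)]
  have hIJ : I ≤ k * J := by
    calc I ≤ ∫⁻ x in B, fluxDensity Ω v x ∂(k • C.paramMeasure) := by
          rw [hI, hres]
          exact lintegral_mono' (Measure.restrict_mono le_rfl hk1) le_rfl
      _ = k * J := by
        rw [Measure.restrict_smul, lintegral_smul_measure]
        rfl
  have hJI : J ≤ k * I := by
    calc J ≤ ∫⁻ x in B, fluxDensity Ω v x ∂(k • (surfaceMeasure Ω).restrict C.U) :=
          lintegral_mono' (Measure.restrict_mono le_rfl hk2) le_rfl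
      _ = k * I := by
        rw [Measure.restrict_smul, lintegral_smul_measure, ← hres]
        rfl
  have hDJ : ∫⁻ p in D, fluxDensity Ω v (C.param p.1) ∂μ = a * J := by
    rw [hμa, Measure.restrict_smul, lintegral_smul_measure, C.lintegral_slabParam hΩ hC1 hv hB]
    rfl
  have hder : ∀ p ∈ D, HasFDerivWithinAt (fun p : W d × ℝ => C.e (C.γ p.1 + p.2 • v))
      (cylinderDeriv C.e (C.γ' p.1) v) D p := by
    intro p hp
    have h1 : HasFDerivAt (fun p : W d × ℝ => C.γ p.1)
        ((C.γ' p.1).comp (ContinuousLinearMap.fst ℝ (W d) ℝ)) p :=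
      (C.hasFDerivAt p.1 hp.1).comp p hasFDerivAt_fst
    have h2 : HasFDerivAt (fun p : W d × ℝ => p.2 • v)
        ((ContinuousLinearMap.snd ℝ (W d) ℝ).smulRight v) p :=
      ((ContinuousLinearMap.snd ℝ (W d) ℝ).smulRight v).hasFDerivAt
    exact ((C.e : E d →L[ℝ] W d × ℝ).hasFDerivAt.comp p (h1.add h2)).hasFDerivWithinAt
  have himg := hvol (slab v B)
  rw [← C.image_slabParam v hBU] at himg
  constructor
  · calc volume (slab v B) ≤ ∫⁻ p in D, ENNReal.ofReal |(cylinderDeriv C.e (C.γ' p.1) v).det| ∂μ := by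
          rw [← himg]
          exact addHaar_image_le_lintegral_abs_det_fderiv μ hDm hder
      _ ≤ ∫⁻ p in D, C.c * fluxDensity Ω v (C.param p.1) ∂μ := by
          refine setLIntegral_mono (measurable_const.mul
            (hq.comp (C.measurable_param.comp measurable_fst))) fun p hp => ?_
          rw [C.param_apply hp.1, fluxDensity, ← ENNReal.ofReal_coe_nnreal,
            ← ENNReal.ofReal_mul C.c.coe_nonneg]
          exact ENNReal.ofReal_le_ofReal (C.det_le p.1 hp.1 v)
      _ = C.c * (a * J) := by
          rw [lintegral_const_mul' _ _ ENNReal.coe_ne_top, hDJ]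
      _ ≤ C.c * (a * (k * I)) := by gcongr
      _ = ((a * C.c * k : ℝ≥0) : ℝ≥0∞) * I := by push_cast; ring
      _ ≤ _ := by gcongr; exact le_max_left _ _
  · intro hline
    have hinj : Set.InjOn (fun p : W d × ℝ => C.e (C.γ p.1 + p.2 • v)) D := by
      rintro ⟨z, t⟩ hp ⟨z', t'⟩ hp' h
      have h1 : C.γ z + t • v = C.γ z' + t' • v := C.e.injective h
      have hzB : C.γ z ∈ B := by have := hp.2.1; rwa [C.param_apply hp.1] at this
      have hzB' : C.γ z' ∈ B := by have := hp'.2.1; rwa [C.param_apply hp'.1] at this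
      have h2 : C.γ z + (t - t') • v = C.γ z' := by
        rw [sub_smul, ← add_sub_assoc, h1, add_sub_cancel_right]
      have h3 := hline _ hzB (t - t') (h2 ▸ hzB')
      rw [h3, zero_smul, add_zero] at h2
      exact Prod.ext (C.bijOn.injOn hp.1 hp'.1 h2) (sub_eq_zero.1 h3)
    have hJa : J = (a⁻¹ : ℝ≥0) * (a * J) := by
      rw [← mul_assoc, ← ENNReal.coe_mul, inv_mul_cancel₀ ha0, ENNReal.coe_one, one_mul]
    calc I ≤ k * ((a⁻¹ : ℝ≥0) * (a * J)) := by rw [← hJa]; exact hIJ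
      _ ≤ k * ((a⁻¹ : ℝ≥0) *
          (C.c * ∫⁻ p in D, ENNReal.ofReal |(cylinderDeriv C.e (C.γ' p.1) v).det| ∂μ)) := by
          refine mul_le_mul' le_rfl (mul_le_mul' le_rfl ?_)
          rw [← hDJ, ← lintegral_const_mul' _ _ ENNReal.coe_ne_top]
          refine setLIntegral_mono' hDm fun p hp => ?_
          rw [C.param_apply hp.1, fluxDensity, ← ENNReal.ofReal_coe_nnreal,
            ← ENNReal.ofReal_mul C.c.coe_nonneg]
          exact ENNReal.ofReal_le_ofReal (C.le_det p.1 hp.1 v)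
      _ ≤ k * ((a⁻¹ : ℝ≥0) * (C.c * volume (slab v B))) := by
          gcongr
          rw [← himg]
          exact lintegral_abs_det_fderiv_le_addHaar_image μ hDm hder hinj
      _ = ((k * a⁻¹ * C.c : ℝ≥0) : ℝ≥0∞) * volume (slab v B) := by push_cast; ring
      _ ≤ _ := by gcongr; exact le_max_right _ _

end BoundaryChart

theorem exists_slab_comparison (hd : 1 ≤ d) (hΩ : IsOpen Ω)
    (hb : Bornology.IsBounded Ω) (hC : HasC1Boundary Ω) :
    ∃ k : ℝ≥0, ∀ v : E d, v ≠ 0 → ∀ B : Set (E d), MeasurableSet B → B ⊆ frontier Ω →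
      volume (slab v B) ≤ k * ∫⁻ x in B, fluxDensity Ω v x ∂(surfaceMeasure Ω) ∧
      (LineInjective v B →
        ∫⁻ x in B, fluxDensity Ω v x ∂(surfaceMeasure Ω) ≤ k * volume (slab v B)) := by
  obtain ⟨N, C, hcov⟩ := exists_finite_boundaryChart_cover hd hΩ hb hC
  choose k hk using fun i => (C i).exists_slab_comparison hΩ hC
  refine ⟨∑ i, k i, fun v hv B hB hBf => ?_⟩
  have hBU : B = ⋃ i, B ∩ (C i).U := by
    rw [← Set.inter_iUnion, Set.inter_eq_left.2 (hBf.trans hcov)]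
  have hm : ∀ i, MeasurableSet (B ∩ (C i).U) := fun i => hB.inter (C i).isOpen_U.measurableSet
  have hsub : ∀ i, B ∩ (C i).U ⊆ (C i).U ∩ frontier Ω := fun i x hx => ⟨hx.2, hBf hx.1⟩
  push_cast
  constructor
  · calc volume (slab v B) ≤ ∑ i, volume (slab v (B ∩ (C i).U)) := by
          conv_lhs => rw [hBU, slab_iUnion]
          exact measure_iUnion_fintype_le _ _
      _ ≤ ∑ i, k i * ∫⁻ x in B, fluxDensity Ω v x ∂(surfaceMeasure Ω) := by
          refine Finset.sum_le_sum fun i _ => ((hk i v hv _ (hm i) (hsub i)).1).trans ?_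
          gcongr
          exact Set.inter_subset_left
      _ = _ := (Finset.sum_mul _ _ _).symm
  · intro hline
    calc ∫⁻ x in B, fluxDensity Ω v x ∂(surfaceMeasure Ω)
        ≤ ∑ i, ∫⁻ x in B ∩ (C i).U, fluxDensity Ω v x ∂(surfaceMeasure Ω) := by
          conv_lhs => rw [hBU]
          exact (lintegral_iUnion_le _ _).trans (tsum_fintype _).le
      _ ≤ ∑ i, k i * volume (slab v B) := by
          refine Finset.sum_le_sum fun i _ =>
            ((hk i v hv _ (hm i) (hsub i)).2 (hline.mono Set.inter_subset_left)).trans ?_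
          gcongr
          exact slab_mono v Set.inter_subset_left
      _ = _ := (Finset.sum_mul _ _ _).symm

end Cylinder

/-! ### Transport along characteristics -/

section Transport

variable {Ω : Set (E d)}

theorem backFoot_injOn (hΩ : IsOpen Ω) (hb : Bornology.IsBounded Ω) (hC : HasC1Boundary Ω)
    (v : E d) : Set.InjOn (fun x => backFoot Ω x v)
      {x | x ∈ frontier Ω ∧ 0 < ⟪v, outwardNormal Ω x⟫} := by
  have key : ∀ x x', x ∈ frontier Ω → x' ∈ frontier Ω → 0 < ⟪v, outwardNormal Ω x⟫ →
      0 < ⟪v, outwardNormal Ω x'⟫ → backFoot Ω x v = backFoot Ω x' v →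
      travelTime Ω x' v ≤ travelTime Ω x v := by
    intro x x' hx hx' hv hv' h
    by_contra! hc
    have hpos := travelTime_pos hb hC hx hv
    have h1 : x = x' - (travelTime Ω x' v - travelTime Ω x v) • v := by
      rw [backFoot, backFoot, sub_eq_iff_eq_add] at h
      exact h.trans (by rw [sub_smul]; abel)
    have h2 := mem_of_lt_travelTime (Ω := Ω) (x := x') (v := v)
      (s := travelTime Ω x' v - travelTime Ω x v) (by linarith) (by linarith)
    rw [← h1] at h2
    rw [hΩ.frontier_eq] at hx
    exact hx.2 h2
  rintro x ⟨hx, hv⟩ x' ⟨hx', hv'⟩ h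
  have h1 := le_antisymm (key x' x hx' hx hv' hv h.symm) (key x x' hx hx' hv hv' h)
  simp only [backFoot, h1] at h
  exact sub_left_injective h

theorem lineInjective_of_between (hΩ : IsOpen Ω) {v : E d} (hv : v ≠ 0) (q : ℝ) :
    LineInjective v {x | x ∈ frontier Ω ∧ ⟪x, v⟫ / ‖v‖ ^ 2 - travelTime Ω x v < q ∧
      q < ⟪x, v⟫ / ‖v‖ ^ 2} := by
  have hv2 : ‖v‖ ^ 2 ≠ 0 := pow_ne_zero 2 (norm_ne_zero_iff.2 hv)
  have hin : ∀ (x : E d) (t : ℝ), ⟪x + t • v, v⟫ / ‖v‖ ^ 2 = ⟪x, v⟫ / ‖v‖ ^ 2 + t := fun x t => by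
    rw [inner_add_left, inner_smul_left, real_inner_self_eq_norm_sq]
    simp only [conj_trivial]
    field_simp
  have key : ∀ (x : E d) (t : ℝ), x ∈ frontier Ω → 0 < t → q < ⟪x, v⟫ / ‖v‖ ^ 2 →
      ⟪x + t • v, v⟫ / ‖v‖ ^ 2 - travelTime Ω (x + t • v) v < q → False := by
    intro x t hx ht h1 h2
    rw [hin] at h2
    have h3 := mem_of_lt_travelTime (Ω := Ω) (x := x + t • v) (v := v) ht (by linarith)
    rw [add_sub_cancel_right] at h3
    rw [hΩ.frontier_eq] at hx
    exact hx.2 h3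
  rintro x ⟨hx, hx1, hx2⟩ t ⟨ht, ht1, ht2⟩
  rcases lt_trichotomy t 0 with h | h | h
  · refine (key (x + t • v) (-t) ht (by linarith) ht2 ?_).elim
    rwa [neg_smul, add_neg_cancel_right]
  · exact h
  · exact (key x t hx h hx2 ht1).elim

theorem measurable_inner_outwardNormal (hΩ : IsOpen Ω) (hC : HasC1Boundary Ω) :
    Measurable fun p : E d × E d => ⟪p.2, outwardNormal Ω p.1⟫ :=
  measurable_snd.inner ((measurable_outwardNormal hΩ hC).comp measurable_fst)

theorem measurableSet_gammaPlus (hΩ : IsOpen Ω) (hC : HasC1Boundary Ω) :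
    MeasurableSet (GammaPlus Ω) :=
  (measurable_fst isClosed_frontier.measurableSet).inter
    (measurableSet_lt measurable_const (measurable_inner_outwardNormal hΩ hC))

theorem measurableSet_gammaMinus (hΩ : IsOpen Ω) (hC : HasC1Boundary Ω) :
    MeasurableSet (GammaMinus Ω) :=
  (measurable_fst isClosed_frontier.measurableSet).inter
    (measurableSet_lt (measurable_inner_outwardNormal hΩ hC) measurable_const)

theorem exists_transport_bound_fiber (hd : 1 ≤ d) (hΩ : IsOpen Ω)
    (hb : Bornology.IsBounded Ω) (hC : HasC1Boundary Ω) :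
    ∃ k : ℝ≥0, ∀ v : E d, ∀ B : Set (E d), MeasurableSet B →
      ∫⁻ x in {x | (x, v) ∈ GammaPlus Ω ∧ backFoot Ω x v ∈ B}, fluxDensity Ω v x
          ∂(surfaceMeasure Ω) ≤
        k * ∫⁻ x in {x | (x, v) ∈ GammaMinus Ω ∧ x ∈ B}, fluxDensity Ω v x
          ∂(surfaceMeasure Ω) := by
  obtain ⟨k, hk⟩ := exists_slab_comparison hd hΩ hb hC
  refine ⟨k * k, fun v B hB => ?_⟩
  rcases eq_or_ne v 0 with rfl | hv
  · simp [GammaPlus, outgoing]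
  have hq := measurable_fluxDensity_left hΩ hC v
  have hTm : Measurable fun x => backFoot Ω x v :=
    Measurable.comp (g := fun p : E d × E d => backFoot Ω p.1 p.2) (f := fun x => (x, v))
      (measurable_backFoot hΩ hb) (measurable_id.prodMk measurable_const)
  have hτm : Measurable fun x => travelTime Ω x v :=
    Measurable.comp (g := fun p : E d × E d => travelTime Ω p.1 p.2) (f := fun x => (x, v))
      (measurable_travelTime hΩ hb) (measurable_id.prodMk measurable_const)
  have hpm : Measurable fun x : E d => (x, v) := measurable_id.prodMk measurable_const
  have hinm : Measurable fun x : E d => ⟪x, v⟫ / ‖v‖ ^ 2 :=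
    (measurable_id.inner measurable_const).div_const _
  set A := {x | (x, v) ∈ GammaPlus Ω ∧ backFoot Ω x v ∈ B} with hA
  have hAm : MeasurableSet A := (hpm (measurableSet_gammaPlus hΩ hC)).inter (hTm hB)
  have hAplus : A ⊆ {x | x ∈ frontier Ω ∧ 0 < ⟪v, outwardNormal Ω x⟫} := fun x hx => hx.1
  obtain ⟨f, hf⟩ := exists_surjective_nat ℚ
  set P : ℕ → Set (E d) := fun n => A ∩ {x | x ∈ frontier Ω ∧
    ⟪x, v⟫ / ‖v‖ ^ 2 - travelTime Ω x v < f n ∧ (f n : ℝ) < ⟪x, v⟫ / ‖v‖ ^ 2} with hP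
  have hPm : ∀ n, MeasurableSet (P n) := fun n =>
    hAm.inter (isClosed_frontier.measurableSet.inter
      ((measurableSet_lt (hinm.sub hτm) measurable_const).inter
        (measurableSet_lt measurable_const hinm)))
  set D : ℕ → Set (E d) := disjointed P with hD
  have hDm : ∀ n, MeasurableSet (D n) := fun n => MeasurableSet.disjointed hPm n
  have hDP : ∀ n, D n ⊆ P n := disjointed_subset P
  have hDA : ∀ n, D n ⊆ A := fun n => (hDP n).trans Set.inter_subset_left
  have hAD : A ⊆ ⋃ n, D n := by
    rw [hD, iUnion_disjointed]
    intro x hx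
    have hpos := travelTime_pos hb hC (hAplus hx).1 (hAplus hx).2
    obtain ⟨r, hr1, hr2⟩ := exists_rat_btwn
      (show ⟪x, v⟫ / ‖v‖ ^ 2 - travelTime Ω x v < ⟪x, v⟫ / ‖v‖ ^ 2 by linarith)
    obtain ⟨n, rfl⟩ := hf r
    exact Set.mem_iUnion.2 ⟨n, hx, (hAplus hx).1, hr1, hr2⟩
  have hline : ∀ n, LineInjective v (D n) := fun n =>
    (lineInjective_of_between hΩ hv (f n)).mono ((hDP n).trans Set.inter_subset_right)
  set T : E d → E d := fun x => backFoot Ω x v with hT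
  have hinj := backFoot_injOn hΩ hb hC v
  have hTD : ∀ n, MeasurableSet (T '' D n) := fun n =>
    (hDm n).image_of_measurable_injOn hTm (hinj.mono ((hDA n).trans hAplus))
  have hTf : ∀ n, T '' D n ⊆ frontier Ω := by
    rintro n _ ⟨x, hx, rfl⟩
    have := hAplus (hDA n hx)
    exact backFoot_mem_frontier hΩ hb hC this.1 this.2
  have hdisj : Pairwise (Function.onFun Disjoint fun n => T '' D n) := fun i j hij =>
    (disjoint_disjointed P hij).image hinj ((hDA i).trans hAplus) ((hDA j).trans hAplus)
  have hstep : ∀ n, ∫⁻ x in D n, fluxDensity Ω v x ∂(surfaceMeasure Ω) ≤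
      k * (k * ∫⁻ x in T '' D n, fluxDensity Ω v x ∂(surfaceMeasure Ω)) := fun n => by
    have h1 := (hk v hv (D n) (hDm n) fun x hx => (hAplus (hDA n hx)).1).2 (hline n)
    have h2 := (hk v hv (T '' D n) (hTD n) (hTf n)).1
    rw [hT, show (fun x => backFoot Ω x v) = fun x => x - travelTime Ω x v • v from rfl,
      slab_image] at h2
    exact h1.trans (mul_le_mul' le_rfl h2)
  calc ∫⁻ x in A, fluxDensity Ω v x ∂(surfaceMeasure Ω)
      ≤ ∑' n, ∫⁻ x in D n, fluxDensity Ω v x ∂(surfaceMeasure Ω) :=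
        (lintegral_mono_set hAD).trans (lintegral_iUnion_le _ _)
    _ ≤ ∑' n, k * (k * ∫⁻ x in T '' D n, fluxDensity Ω v x ∂(surfaceMeasure Ω)) :=
        ENNReal.tsum_le_tsum hstep
    _ = ((k * k : ℝ≥0) : ℝ≥0∞) *
        ∫⁻ x in ⋃ n, T '' D n, fluxDensity Ω v x ∂(surfaceMeasure Ω) := by
        rw [lintegral_iUnion hTD hdisj, ENNReal.tsum_mul_left, ENNReal.tsum_mul_left,
          ENNReal.coe_mul, mul_assoc]
    _ ≤ _ := by
        refine mul_le_mul' le_rfl ?_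
        have hUm : MeasurableSet (⋃ n, T '' D n) := MeasurableSet.iUnion hTD
        have hRm : MeasurableSet {x | (x, v) ∈ GammaMinus Ω ∧ x ∈ B} :=
          (hpm (measurableSet_gammaMinus hΩ hC)).inter hB
        rw [← lintegral_indicator hUm, ← lintegral_indicator hRm]
        refine lintegral_mono fun y => ?_
        by_cases hy : y ∈ ⋃ n, T '' D n
        · rw [Set.indicator_of_mem hy]
          obtain ⟨n, x, hx, rfl⟩ := Set.mem_iUnion.1 hy
          have hxA := hDA n hx
          have h1 := inner_outwardNormal_backFoot_nonpos hΩ hb hC (hAplus hxA).1 (hAplus hxA).2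
          rcases h1.lt_or_eq with h2 | h2
          · have h3 : T x ∈ {x | (x, v) ∈ GammaMinus Ω ∧ x ∈ B} :=
              ⟨⟨hTf n ⟨x, hx, rfl⟩, h2⟩, hxA.2⟩
            rw [Set.indicator_of_mem h3]
          · rw [fluxDensity, hT, h2]
            simp
        · rw [Set.indicator_of_notMem hy]
          exact zero_le

variable {m : Measure (E d)}

theorem boundaryFlux_eq : boundaryFlux Ω m =
    ((surfaceMeasure Ω).prod m).withDensity fun p => fluxDensity Ω p.2 p.1 := rfl

theorem lintegral_fluxPlus [SFinite m] (hΩ : IsOpen Ω) (hC : HasC1Boundary Ω)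
    {G : E d × E d → ℝ≥0∞} (hG : Measurable G) :
    ∫⁻ p, G p ∂(fluxPlus Ω m) = ∫⁻ x, ∫⁻ v in outgoing Ω x, fluxDensity Ω v x * G (x, v) ∂m
      ∂(surfaceMeasure Ω) := by
  have hq := measurable_fluxDensity hΩ hC
  have hΓ := measurableSet_gammaPlus (Ω := Ω) hΩ hC
  rw [fluxPlus, boundaryFlux_eq, restrict_withDensity hΓ,
    lintegral_withDensity_eq_lintegral_mul _ hq hG, ← lintegral_indicator hΓ,
    lintegral_prod _ (((hq.mul hG).indicator hΓ).aemeasurable)]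
  have hx : ∀ᵐ x ∂(surfaceMeasure Ω), x ∈ frontier Ω :=
    ae_restrict_mem isClosed_frontier.measurableSet
  refine lintegral_congr_ae (hx.mono fun x hx => ?_)
  have hm : MeasurableSet (outgoing Ω x) :=
    measurableSet_lt measurable_const (measurable_id.inner measurable_const)
  beta_reduce
  rw [← lintegral_indicator hm]
  refine lintegral_congr fun v => ?_
  by_cases hv : v ∈ outgoing Ω x
  · rw [Set.indicator_of_mem (show (x, v) ∈ GammaPlus Ω from ⟨hx, hv⟩), Set.indicator_of_mem hv]
    rfl
  · rw [Set.indicator_of_notMem (show (x, v) ∉ GammaPlus Ω from fun h => hv h.2),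
      Set.indicator_of_notMem hv]

theorem lintegral_fluxMinus [SFinite m] (hΩ : IsOpen Ω) (hC : HasC1Boundary Ω)
    {G : E d × E d → ℝ≥0∞} (hG : Measurable G) :
    ∫⁻ p, G p ∂(fluxMinus Ω m) = ∫⁻ x, ∫⁻ v in incoming Ω x, fluxDensity Ω v x * G (x, v) ∂m
      ∂(surfaceMeasure Ω) := by
  have hq := measurable_fluxDensity hΩ hC
  have hΓ := measurableSet_gammaMinus (Ω := Ω) hΩ hC
  rw [fluxMinus, boundaryFlux_eq, restrict_withDensity hΓ,
    lintegral_withDensity_eq_lintegral_mul _ hq hG, ← lintegral_indicator hΓ,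
    lintegral_prod _ (((hq.mul hG).indicator hΓ).aemeasurable)]
  have hx : ∀ᵐ x ∂(surfaceMeasure Ω), x ∈ frontier Ω :=
    ae_restrict_mem isClosed_frontier.measurableSet
  refine lintegral_congr_ae (hx.mono fun x hx => ?_)
  have hm : MeasurableSet (incoming Ω x) :=
    measurableSet_lt (measurable_id.inner measurable_const) measurable_const
  beta_reduce
  rw [← lintegral_indicator hm]
  refine lintegral_congr fun v => ?_
  by_cases hv : v ∈ incoming Ω x
  · rw [Set.indicator_of_mem (show (x, v) ∈ GammaMinus Ω from ⟨hx, hv⟩), Set.indicator_of_mem hv]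
    rfl
  · rw [Set.indicator_of_notMem (show (x, v) ∉ GammaMinus Ω from fun h => hv h.2),
      Set.indicator_of_notMem hv]

/-- The map `(x, v) ↦ (x - τ₋(x, v) v, v)`. -/
def footMap (Ω : Set (E d)) (p : E d × E d) : E d × E d := (backFoot Ω p.1 p.2, p.2)

theorem measurable_footMap (hΩ : IsOpen Ω) (hb : Bornology.IsBounded Ω) :
    Measurable (footMap Ω) := (measurable_backFoot hΩ hb).prodMk measurable_snd

theorem boundaryFlux_apply [SFinite m] [SFinite (surfaceMeasure Ω)] (hΩ : IsOpen Ω)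
    (hC : HasC1Boundary Ω) {S : Set (E d × E d)} (hS : MeasurableSet S) :
    boundaryFlux Ω m S = ∫⁻ v, ∫⁻ x in {x | (x, v) ∈ S}, fluxDensity Ω v x
      ∂(surfaceMeasure Ω) ∂m := by
  have hq := measurable_fluxDensity hΩ hC
  rw [boundaryFlux_eq, withDensity_apply _ hS, ← lintegral_indicator hS]
  have h1 := lintegral_prod_symm' (μ := surfaceMeasure Ω) (ν := m)
    (S.indicator fun p : E d × E d => fluxDensity Ω p.2 p.1) (hq.indicator hS)
  refine h1.trans (lintegral_congr fun v => ?_)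
  have hm : MeasurableSet {x | (x, v) ∈ S} := (measurable_id.prodMk measurable_const) hS
  rw [← lintegral_indicator hm]
  rfl

/-- Transport along characteristics from `Γ₊` to `Γ₋` is bounded on the flux measures, whatever the
velocity measure is. -/
theorem exists_map_footMap_le (hd : 1 ≤ d) (hΩ : IsOpen Ω)
    (hb : Bornology.IsBounded Ω) (hC : HasC1Boundary Ω) :
    ∃ k : ℝ≥0, ∀ (m : Measure (E d)) [SFinite m],
      (fluxPlus Ω m).map (footMap Ω) ≤ k • fluxMinus Ω m := by
  obtain ⟨k, hk⟩ := exists_transport_bound_fiber hd hΩ hb hC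
  have := isFiniteMeasure_surfaceMeasure hd hΩ hb hC
  have hTm := measurable_footMap hΩ hb
  refine ⟨k, fun m _ => Measure.le_iff.2 fun S hS => ?_⟩
  rw [Measure.map_apply hTm hS, fluxPlus, Measure.restrict_apply (hTm hS),
    boundaryFlux_apply hΩ hC ((hTm hS).inter (measurableSet_gammaPlus hΩ hC)), Measure.smul_apply,
    fluxMinus, Measure.restrict_apply hS,
    boundaryFlux_apply hΩ hC (hS.inter (measurableSet_gammaMinus hΩ hC))]
  change _ ≤ (k : ℝ≥0∞) * _
  rw [← lintegral_const_mul' _ _ ENNReal.coe_ne_top]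
  refine lintegral_mono fun v => ?_
  have h1 := hk v {x | (x, v) ∈ S} ((measurable_id.prodMk measurable_const) hS)
  have e1 : {x | (x, v) ∈ footMap Ω ⁻¹' S ∩ GammaPlus Ω} =
      {x | (x, v) ∈ GammaPlus Ω ∧ backFoot Ω x v ∈ {x | (x, v) ∈ S}} := by
    ext x
    exact and_comm
  have e2 : {x | (x, v) ∈ S ∩ GammaMinus Ω} =
      {x | (x, v) ∈ GammaMinus Ω ∧ x ∈ {x | (x, v) ∈ S}} := by
    ext x
    exact and_comm
  beta_reduce
  rw [e1, e2]
  exact h1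

end Transport

/-! ### The transfer operator -/

section Transfer

variable {Ω : Set (E d)} {m : Measure (E d)}

/-- The phase `exp (-l τ₋)`. -/
def phase (Ω : Set (E d)) (l : ℂ) (p : E d × E d) : ℂ :=
  Complex.exp (-l * (travelTime Ω p.1 p.2 : ℂ))

theorem measurable_phase (hΩ : IsOpen Ω) (hb : Bornology.IsBounded Ω) (l : ℂ) :
    Measurable (phase Ω l) :=
  Complex.measurable_exp.comp
    (measurable_const.mul (Complex.measurable_ofReal.comp (measurable_travelTime hΩ hb)))

theorem norm_phase_le {l : ℂ} (hl : 0 ≤ l.re) (p : E d × E d) : ‖phase Ω l p‖ ≤ 1 := by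
  rw [phase, Complex.norm_exp, Real.exp_le_one_iff]
  have : (-l * (travelTime Ω p.1 p.2 : ℂ)).re = -(l.re * travelTime Ω p.1 p.2) := by simp
  rw [this, neg_nonpos]
  exact mul_nonneg hl (travelTime_nonneg _ _)

theorem eLpNorm_transfer_le (hΩ : IsOpen Ω) (hb : Bornology.IsBounded Ω) {k : ℝ≥0}
    (hk : (fluxPlus Ω m).map (footMap Ω) ≤ k • fluxMinus Ω m) {l : ℂ} (hl : 0 ≤ l.re)
    {f : E d × E d → ℂ} (hf : Measurable f) :
    eLpNorm (fun p => f (footMap Ω p) * phase Ω l p) 1 (fluxPlus Ω m) ≤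
      k * eLpNorm f 1 (fluxMinus Ω m) := by
  rw [eLpNorm_one_eq_lintegral_enorm, eLpNorm_one_eq_lintegral_enorm]
  calc ∫⁻ p, ‖f (footMap Ω p) * phase Ω l p‖ₑ ∂(fluxPlus Ω m)
      ≤ ∫⁻ p, ‖f (footMap Ω p)‖ₑ ∂(fluxPlus Ω m) := by
        refine lintegral_mono fun p => ?_
        rw [enorm_mul]
        refine mul_le_of_le_one_right' ?_
        have h1 := norm_phase_le (Ω := Ω) hl p
        rw [← ofReal_norm]
        exact ENNReal.ofReal_le_one.2 h1
    _ = ∫⁻ p, ‖f p‖ₑ ∂((fluxPlus Ω m).map (footMap Ω)) :=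
        (lintegral_map hf.enorm (measurable_footMap hΩ hb)).symm
    _ ≤ ∫⁻ p, ‖f p‖ₑ ∂(k • fluxMinus Ω m) := lintegral_mono' hk le_rfl
    _ = _ := by
        rw [lintegral_smul_measure]
        rfl

theorem exists_transferOperator (hΩ : IsOpen Ω) (hb : Bornology.IsBounded Ω) {k : ℝ≥0}
    (hk : (fluxPlus Ω m).map (footMap Ω) ≤ k • fluxMinus Ω m) {l : ℂ} (hl : 0 ≤ l.re) :
    ∃ M : L1Minus Ω m →L[ℂ] L1Plus Ω m, IsTransferOperator Ω m l M ∧ ‖M‖ ≤ k := by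
  have hqmp : Measure.QuasiMeasurePreserving (footMap Ω) (fluxPlus Ω m) (fluxMinus Ω m) :=
    ⟨measurable_footMap hΩ hb, Measure.absolutelyContinuous_of_le_smul (c := k) hk⟩
  have hmem : ∀ u : L1Minus Ω m,
      MemLp (fun p => u (footMap Ω p) * phase Ω l p) 1 (fluxPlus Ω m) := fun u => by
    have hu := (Lp.stronglyMeasurable u).measurable
    refine ⟨((hu.comp (measurable_footMap hΩ hb)).mul
      (measurable_phase hΩ hb l)).aestronglyMeasurable, ?_⟩
    exact (eLpNorm_transfer_le hΩ hb hk hl hu).trans_lt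
      (ENNReal.mul_lt_top ENNReal.coe_lt_top (Lp.eLpNorm_lt_top u))
  let M₀ : L1Minus Ω m →ₗ[ℂ] L1Plus Ω m :=
    { toFun := fun u => (hmem u).toLp _
      map_add' := fun u w => by
        rw [← MemLp.toLp_add]
        refine MemLp.toLp_congr _ _ ?_
        filter_upwards [hqmp.ae (Lp.coeFn_add u w)] with p hp
        rw [hp, Pi.add_apply, Pi.add_apply, add_mul]
      map_smul' := fun c u => by
        rw [RingHom.id_apply, ← MemLp.toLp_const_smul]
        refine MemLp.toLp_congr _ _ ?_
        filter_upwards [hqmp.ae (Lp.coeFn_smul c u)] with p hp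
        rw [hp, Pi.smul_apply, Pi.smul_apply, smul_eq_mul, smul_eq_mul, mul_assoc] }
  have hbound : ∀ u, ‖M₀ u‖ ≤ k * ‖u‖ := fun u => by
    change ‖(hmem u).toLp _‖ ≤ _
    rw [Lp.norm_toLp, Lp.norm_def, ← ENNReal.coe_toReal k, ← ENNReal.toReal_mul]
    exact ENNReal.toReal_mono (ENNReal.mul_ne_top ENNReal.coe_ne_top (Lp.eLpNorm_ne_top u))
      (eLpNorm_transfer_le hΩ hb hk hl (Lp.stronglyMeasurable u).measurable)
  refine ⟨M₀.mkContinuous k hbound, fun u f hf => ?_, M₀.mkContinuous_norm_le k.2 hbound⟩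
  have h1 : (M₀.mkContinuous k hbound u : E d × E d → ℂ) =ᵐ[fluxPlus Ω m] _ :=
    (hmem u).coeFn_toLp
  filter_upwards [h1, hqmp.ae hf] with p hp1 hp2
  rw [hp1, hp2]
  rfl

end Transfer

/-! ### Polar coordinates -/

section Polar

/-- The surface measure of the unit sphere, as a measure on `ℝ^d`. -/
def sphereMeasure (d : ℕ) : Measure (E d) :=
  (volume : Measure (E d)).toSphere.map Subtype.val

instance : IsFiniteMeasure (sphereMeasure d) := by
  unfold sphereMeasure; infer_instance

/-- The radial part `ϖ(ρ) ρ^{d-1} dρ` of the velocity measure. -/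
def radialMeasure (d : ℕ) (ϖ : ℝ → ℝ≥0) : Measure ℝ :=
  (volume.restrict (Set.Ioi 0)).withDensity fun ρ => ((Real.toNNReal (ρ ^ (d - 1)) * ϖ ρ : ℝ≥0) : ℝ≥0∞)

variable {ϖ : ℝ → ℝ≥0}

instance : SFinite (radialMeasure d ϖ) := by
  unfold radialMeasure; infer_instance

theorem measurable_radialDensity (hϖ : Measurable ϖ) :
    Measurable fun ρ : ℝ => Real.toNNReal (ρ ^ (d - 1)) * ϖ ρ :=
  (measurable_real_toNNReal.comp (measurable_id.pow_const _)).mul hϖ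

theorem ae_norm_eq_one_sphereMeasure : ∀ᵐ w ∂(sphereMeasure d), ‖w‖ = 1 := by
  rw [sphereMeasure, ae_map_iff measurable_subtype_coe.aemeasurable
    (measurableSet_eq_fun measurable_norm measurable_const)]
  exact Eventually.of_forall fun w => by simp

theorem ae_pos_radialMeasure : ∀ᵐ ρ ∂(radialMeasure d ϖ), 0 < ρ := by
  refine (withDensity_absolutelyContinuous _ _).ae_le ?_
  exact ae_restrict_mem measurableSet_Ioi

theorem lintegral_volume_polar {f : E d → ℝ≥0∞} (hf : Measurable f) (hd : 1 ≤ d) :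
    ∫⁻ v, f v = ∫⁻ w, ∫⁻ ρ, f (ρ • w) ∂(radialMeasure d 1) ∂(sphereMeasure d) := by
  have : Nonempty (Fin d) := ⟨⟨0, hd⟩⟩
  have hsm : Measurable fun p : E d × ℝ => f (p.2 • p.1) :=
    hf.comp (measurable_snd.smul measurable_fst)
  have hr : ∀ w : E d, ∫⁻ ρ, f (ρ • w) ∂(radialMeasure d 1) =
      ∫⁻ ρ, f ((ρ : ℝ) • w) ∂(Measure.volumeIoiPow (d - 1)) := by
    intro w
    have hfw : Measurable fun ρ : ℝ => f (ρ • w) := hf.comp (measurable_id.smul_const w)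
    have hden := (measurable_radialDensity (d := d) (ϖ := 1) measurable_one).coe_nnreal_ennreal
    have hpow : Measurable fun r : Set.Ioi (0 : ℝ) => ENNReal.ofReal (r.1 ^ (d - 1)) :=
      ENNReal.measurable_ofReal.comp (measurable_subtype_coe.pow_const _)
    have hfw' : Measurable fun r : Set.Ioi (0 : ℝ) => f ((r : ℝ) • w) :=
      hfw.comp measurable_subtype_coe
    rw [radialMeasure, lintegral_withDensity_eq_lintegral_mul _ hden hfw, Measure.volumeIoiPow,
      lintegral_withDensity_eq_lintegral_mul _ hpow hfw',
      ← lintegral_subtype_comap measurableSet_Ioi]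
    refine lintegral_congr fun ρ => ?_
    simp [ENNReal.ofReal]
  simp_rw [hr]
  have hm2 : Measurable fun w : E d =>
      ∫⁻ ρ, f ((ρ : ℝ) • w) ∂(Measure.volumeIoiPow (d - 1)) := by
    have h1 : Measurable fun p : E d × Set.Ioi (0 : ℝ) => f ((p.2 : ℝ) • p.1) :=
      hf.comp ((measurable_subtype_coe.comp measurable_snd).smul measurable_fst)
    exact h1.lintegral_prod_right'
  rw [sphereMeasure, lintegral_map hm2 measurable_subtype_coe]
  have h2 := (volume : Measure (E d)).measurePreserving_homeomorphUnitSphereProd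
  rw [finrank_euclideanSpace, Fintype.card_fin] at h2
  have h3 : Measurable fun p : Metric.sphere (0 : E d) 1 × Set.Ioi (0 : ℝ) =>
      f ((p.2 : ℝ) • (p.1 : E d)) :=
    hf.comp ((measurable_subtype_coe.comp measurable_snd).smul
      (measurable_subtype_coe.comp measurable_fst))
  rw [← lintegral_prod _ h3.aemeasurable, ← h2.lintegral_comp h3]
  have h4 : ∀ x : ({0}ᶜ : Set (E d)),
      f (((homeomorphUnitSphereProd (E d) x).2 : ℝ) • ((homeomorphUnitSphereProd (E d) x).1 : E d)) =
      f x := by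
    intro x
    have hx : ‖(x : E d)‖ ≠ 0 := norm_ne_zero_iff.2 x.2
    congr 1
    simp [smul_smul, hx]
  simp_rw [h4]
  rw [lintegral_subtype_comap (measurableSet_singleton (0 : E d)).compl,
    restrict_compl_singleton]

theorem lintegral_velocityMeasure {f : E d → ℝ≥0∞} (hf : Measurable f) (hd : 1 ≤ d)
    (hϖ : Measurable ϖ) :
    ∫⁻ v, f v ∂(velocityMeasure d ϖ) =
      ∫⁻ w, ∫⁻ ρ, f (ρ • w) ∂(radialMeasure d ϖ) ∂(sphereMeasure d) := by
  have hϖm : Measurable fun v : E d => (ϖ ‖v‖ : ℝ≥0∞) :=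
    (hϖ.comp measurable_norm).coe_nnreal_ennreal
  rw [velocityMeasure, lintegral_withDensity_eq_lintegral_mul _ hϖm hf,
    lintegral_volume_polar (hϖm.mul hf) hd]
  refine lintegral_congr_ae (ae_norm_eq_one_sphereMeasure.mono fun w hw => ?_)
  have hfw : Measurable fun ρ : ℝ => f (ρ • w) := hf.comp (measurable_id.smul_const w)
  have hgw : Measurable fun ρ : ℝ => ((fun v : E d => (ϖ ‖v‖ : ℝ≥0∞)) * f) (ρ • w) :=
    (hϖm.mul hf).comp (measurable_id.smul_const w)
  have hden := (measurable_radialDensity (d := d) (ϖ := 1) measurable_one).coe_nnreal_ennreal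
  have hden' := (measurable_radialDensity (d := d) hϖ).coe_nnreal_ennreal
  beta_reduce
  rw [radialMeasure, radialMeasure, lintegral_withDensity_eq_lintegral_mul _ hden' hfw,
    lintegral_withDensity_eq_lintegral_mul _ hden hgw]
  refine setLIntegral_congr_fun measurableSet_Ioi fun ρ hρ => ?_
  have hρ : (0 : ℝ) < ρ := hρ
  simp [norm_smul, hw, abs_of_pos hρ, mul_assoc]

theorem velocityMeasure_eq_map (hd : 1 ≤ d) (hϖ : Measurable ϖ) :
    velocityMeasure d ϖ =
      ((sphereMeasure d).prod (radialMeasure d ϖ)).map fun p => p.2 • p.1 := by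
  have hm : Measurable fun p : E d × ℝ => p.2 • p.1 := measurable_snd.smul measurable_fst
  refine Measure.ext fun S hS => ?_
  have h1 : Measurable (S.indicator (1 : E d → ℝ≥0∞)) := measurable_one.indicator hS
  have h2 : Measurable fun p : E d × ℝ => S.indicator (1 : E d → ℝ≥0∞) (p.2 • p.1) := h1.comp hm
  rw [← lintegral_indicator_one hS, lintegral_velocityMeasure h1 hd hϖ,
    ← lintegral_indicator_one hS, lintegral_map h1 hm, lintegral_prod _ h2.aemeasurable]

theorem sphereMeasure_hyperplane (hd : 1 ≤ d) {n : E d} (hn : n ≠ 0) :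
    ∀ᵐ w ∂(sphereMeasure d), ⟪w, n⟫ ≠ 0 := by
  set S : Set (E d) := {v | ⟪v, n⟫ = 0} with hS
  have hSm : MeasurableSet S :=
    measurableSet_eq_fun (measurable_id.inner measurable_const) measurable_const
  have hS0 : (volume : Measure (E d)) S = 0 := by
    have h1 : S = ((ℝ ∙ n)ᗮ : Submodule ℝ (E d)) := by
      ext v
      rw [SetLike.mem_coe, Submodule.mem_orthogonal_singleton_iff_inner_left]
      rfl
    rw [h1]
    refine Measure.addHaar_submodule _ _ fun htop => hn ?_
    have h2 : n ∈ (ℝ ∙ n)ᗮ := htop ▸ Submodule.mem_top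
    exact inner_self_eq_zero.1 (Submodule.mem_orthogonal_singleton_iff_inner_left.1 h2)
  rw [← lintegral_indicator_one hSm, lintegral_volume_polar (measurable_one.indicator hSm) hd] at hS0
  have h3 : ∀ w : E d, ∫⁻ ρ, S.indicator (1 : E d → ℝ≥0∞) (ρ • w) ∂(radialMeasure d 1) =
      S.indicator 1 w * radialMeasure d 1 Set.univ := by
    intro w
    rw [← lintegral_one (μ := radialMeasure d 1), ← lintegral_const_mul _ measurable_const]
    refine lintegral_congr_ae (ae_pos_radialMeasure.mono fun ρ hρ => ?_)
    have h4 : ρ • w ∈ S ↔ w ∈ S := by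
      simp [hS, inner_smul_left, hρ.ne']
    by_cases hw : w ∈ S
    · simp [hw, h4.2 hw]
    · simp [hw, mt h4.1 hw]
  simp_rw [h3] at hS0
  have h5 : radialMeasure d 1 Set.univ ≠ 0 := by
    intro h0
    rw [radialMeasure, withDensity_apply _ MeasurableSet.univ, Measure.restrict_univ,
      lintegral_eq_zero_iff (measurable_radialDensity measurable_one).coe_nnreal_ennreal] at h0
    have h6 : ∀ᵐ ρ ∂(volume.restrict (Set.Ioi (0 : ℝ))), False := by
      filter_upwards [h0, ae_restrict_mem measurableSet_Ioi] with ρ h7 h8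
      have h8 : (0 : ℝ) < ρ := h8
      have h9 : (0 : ℝ) < ρ ^ (d - 1) := by positivity
      simp only [Pi.one_apply, mul_one, Pi.zero_apply, ENNReal.coe_eq_zero,
        Real.toNNReal_eq_zero] at h7
      linarith
    rw [eventually_false_iff_eq_bot, ae_eq_bot, Measure.restrict_eq_zero, Real.volume_Ioi] at h6
    exact ENNReal.top_ne_zero h6
  rw [lintegral_mul_const _ (measurable_one.indicator hSm), mul_eq_zero,
    lintegral_indicator_one hSm] at hS0
  exact measure_eq_zero_iff_ae_notMem.1 (hS0.resolve_right h5)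

end Polar

/-! ### The Riemann-Lebesgue lemma in the radial variable -/

section RiemannLebesgue

theorem tendsto_integral_Ioi_exp_inv (g : ℝ → ℂ) :
    Tendsto (fun w : ℝ => ∫ ρ in Set.Ioi (0 : ℝ), g ρ * Complex.exp (-(w * Complex.I) * (ρ⁻¹ : ℝ)))
      (cocompact ℝ) (𝓝 0) := by
  set G : ℝ → ℂ := (Set.Ioi (0 : ℝ)).indicator fun r => (r ^ (-2 : ℝ) : ℝ) • g r⁻¹ with hG
  have h1 := Real.tendsto_integral_exp_smul_cocompact G
  have h2 : Tendsto (fun w : ℝ => w / (2 * Real.pi)) (cocompact ℝ) (cocompact ℝ) :=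
    (Homeomorph.mulRight₀ ((2 * Real.pi)⁻¹) (by positivity)).isClosedEmbedding.tendsto_cocompact
  refine (h1.comp h2).congr fun w => ?_
  have h3 := integral_comp_rpow_Ioi
    (fun ρ : ℝ => g ρ * Complex.exp (-(w * Complex.I) * (ρ⁻¹ : ℝ))) (p := -1) (by norm_num)
  rw [← h3, Function.comp_apply, ← integral_indicator measurableSet_Ioi]
  refine integral_congr_ae (Eventually.of_forall fun r => ?_)
  beta_reduce
  by_cases hr : r ∈ Set.Ioi (0 : ℝ)
  · have hr' : (0 : ℝ) < r := hr
    rw [hG, Set.indicator_of_mem hr, Set.indicator_of_mem hr, Real.rpow_neg_one, inv_inv,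
      Circle.smul_def, Real.fourierChar_apply]
    have e1 : (2 * Real.pi * -(r * (w / (2 * Real.pi))) : ℝ) = -(w * r) := by
      field_simp
    rw [e1]
    norm_num
    ring_nf
  · rw [hG, Set.indicator_of_notMem hr, Set.indicator_of_notMem hr, smul_zero]

variable {ϖ : ℝ → ℝ≥0}

theorem tendsto_integral_radialMeasure (hϖ : Measurable ϖ) (f : ℝ → ℂ) :
    Tendsto (fun w : ℝ => ∫ ρ, f ρ * Complex.exp (-(w * Complex.I) * (ρ⁻¹ : ℝ)) ∂(radialMeasure d ϖ))
      (cocompact ℝ) (𝓝 0) := by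
  refine (tendsto_integral_Ioi_exp_inv
    fun ρ => ((Real.toNNReal (ρ ^ (d - 1)) * ϖ ρ : ℝ≥0) : ℝ) • f ρ).congr fun w => ?_
  rw [radialMeasure, integral_withDensity_eq_integral_smul (measurable_radialDensity hϖ)]
  refine integral_congr_ae (Eventually.of_forall fun ρ => ?_)
  simp only [NNReal.smul_def, smul_mul_assoc]

theorem tendsto_integral_radialMeasure_seq (hϖ : Measurable ϖ) {f : ℝ → ℂ}
    (hf : Integrable f (radialMeasure d ϖ)) {ε : ℝ} (hε : 0 ≤ ε) {s t : ℕ → ℝ}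
    (hs : Tendsto (fun n => |s n|) atTop atTop) {a b : ℝ} (ha : 0 < a)
    (ht : ∀ᶠ n in atTop, t n ∈ Set.Icc a b) :
    Tendsto (fun n => ∫ ρ, f ρ * Complex.exp (-(ε + s n * Complex.I) * ((t n / ρ : ℝ) : ℂ))
      ∂(radialMeasure d ϖ)) atTop (𝓝 0) := by
  refine tendsto_of_subseq_tendsto fun ns hns => ?_
  obtain ⟨N, hN⟩ := eventually_atTop.1 (hns.eventually ht)
  obtain ⟨t₀, ht₀, ms, hms, hlim⟩ := (isCompact_Icc (a := a) (b := b)).tendsto_subseq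
    (x := fun k => t (ns (k + N))) fun k => hN _ (Nat.le_add_left _ _)
  refine ⟨fun k => ms k + N, ?_⟩
  have hidx : Tendsto (fun k => ns (ms k + N)) atTop atTop :=
    hns.comp ((tendsto_add_atTop_nat N).comp hms.tendsto_atTop)
  set T : ℕ → ℝ := fun k => t (ns (ms k + N)) with hT
  set S : ℕ → ℝ := fun k => s (ns (ms k + N)) with hS
  have hTt : Tendsto T atTop (𝓝 t₀) := hlim
  have hTmem : ∀ k, T k ∈ Set.Icc a b := fun k => hN _ (Nat.le_add_left _ _)
  have hSt : Tendsto (fun k => |S k|) atTop atTop := hs.comp hidx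
  set ν := radialMeasure d ϖ with hν
  have hpos : ∀ᵐ ρ ∂ν, 0 < ρ := ae_pos_radialMeasure
  have hexp_le : ∀ x ρ : ℝ, 0 ≤ x → 0 < ρ → ‖Complex.exp ((-(ε * (x / ρ)) : ℝ) : ℂ)‖ ≤ 1 := by
    intro x ρ hx hρ
    rw [Complex.norm_exp, Complex.ofReal_re, Real.exp_le_one_iff, neg_nonpos]
    positivity
  have hexpm : ∀ x : ℝ, Measurable fun ρ : ℝ => Complex.exp ((-(ε * (x / ρ)) : ℝ) : ℂ) := by
    intro x; fun_prop
  have hoscm : ∀ w : ℝ, Measurable fun ρ : ℝ => Complex.exp (-(w * Complex.I) * (ρ⁻¹ : ℝ)) := by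
    intro w; fun_prop
  have hosc : ∀ w ρ : ℝ, ‖Complex.exp (-(w * Complex.I) * (ρ⁻¹ : ℝ))‖ = 1 := by
    intro w ρ
    rw [Complex.norm_exp]
    simp
  have ht₀pos : 0 ≤ t₀ := ha.le.trans ht₀.1
  have hFint : ∀ x : ℝ, 0 ≤ x →
      Integrable (fun ρ => f ρ * Complex.exp ((-(ε * (x / ρ)) : ℝ) : ℂ)) ν := fun x hx => by
    refine hf.mono (hf.1.mul (hexpm x).aestronglyMeasurable) (hpos.mono fun ρ hρ => ?_)
    rw [norm_mul]
    exact mul_le_of_le_one_right (norm_nonneg _) (hexp_le x ρ hx hρ)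
  have hosc_int : ∀ (w : ℝ) {g : ℝ → ℂ}, Integrable g ν →
      Integrable (fun ρ => g ρ * Complex.exp (-(w * Complex.I) * (ρ⁻¹ : ℝ))) ν := fun w g hg => by
    refine hg.mono (hg.1.mul (hoscm w).aestronglyMeasurable) (Eventually.of_forall fun ρ => ?_)
    rw [norm_mul, hosc, mul_one]
  have hRL : Tendsto (fun k => ∫ ρ, f ρ * Complex.exp ((-(ε * (t₀ / ρ)) : ℝ) : ℂ) *
      Complex.exp (-((S k * T k : ℝ) * Complex.I) * (ρ⁻¹ : ℝ)) ∂ν) atTop (𝓝 0) := by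
    have h1 : Tendsto (fun k => S k * T k) atTop (cocompact ℝ) := by
      refine tendsto_cocompact_of_tendsto_dist_comp_atTop 0 ?_
      refine tendsto_atTop_mono (fun k => ?_) (hSt.atTop_mul_const ha)
      rw [dist_zero_right, norm_mul, Real.norm_eq_abs, Real.norm_eq_abs]
      exact mul_le_mul_of_nonneg_left ((hTmem k).1.trans (le_abs_self _)) (abs_nonneg _)
    exact (tendsto_integral_radialMeasure hϖ _).comp h1
  have hdiff : Tendsto (fun k => ∫ ρ, ‖f ρ * Complex.exp ((-(ε * (T k / ρ)) : ℝ) : ℂ) -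
      f ρ * Complex.exp ((-(ε * (t₀ / ρ)) : ℝ) : ℂ)‖ ∂ν) atTop (𝓝 0) := by
    have h1 := tendsto_integral_of_dominated_convergence (μ := ν)
      (F := fun k ρ => ‖f ρ * Complex.exp ((-(ε * (T k / ρ)) : ℝ) : ℂ) -
        f ρ * Complex.exp ((-(ε * (t₀ / ρ)) : ℝ) : ℂ)‖) (f := fun _ => 0)
      (fun ρ => ‖f ρ‖ + ‖f ρ‖)
      (fun k => (((hFint _ (ha.le.trans (hTmem k).1)).sub (hFint _ ht₀pos)).norm).1)
      (hf.norm.add hf.norm) (fun k => hpos.mono fun ρ hρ => ?_)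
      (Eventually.of_forall fun ρ => ?_)
    · simpa using h1
    · rw [norm_norm]
      refine (norm_sub_le _ _).trans ?_
      rw [norm_mul, norm_mul]
      exact add_le_add
        (mul_le_of_le_one_right (norm_nonneg _) (hexp_le _ ρ (ha.le.trans (hTmem k).1) hρ))
        (mul_le_of_le_one_right (norm_nonneg _) (hexp_le _ ρ ht₀pos hρ))
    · have hc : Continuous fun x : ℝ => ‖f ρ * Complex.exp ((-(ε * (x / ρ)) : ℝ) : ℂ) -
          f ρ * Complex.exp ((-(ε * (t₀ / ρ)) : ℝ) : ℂ)‖ := by fun_prop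
      simpa [Function.comp_def] using (hc.tendsto t₀).comp hTt
  have hlim0 := hdiff.add hRL.norm
  rw [norm_zero, add_zero] at hlim0
  refine squeeze_zero_norm (fun k => ?_) hlim0
  have h1 : ∀ ρ : ℝ, f ρ * Complex.exp (-(ε + S k * Complex.I) * ((T k / ρ : ℝ) : ℂ)) =
      (f ρ * Complex.exp ((-(ε * (T k / ρ)) : ℝ) : ℂ) -
        f ρ * Complex.exp ((-(ε * (t₀ / ρ)) : ℝ) : ℂ)) *
          Complex.exp (-((S k * T k : ℝ) * Complex.I) * (ρ⁻¹ : ℝ)) +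
      f ρ * Complex.exp ((-(ε * (t₀ / ρ)) : ℝ) : ℂ) *
          Complex.exp (-((S k * T k : ℝ) * Complex.I) * (ρ⁻¹ : ℝ)) := by
    intro ρ
    rw [sub_mul, sub_add_cancel, mul_assoc, ← Complex.exp_add]
    congr 2
    push_cast
    ring
  have hi : Integrable (fun ρ => f ρ * Complex.exp ((-(ε * (T k / ρ)) : ℝ) : ℂ) -
      f ρ * Complex.exp ((-(ε * (t₀ / ρ)) : ℝ) : ℂ)) ν := (hFint _ (ha.le.trans (hTmem k).1)).sub (hFint _ ht₀pos)
  calc ‖∫ ρ, f ρ * Complex.exp (-(ε + S k * Complex.I) * ((T k / ρ : ℝ) : ℂ)) ∂ν‖ = _ := by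
        simp_rw [h1]
        rw [integral_add (hosc_int _ hi) (hosc_int _ (hFint _ ht₀pos))]
    _ ≤ _ := by
        refine (norm_add_le _ _).trans (add_le_add ?_ le_rfl)
        refine (norm_integral_le_integral_norm _).trans (le_of_eq ?_)
        refine integral_congr_ae (Eventually.of_forall fun ρ => ?_)
        beta_reduce
        rw [norm_mul, hosc, mul_one]

end RiemannLebesgue

/-! ### Averages of the phase over the incoming directions -/

section PhaseAverage

variable {Ω : Set (E d)} {ϖ : ℝ → ℝ≥0}

theorem exists_le_travelTime (hb : Bornology.IsBounded Ω) (hΩ : IsOpen Ω) (hC : HasC1Boundary Ω)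
    {y w : E d} (hy : y ∈ frontier Ω) (hw : ⟪w, outwardNormal Ω y⟫ < 0) :
    ∃ κ : ℝ, 0 < κ ∧ ∀ᶠ z in 𝓝 y, z ∈ frontier Ω → κ ≤ travelTime Ω z (-w) := by
  obtain ⟨φ, hφ⟩ := hC y hy
  have hw0 : w ≠ 0 := by rintro rfl; simp at hw
  have hgrad : fderiv ℝ φ y w < 0 := by
    rw [← IsDefiningFunction.inner_gradient]
    exact (hφ.inner_outwardNormal_neg_iff w).1 hw
  have hw' : 0 < ‖w‖ := norm_pos_iff.2 hw0
  set c : ℝ := -(fderiv ℝ φ y w) / (2 * ‖w‖) with hc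
  have hcpos : 0 < c := div_pos (by linarith) (by positivity)
  have hstrict := hφ.contDiffAt.hasStrictFDerivAt one_ne_zero
  have h1 := hstrict.isLittleO.def hcpos
  rw [nhds_prod_eq] at h1
  obtain ⟨pa, hpa, pb, hpb, hab⟩ := eventually_prod_iff.1 h1
  obtain ⟨r, hr, hball⟩ := Metric.eventually_nhds_iff_ball.1 (hpa.and hφ.mem_iff)
  refine ⟨r / (2 * ‖w‖), by positivity, ?_⟩
  filter_upwards [hpb, hφ.eventually_eq_zero hΩ, Metric.ball_mem_nhds y (half_pos hr)]
    with z hz1 hz2 hz3 hz4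
  refine le_csInf (travelTime_set_nonempty hb z (neg_ne_zero.2 hw0)) fun s hs => ?_
  by_contra! hlt
  refine hs.2 ?_
  have hs0 : 0 < s := hs.1
  have hmem : z - s • -w ∈ Metric.ball y r := by
    rw [smul_neg, sub_neg_eq_add, Metric.mem_ball, dist_eq_norm]
    rw [Metric.mem_ball, dist_eq_norm] at hz3
    rw [lt_div_iff₀ (by positivity)] at hlt
    calc ‖z + s • w - y‖ = ‖(z - y) + s • w‖ := by congr 1; abel
      _ ≤ ‖z - y‖ + ‖s • w‖ := norm_add_le _ _
      _ = ‖z - y‖ + s * ‖w‖ := by rw [norm_smul, Real.norm_of_nonneg hs0.le]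
      _ < r := by linarith
  obtain ⟨hpx, hiff⟩ := hball _ hmem
  rw [hiff]
  have h2 := hab hpx hz1
  have e1 : z - s • -w - z = s • w := by rw [smul_neg, sub_neg_eq_add, add_sub_cancel_left]
  rw [hz2 hz4, sub_zero, e1, map_smul, smul_eq_mul, norm_smul, Real.norm_of_nonneg hs0.le,
    Real.norm_eq_abs] at h2
  have h3 := (le_abs_self _).trans h2
  have h4 : c * (s * ‖w‖) = s * (-(fderiv ℝ φ y w) / 2) := by
    rw [hc]; field_simp
  rw [h4] at h3
  nlinarith [mul_neg_of_pos_of_neg hs0 hgrad]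

theorem travelTime_le (hb : Bornology.IsBounded Ω) {w : E d} (hw : w ≠ 0) :
    ∃ D : ℝ, ∀ z ∈ frontier Ω, travelTime Ω z w ≤ D := by
  obtain ⟨R, hR⟩ := hb.closure.subset_closedBall 0
  have hw' : 0 < ‖w‖ := norm_pos_iff.2 hw
  refine ⟨(2 * |R| + 1) / ‖w‖, fun z hz => csInf_le (travelTime_bddBelow z w) ⟨by positivity, ?_⟩⟩
  intro hmem
  have h1 := hR (subset_closure hmem)
  have h2 := hR (frontier_subset_closure hz)
  rw [mem_closedBall_zero_iff] at h1 h2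
  have h3 : ‖((2 * |R| + 1) / ‖w‖) • w‖ = 2 * |R| + 1 := by
    rw [norm_smul, Real.norm_of_nonneg (by positivity), div_mul_cancel₀ _ hw'.ne']
  have h4 : ‖((2 * |R| + 1) / ‖w‖) • w‖ ≤ ‖z‖ + ‖z - ((2 * |R| + 1) / ‖w‖) • w‖ := by
    have := norm_sub_le z (z - ((2 * |R| + 1) / ‖w‖) • w)
    rwa [sub_sub_cancel] at this
  have := le_abs_self R
  linarith

/-- The average over the directions `w` incoming at `y` of the modulus of
`∫ f (ρ w) exp (-l τ / ρ)`, where `τ` is the exit time from `y` in the direction `w`. -/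
def phaseAverage (Ω : Set (E d)) (ϖ : ℝ → ℝ≥0) (l : ℂ) (y : E d) (f : E d → ℂ) : ℝ≥0∞ :=
  ∫⁻ w in incoming Ω y,
    ‖∫ ρ, f (ρ • w) * Complex.exp (-l * ((travelTime Ω y (-w) / ρ : ℝ) : ℂ))
      ∂(radialMeasure d ϖ)‖ₑ ∂(sphereMeasure d)

theorem measurableSet_incoming (Ω : Set (E d)) (y : E d) : MeasurableSet (incoming Ω y) :=
  measurableSet_lt (measurable_id.inner measurable_const) measurable_const

theorem measurableSet_outgoing (Ω : Set (E d)) (y : E d) : MeasurableSet (outgoing Ω y) :=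
  measurableSet_lt measurable_const (measurable_id.inner measurable_const)

theorem measurable_radial_integrand (hΩ : IsOpen Ω) (hb : Bornology.IsBounded Ω) (l : ℂ)
    {u : E d × E d → ℂ} (hu : Measurable u) :
    Measurable fun q : (E d × E d) × ℝ => u (q.1.1, q.2 • q.1.2) *
      Complex.exp (-l * ((travelTime Ω q.1.1 (-q.1.2) / q.2 : ℝ) : ℂ)) := by
  have h1 : Measurable fun q : (E d × E d) × ℝ => travelTime Ω q.1.1 (-q.1.2) :=
    Measurable.comp (g := fun p : E d × E d => travelTime Ω p.1 p.2)
      (f := fun q : (E d × E d) × ℝ => (q.1.1, -q.1.2))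
      (measurable_travelTime hΩ hb) (by fun_prop)
  have h2 : Measurable fun q : (E d × E d) × ℝ => (q.1.1, q.2 • q.1.2) := by fun_prop
  exact (hu.comp h2).mul (Complex.measurable_exp.comp
    (measurable_const.mul (Complex.measurable_ofReal.comp (h1.div measurable_snd))))

theorem measurable_radial_integral (hΩ : IsOpen Ω) (hb : Bornology.IsBounded Ω) (l : ℂ)
    {u : E d × E d → ℂ} (hu : Measurable u) :
    Measurable fun p : E d × E d => ‖∫ ρ, u (p.1, ρ • p.2) *
      Complex.exp (-l * ((travelTime Ω p.1 (-p.2) / ρ : ℝ) : ℂ)) ∂(radialMeasure d ϖ)‖ₑ :=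
  ((measurable_radial_integrand hΩ hb l hu).stronglyMeasurable.integral_prod_right').enorm

theorem measurable_radial_integral_right (hΩ : IsOpen Ω) (hb : Bornology.IsBounded Ω) (l : ℂ)
    (y : E d) {f : E d → ℂ} (hf : Measurable f) :
    Measurable fun w : E d => ‖∫ ρ, f (ρ • w) *
      Complex.exp (-l * ((travelTime Ω y (-w) / ρ : ℝ) : ℂ)) ∂(radialMeasure d ϖ)‖ₑ :=
  Measurable.comp (g := fun p : E d × E d => ‖∫ ρ, f (ρ • p.2) *
      Complex.exp (-l * ((travelTime Ω p.1 (-p.2) / ρ : ℝ) : ℂ)) ∂(radialMeasure d ϖ)‖ₑ)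
    (f := fun w => (y, w))
    (measurable_radial_integral hΩ hb l (hf.comp measurable_snd)) (by fun_prop)

theorem norm_exp_travelTime_le {l : ℂ} (hl : 0 ≤ l.re) (y w : E d) {ρ : ℝ} (hρ : 0 < ρ) :
    ‖Complex.exp (-l * ((travelTime Ω y w / ρ : ℝ) : ℂ))‖ ≤ 1 := by
  rw [Complex.norm_exp, Real.exp_le_one_iff]
  have : (-l * ((travelTime Ω y w / ρ : ℝ) : ℂ)).re = -(l.re * (travelTime Ω y w / ρ)) := by simp
  rw [this, neg_nonpos]
  exact mul_nonneg hl (div_nonneg (travelTime_nonneg _ _) hρ.le)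

theorem enorm_radial_integral_le {l : ℂ} (hl : 0 ≤ l.re) (y w : E d) (f : E d → ℂ) :
    ‖∫ ρ, f (ρ • w) * Complex.exp (-l * ((travelTime Ω y (-w) / ρ : ℝ) : ℂ))
      ∂(radialMeasure d ϖ)‖ₑ ≤ ∫⁻ ρ, ‖f (ρ • w)‖ₑ ∂(radialMeasure d ϖ) := by
  refine (enorm_integral_le_lintegral_enorm _).trans (lintegral_mono_ae ?_)
  filter_upwards [ae_pos_radialMeasure] with ρ hρ
  rw [enorm_mul]
  refine mul_le_of_le_one_right' ?_
  rw [← ofReal_norm]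
  exact ENNReal.ofReal_le_one.2 (norm_exp_travelTime_le hl y (-w) hρ)

theorem ae_integrable_radial (hd : 1 ≤ d) (hϖ : Measurable ϖ) {f : E d → ℂ} (hf : Measurable f)
    (hfi : ∫⁻ v, ‖f v‖ₑ ∂(velocityMeasure d ϖ) ≠ ∞) :
    ∀ᵐ w ∂(sphereMeasure d), Integrable (fun ρ => f (ρ • w)) (radialMeasure d ϖ) := by
  rw [lintegral_velocityMeasure hf.enorm hd hϖ] at hfi
  have hm : Measurable fun w : E d => ∫⁻ ρ, ‖f (ρ • w)‖ₑ ∂(radialMeasure d ϖ) := by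
    have h1 : Measurable fun p : E d × ℝ => ‖f (p.2 • p.1)‖ₑ :=
      (hf.comp (measurable_snd.smul measurable_fst)).enorm
    exact h1.lintegral_prod_right'
  filter_upwards [ae_lt_top hm hfi] with w hw
  exact ⟨(hf.comp (measurable_id.smul_const w)).aestronglyMeasurable, hw⟩

theorem tendsto_phaseAverage_seq (hd : 1 ≤ d) (hΩ : IsOpen Ω) (hb : Bornology.IsBounded Ω)
    (hC : HasC1Boundary Ω) (hϖ : Measurable ϖ) {f : E d → ℂ} (hf : Measurable f)
    (hfi : ∫⁻ v, ‖f v‖ₑ ∂(velocityMeasure d ϖ) ≠ ∞) {ε : ℝ} (hε : 0 ≤ ε) {s : ℕ → ℝ}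
    (hs : Tendsto (fun n => |s n|) atTop atTop) {y : ℕ → E d} (hy : ∀ n, y n ∈ frontier Ω)
    {y₀ : E d} (hy₀ : y₀ ∈ frontier Ω) (hlim : Tendsto y atTop (𝓝 y₀)) :
    Tendsto (fun n => phaseAverage Ω ϖ (ε + s n * Complex.I) (y n) f) atTop (𝓝 0) := by
  have hre : ∀ n, 0 ≤ ((ε : ℂ) + s n * Complex.I).re := fun n => by simpa using hε
  have hfi' := hfi
  rw [lintegral_velocityMeasure hf.enorm hd hϖ] at hfi'
  simp_rw [phaseAverage, ← lintegral_indicator (measurableSet_incoming Ω _)]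
  have hint := ae_integrable_radial hd hϖ hf hfi
  have hn₀ : outwardNormal Ω y₀ ≠ 0 := by
    rw [← norm_ne_zero_iff, norm_outwardNormal hC hy₀]
    exact one_ne_zero
  have hnlim : Tendsto (fun n => outwardNormal Ω (y n)) atTop (𝓝 (outwardNormal Ω y₀)) :=
    (continuousOn_outwardNormal hΩ hC y₀ hy₀).tendsto.comp
      (tendsto_nhdsWithin_iff.2 ⟨hlim, Eventually.of_forall hy⟩)
  have key := tendsto_lintegral_of_dominated_convergence (μ := sphereMeasure d)
    (F := fun n => (incoming Ω (y n)).indicator fun w => ‖∫ ρ, f (ρ • w) *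
      Complex.exp (-(ε + s n * Complex.I) * ((travelTime Ω (y n) (-w) / ρ : ℝ) : ℂ))
        ∂(radialMeasure d ϖ)‖ₑ) (f := fun _ => 0)
    (fun w => ∫⁻ ρ, ‖f (ρ • w)‖ₑ ∂(radialMeasure d ϖ))
    (fun n => (measurable_radial_integral_right hΩ hb _ (y n) hf).indicator
      (measurableSet_incoming Ω _))
    (fun n => Eventually.of_forall fun w => (Set.indicator_le_self _ _ w).trans
      (enorm_radial_integral_le (hre n) (y n) w f)) hfi' ?_
  · simpa using key
  filter_upwards [hint, sphereMeasure_hyperplane hd hn₀] with w hw1 hw2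
  have hin : Tendsto (fun n => ⟪w, outwardNormal Ω (y n)⟫) atTop (𝓝 ⟪w, outwardNormal Ω y₀⟫) :=
    tendsto_const_nhds.inner hnlim
  rcases lt_or_gt_of_ne hw2 with h | h
  · have hw0 : w ≠ 0 := by rintro rfl; simp at h
    obtain ⟨κ, hκ, hev⟩ := exists_le_travelTime hb hΩ hC hy₀ h
    obtain ⟨D, hD⟩ := travelTime_le hb (neg_ne_zero.2 hw0)
    have h1 := tendsto_integral_radialMeasure_seq (d := d) hϖ hw1 hε hs
      (t := fun n => travelTime Ω (y n) (-w)) (b := D) hκ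
      ((hlim.eventually hev).mono fun n hn => ⟨hn (hy n), hD _ (hy n)⟩)
    have h2 := (continuous_enorm.tendsto (0 : ℂ)).comp h1
    rw [enorm_zero] at h2
    refine tendsto_of_tendsto_of_tendsto_of_le_of_le tendsto_const_nhds h2 (fun _ => zero_le)
      fun n => Set.indicator_le_self _ _ w
  · refine tendsto_const_nhds.congr' ?_
    filter_upwards [hin.eventually (lt_mem_nhds h)] with n hn
    have hnot : w ∉ incoming Ω (y n) := fun hmem => absurd hn (not_lt.2 (le_of_lt hmem))
    rw [Set.indicator_of_notMem hnot]

theorem exists_phaseAverage_le (hd : 1 ≤ d) (hΩ : IsOpen Ω) (hb : Bornology.IsBounded Ω)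
    (hC : HasC1Boundary Ω) (hϖ : Measurable ϖ) {f : E d → ℂ} (hf : Measurable f)
    (hfi : ∫⁻ v, ‖f v‖ₑ ∂(velocityMeasure d ϖ) ≠ ∞) {ε : ℝ} (hε : 0 ≤ ε) {η : ℝ≥0∞} (hη : 0 < η) :
    ∃ R : ℝ, ∀ s : ℝ, R ≤ |s| → ∀ y ∈ frontier Ω,
      phaseAverage Ω ϖ (ε + s * Complex.I) y f ≤ η := by
  by_contra! hcon
  choose s hs y hy hlt using fun n : ℕ => hcon n
  have hcpt : IsCompact (frontier Ω) :=
    Metric.isCompact_of_isClosed_isBounded isClosed_frontier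
      (hb.closure.subset frontier_subset_closure)
  obtain ⟨y₀, hy₀, ms, hms, hlim⟩ := hcpt.tendsto_subseq hy
  have hs' : Tendsto (fun k => |s (ms k)|) atTop atTop :=
    (tendsto_atTop_mono hs tendsto_natCast_atTop_atTop).comp hms.tendsto_atTop
  have h1 := tendsto_phaseAverage_seq hd hΩ hb hC hϖ hf hfi hε hs' (fun k => hy (ms k)) hy₀ hlim
  obtain ⟨k, hk⟩ := (h1.eventually (gt_mem_nhds hη)).exists
  exact absurd hk (not_lt.2 (hlt (ms k)).le)

theorem phaseAverage_le_add (hd : 1 ≤ d) (hΩ : IsOpen Ω) (hb : Bornology.IsBounded Ω)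
    (hϖ : Measurable ϖ) {l : ℂ} (hl : 0 ≤ l.re) (y : E d) {f g : E d → ℂ} (hf : Measurable f)
    (hg : Measurable g) (hgi : ∫⁻ v, ‖g v‖ₑ ∂(velocityMeasure d ϖ) ≠ ∞) :
    phaseAverage Ω ϖ l y f ≤ phaseAverage Ω ϖ l y g +
      ∫⁻ v in incoming Ω y, ‖f v - g v‖ₑ ∂(velocityMeasure d ϖ) := by
  have hfg : Measurable fun v => ‖f v - g v‖ₑ := (hf.sub hg).enorm
  have h1 : ∫⁻ v in incoming Ω y, ‖f v - g v‖ₑ ∂(velocityMeasure d ϖ) =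
      ∫⁻ w in incoming Ω y, ∫⁻ ρ, ‖f (ρ • w) - g (ρ • w)‖ₑ ∂(radialMeasure d ϖ)
        ∂(sphereMeasure d) := by
    rw [← lintegral_indicator (measurableSet_incoming Ω y),
      lintegral_velocityMeasure (hfg.indicator (measurableSet_incoming Ω y)) hd hϖ,
      ← lintegral_indicator (measurableSet_incoming Ω y)]
    refine lintegral_congr fun w => ?_
    have h2 : ∀ ρ : ℝ, 0 < ρ → (ρ • w ∈ incoming Ω y ↔ w ∈ incoming Ω y) := fun ρ hρ => by
      simp only [incoming, Set.mem_ofPred_eq, inner_smul_left, conj_trivial]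
      exact ⟨fun h => by by_contra! hc; exact absurd (mul_nonneg hρ.le hc) (not_le.2 h),
        fun h => mul_neg_of_pos_of_neg hρ h⟩
    by_cases hw : w ∈ incoming Ω y
    · rw [Set.indicator_of_mem hw]
      refine lintegral_congr_ae (ae_pos_radialMeasure.mono fun ρ hρ => ?_)
      exact Set.indicator_of_mem ((h2 ρ hρ).2 hw) _
    · rw [Set.indicator_of_notMem hw, ← lintegral_zero (μ := radialMeasure d ϖ)]
      refine lintegral_congr_ae (ae_pos_radialMeasure.mono fun ρ hρ => ?_)
      exact Set.indicator_of_notMem (fun h => hw ((h2 ρ hρ).1 h)) _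
  rw [h1, phaseAverage, phaseAverage,
    ← lintegral_add_left (measurable_radial_integral_right hΩ hb l y hg)]
  refine lintegral_mono_ae (ae_restrict_of_ae ?_)
  filter_upwards [ae_integrable_radial hd hϖ hg hgi] with w hw
  have hem : Measurable fun ρ : ℝ =>
      Complex.exp (-l * ((travelTime Ω y (-w) / ρ : ℝ) : ℂ)) := by fun_prop
  have hge : Integrable (fun ρ => g (ρ • w) * Complex.exp (-l * ((travelTime Ω y (-w) / ρ : ℝ) : ℂ))) (radialMeasure d ϖ) := by
    refine hw.mono (hw.1.mul hem.aestronglyMeasurable) ?_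
    filter_upwards [ae_pos_radialMeasure] with ρ hρ
    rw [norm_mul]
    exact mul_le_of_le_one_right (norm_nonneg _) (norm_exp_travelTime_le hl y (-w) hρ)
  by_cases hfe : Integrable (fun ρ => f (ρ • w) * Complex.exp (-l * ((travelTime Ω y (-w) / ρ : ℝ) : ℂ))) (radialMeasure d ϖ)
  · have h3 : ∫ ρ, f (ρ • w) * Complex.exp (-l * ((travelTime Ω y (-w) / ρ : ℝ) : ℂ)) ∂(radialMeasure d ϖ) =
        ∫ ρ, g (ρ • w) * Complex.exp (-l * ((travelTime Ω y (-w) / ρ : ℝ) : ℂ)) ∂(radialMeasure d ϖ) +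
          ∫ ρ, (fun v => f v - g v) (ρ • w) * Complex.exp (-l * ((travelTime Ω y (-w) / ρ : ℝ) : ℂ)) ∂(radialMeasure d ϖ) := by
      rw [← integral_add hge]
      · refine integral_congr_ae (Eventually.of_forall fun ρ => ?_)
        ring
      · refine (hfe.sub hge).congr (Eventually.of_forall fun ρ => ?_)
        simp only [Pi.sub_apply]
        ring
    have h4 := enorm_radial_integral_le (Ω := Ω) (ϖ := ϖ) hl y w fun v => f v - g v
    rw [h3]
    exact (enorm_add_le _ _).trans (add_le_add_right h4 _)
  · rw [integral_undef hfe, enorm_zero]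
    exact zero_le

/-- The phase averages tend to `0` uniformly on totally bounded sets. -/
theorem exists_phaseAverage_le_of_totallyBounded (hd : 1 ≤ d) (hΩ : IsOpen Ω)
    (hb : Bornology.IsBounded Ω) (hC : HasC1Boundary Ω) (hϖ : Measurable ϖ)
    {S : Set (Lp ℂ 1 (velocityMeasure d ϖ))} (hS : TotallyBounded S)
    {g : E d → ℂ} (hg : Measurable g) {c : ℝ≥0} (hgc : ∀ v, ‖g v‖ₑ ≤ c)
    {ε : ℝ} (hε : 0 ≤ ε) {η : ℝ≥0} (hη : 0 < η) :
    ∃ R : ℝ, ∀ s : ℝ, R ≤ |s| → ∀ y ∈ frontier Ω, ∀ F ∈ S,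
      phaseAverage Ω ϖ (ε + s * Complex.I) y (fun v => g v * F v) ≤ η := by
  set δ : ℝ≥0 := η / (2 * (c + 1)) with hδ
  have hδpos : 0 < δ := by positivity
  obtain ⟨t, htS, htf, hcov⟩ := EMetric.totallyBounded_iff'.1 hS δ (by exact_mod_cast hδpos)
  have hm : ∀ F : Lp ℂ 1 (velocityMeasure d ϖ), Measurable fun v => g v * F v := fun F =>
    hg.mul (Lp.stronglyMeasurable F).measurable
  have hfin : ∀ F : Lp ℂ 1 (velocityMeasure d ϖ),
      ∫⁻ v, ‖g v * F v‖ₑ ∂(velocityMeasure d ϖ) ≠ ∞ := fun F => by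
    have h1 := Lp.eLpNorm_ne_top F
    rw [eLpNorm_one_eq_lintegral_enorm] at h1
    refine ne_top_of_le_ne_top (ENNReal.mul_ne_top (ENNReal.coe_ne_top (r := c)) h1) ?_
    rw [← lintegral_const_mul' _ _ ENNReal.coe_ne_top]
    refine lintegral_mono fun v => ?_
    rw [enorm_mul]
    exact mul_le_mul' (hgc v) le_rfl
  have hη2 : (0 : ℝ≥0∞) < (η / 2 : ℝ≥0) := by exact_mod_cast half_pos hη
  choose R hR using fun F : Lp ℂ 1 (velocityMeasure d ϖ) =>
    exists_phaseAverage_le hd hΩ hb hC hϖ (hm F) (hfin F) hε hη2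
  obtain ⟨R₀, hR₀⟩ := (htf.image R).bddAbove
  refine ⟨R₀, fun s hs y hy F hF => ?_⟩
  obtain ⟨F', hF', hdist⟩ := Set.mem_iUnion₂.1 (hcov hF)
  have h1 := hR F' s ((hR₀ ⟨F', hF', rfl⟩).trans hs) y hy
  have hre : 0 ≤ ((ε : ℂ) + s * Complex.I).re := by simpa using hε
  refine (phaseAverage_le_add hd hΩ hb hϖ hre y (hm F) (hm F') (hfin F')).trans ?_
  have h2 : ∫⁻ v in incoming Ω y, ‖g v * F v - g v * F' v‖ₑ ∂(velocityMeasure d ϖ) ≤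
      (η / 2 : ℝ≥0) := by
    calc _ ≤ ∫⁻ v, ‖g v * F v - g v * F' v‖ₑ ∂(velocityMeasure d ϖ) := setLIntegral_le_lintegral _ _
      _ ≤ ∫⁻ v, c * ‖F v - F' v‖ₑ ∂(velocityMeasure d ϖ) := by
        refine lintegral_mono fun v => ?_
        rw [← mul_sub, enorm_mul]
        exact mul_le_mul' (hgc v) le_rfl
      _ = c * edist F F' := by
        rw [lintegral_const_mul' _ _ ENNReal.coe_ne_top, Lp.edist_def,
          eLpNorm_one_eq_lintegral_enorm]
        rfl
      _ ≤ c * δ := by gcongr; exact (Metric.mem_eball.1 hdist).le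
      _ ≤ (η / 2 : ℝ≥0) := by
        rw [← ENNReal.coe_mul, ENNReal.coe_le_coe, hδ, ← NNReal.coe_le_coe]
        push_cast
        rw [mul_div_assoc', div_le_div_iff₀ (by positivity) (by positivity)]
        have hc := c.coe_nonneg
        have hη' : (0 : ℝ) < η := hη
        nlinarith [mul_nonneg hc hη'.le]
  calc _ ≤ ((η / 2 : ℝ≥0) : ℝ≥0∞) + (η / 2 : ℝ≥0) := add_le_add h1 h2
    _ = η := by rw [← ENNReal.coe_add, add_halves]

end PhaseAverage

/-! ### Adjoints of integral operators and compactness -/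

section Adjoint

variable {m : Measure (E d)}

theorem Lp_top_ae_enorm_le (ψ : Lp ℂ ∞ m) : ∀ᵐ v ∂m, ‖ψ v‖ₑ ≤ ‖ψ‖ₑ := by
  have h := enorm_ae_le_eLpNormEssSup ψ m
  rwa [← eLpNorm_exponent_top, ← Lp.enorm_def] at h

theorem Lp_one_enorm_eq_lintegral (φ : Lp ℂ 1 m) : ‖φ‖ₑ = ∫⁻ v, ‖φ v‖ₑ ∂m := by
  rw [Lp.enorm_def, eLpNorm_one_eq_lintegral_enorm]

theorem enorm_integral_mul_le (φ : Lp ℂ 1 m) (ψ : Lp ℂ ∞ m) :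
    ‖∫ v, φ v * ψ v ∂m‖ₑ ≤ ‖ψ‖ₑ * ‖φ‖ₑ := by
  refine (enorm_integral_le_lintegral_enorm _).trans ?_
  rw [Lp_one_enorm_eq_lintegral, ← lintegral_const_mul' _ _ enorm_ne_top]
  refine lintegral_mono_ae ((Lp_top_ae_enorm_le ψ).mono fun v hv => ?_)
  rw [enorm_mul, mul_comm]
  exact mul_le_mul' hv le_rfl

theorem integrable_mul_Lp (φ : Lp ℂ 1 m) (ψ : Lp ℂ ∞ m) :
    Integrable (fun v => φ v * ψ v) m :=
  (L1.integrable_coeFn φ).mul_of_top_left (Lp.memLp ψ)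

theorem exists_bounded_representative (g : Lp ℂ ∞ m) :
    ∃ (g' : E d → ℂ) (c : ℝ≥0), Measurable g' ∧ (∀ v, ‖g' v‖ₑ ≤ c) ∧ g =ᵐ[m] g' := by
  have hgm := (Lp.stronglyMeasurable g).measurable
  have hs : MeasurableSet {v | ‖g v‖ₑ ≤ ‖g‖ₑ} := measurableSet_le hgm.enorm measurable_const
  refine ⟨{v | ‖g v‖ₑ ≤ ‖g‖ₑ}.indicator g, ‖g‖₊, hgm.indicator hs, fun v => ?_, ?_⟩
  · by_cases hv : v ∈ {v | ‖g v‖ₑ ≤ ‖g‖ₑ}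
    · rw [Set.indicator_of_mem hv]
      exact hv
    · rw [Set.indicator_of_notMem hv, enorm_zero]
      exact zero_le
  · filter_upwards [Lp_top_ae_enorm_le g] with v hv
    exact (Set.indicator_of_mem (s := {v | ‖g v‖ₑ ≤ ‖g‖ₑ}) hv _).symm

variable {κ : E d → E d → ℝ} {T : Lp ℂ 1 m →L[ℂ] Lp ℂ 1 m}

/-- The column masses of a nonnegative kernel are bounded by the norm of its operator. -/
theorem IsIntegralOperator.ae_lintegral_kernel_le [SigmaFinite m] (hT : IsIntegralOperator m κ T)
    (hκ : Measurable (Function.uncurry κ)) (hκ0 : ∀ v v', 0 ≤ κ v v') :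
    ∀ᵐ v' ∂m, ∫⁻ v, ‖κ v v'‖ₑ ∂m ≤ ‖T‖ₑ := by
  have hκe : Measurable fun p : E d × E d => ‖κ p.1 p.2‖ₑ := hκ.enorm
  have hcol : Measurable fun v' => ∫⁻ v, ‖κ v v'‖ₑ ∂m := hκe.lintegral_prod_left'
  refine ae_le_of_forall_setLIntegral_le_of_sigmaFinite hcol fun s hs hms => ?_
  set χ : Lp ℂ 1 m := indicatorConstLp 1 hs hms.ne (1 : ℂ) with hχ
  have hχe : χ =ᵐ[m] s.indicator fun _ => (1 : ℂ) := indicatorConstLp_coeFn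
  obtain ⟨hint, happ⟩ := hT χ
  calc ∫⁻ v' in s, ∫⁻ v, ‖κ v v'‖ₑ ∂m ∂m = ∫⁻ v, ∫⁻ v' in s, ‖κ v v'‖ₑ ∂m ∂m :=
        lintegral_lintegral_swap (hκe.comp measurable_swap).aemeasurable
    _ = ∫⁻ v, ‖T χ v‖ₑ ∂m := by
        refine lintegral_congr_ae ?_
        filter_upwards [hint, happ] with v h1 h2
        rw [h2]
        have h3 : (fun v' => κ v v' • χ v') =ᵐ[m] fun v' => ((s.indicator (κ v) v' : ℝ) : ℂ) := by
          filter_upwards [hχe] with v' hv'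
          rw [hv']
          by_cases h4 : v' ∈ s <;> simp [h4]
        have h5 : Integrable (s.indicator (κ v)) m := by
          have h6 := (h1.congr h3).re
          simpa using h6
        rw [integral_congr_ae h3, integral_complex_ofReal, ← lintegral_indicator hs]
        have h7 : 0 ≤ ∫ v', s.indicator (κ v) v' ∂m :=
          integral_nonneg fun v' => Set.indicator_nonneg (fun _ _ => hκ0 v _) v'
        rw [← ofReal_norm, Complex.norm_real, Real.norm_of_nonneg h7,
          ofReal_integral_eq_lintegral_ofReal h5
            (Eventually.of_forall fun v' => Set.indicator_nonneg (fun _ _ => hκ0 v _) v')]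
        refine lintegral_congr fun v' => ?_
        by_cases h4 : v' ∈ s
        · rw [Set.indicator_of_mem h4, Set.indicator_of_mem h4, ← ofReal_norm,
            Real.norm_of_nonneg (hκ0 v v')]
        · rw [Set.indicator_of_notMem h4, Set.indicator_of_notMem h4, ENNReal.ofReal_zero]
    _ = ‖T χ‖ₑ := (Lp_one_enorm_eq_lintegral _).symm
    _ ≤ ‖T‖ₑ * ‖χ‖ₑ := T.le_opENorm χ
    _ = ∫⁻ _ in s, ‖T‖ₑ ∂m := by
        rw [setLIntegral_const]
        congr 1
        rw [Lp_one_enorm_eq_lintegral, lintegral_congr_ae (hχe.mono fun v hv => congrArg enorm hv),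
          ← lintegral_indicator_one hs]
        refine lintegral_congr fun v => ?_
        by_cases h4 : v ∈ s <;> simp [h4]

/-- The adjoint of an integral operator with nonnegative kernel acts on `L^∞`. -/
theorem IsIntegralOperator.exists_isAdjointImage [SigmaFinite m] (hT : IsIntegralOperator m κ T)
    (hκ : Measurable (Function.uncurry κ)) (hκ0 : ∀ v v', 0 ≤ κ v v') (ψ : Lp ℂ ∞ m) :
    ∃ g : Lp ℂ ∞ m, IsAdjointImage T ψ g := by
  have hcol := hT.ae_lintegral_kernel_le hκ hκ0
  have hκe : Measurable fun p : E d × E d => ‖κ p.1 p.2‖ₑ := hκ.enorm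
  have hψm := (Lp.stronglyMeasurable ψ).measurable
  have hmeas : Measurable fun p : E d × E d => κ p.1 p.2 • ψ p.1 :=
    hκ.smul (hψm.comp measurable_fst)
  have hbound : ∀ v', ∫⁻ v, ‖κ v v' • ψ v‖ₑ ∂m ≤ ‖ψ‖ₑ * ∫⁻ v, ‖κ v v'‖ₑ ∂m := fun v' => by
    rw [← lintegral_const_mul' _ _ enorm_ne_top]
    refine lintegral_mono_ae ((Lp_top_ae_enorm_le ψ).mono fun v hv => ?_)
    rw [enorm_smul, mul_comm]
    exact mul_le_mul' hv le_rfl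
  have hg₀ : MemLp (fun v' => ∫ v, κ v v' • ψ v ∂m) ∞ m := by
    refine memLp_top_of_bound_enorm
      (hmeas.stronglyMeasurable.integral_prod_left').aestronglyMeasurable (‖ψ‖₊ * ‖T‖₊)
      (hcol.mono fun v' hv' => ?_)
    rw [ENNReal.coe_mul]
    exact (enorm_integral_le_lintegral_enorm _).trans
      ((hbound v').trans (mul_le_mul' le_rfl hv'))
  refine ⟨hg₀.toLp, fun φ => ?_⟩
  obtain ⟨hint, happ⟩ := hT φ
  have hφm := (Lp.stronglyMeasurable φ).measurable
  have hprod : Integrable (Function.uncurry fun v v' => (κ v v' • φ v') * ψ v) (m.prod m) := by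
    have hm1 : Measurable (Function.uncurry fun v v' => (κ v v' • φ v') * ψ v) :=
      (hκ.smul (hφm.comp measurable_snd)).mul (hψm.comp measurable_fst)
    refine ⟨hm1.aestronglyMeasurable, ?_⟩
    rw [hasFiniteIntegral_iff_enorm, lintegral_prod_symm' _ hm1.enorm]
    calc _ ≤ ∫⁻ v', (‖ψ‖ₑ * ‖T‖ₑ) * ‖φ v'‖ₑ ∂m := by
          refine lintegral_mono_ae (hcol.mono fun v' hv' => ?_)
          calc ∫⁻ v, ‖(κ v v' • φ v') * ψ v‖ₑ ∂m = ∫⁻ v, ‖κ v v' • ψ v‖ₑ * ‖φ v'‖ₑ ∂m := by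
                refine lintegral_congr fun v => ?_
                rw [← enorm_mul, smul_mul_assoc, smul_mul_assoc, mul_comm (φ v')]
            _ = (∫⁻ v, ‖κ v v' • ψ v‖ₑ ∂m) * ‖φ v'‖ₑ := lintegral_mul_const' _ _ enorm_ne_top
            _ ≤ _ := mul_le_mul' ((hbound v').trans (mul_le_mul' le_rfl hv')) le_rfl
      _ = (‖ψ‖ₑ * ‖T‖ₑ) * ‖φ‖ₑ := by
          rw [lintegral_const_mul' _ _ (ENNReal.mul_ne_top enorm_ne_top enorm_ne_top),
            Lp_one_enorm_eq_lintegral]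
      _ < ∞ := ENNReal.mul_lt_top (ENNReal.mul_lt_top enorm_lt_top enorm_lt_top) enorm_lt_top
  calc ∫ v, T φ v * ψ v ∂m = ∫ v, ∫ v', (κ v v' • φ v') * ψ v ∂m ∂m := by
        refine integral_congr_ae (happ.mono fun v hv => ?_)
        beta_reduce
        rw [hv, integral_mul_const]
    _ = ∫ v', ∫ v, (κ v v' • φ v') * ψ v ∂m ∂m := integral_integral_swap hprod
    _ = ∫ v', φ v' * hg₀.toLp _ v' ∂m := by
        refine integral_congr_ae (hg₀.coeFn_toLp.mono fun v' hv' => ?_)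
        beta_reduce
        rw [hv', ← integral_const_mul]
        refine integral_congr_ae (Eventually.of_forall fun v => ?_)
        beta_reduce
        rw [smul_mul_assoc, mul_smul_comm]

/-- Finitely many bounded functions almost norm a totally bounded set of `L¹`. -/
theorem exists_norming_finset {S : Set (Lp ℂ 1 m)} (hS : TotallyBounded S) {η : ℝ≥0}
    (hη : 0 < η) :
    ∃ t : Finset (Lp ℂ ∞ m), ∀ f ∈ S, ‖f‖ₑ ≤ η + ∑ ψ ∈ t, ‖∫ v, f v * ψ v ∂m‖ₑ := by
  classical
  have hsgn : ∀ f : Lp ℂ 1 m, ∃ ψ : Lp ℂ ∞ m, ‖ψ‖ₑ ≤ 1 ∧ ‖∫ v, f v * ψ v ∂m‖ₑ = ‖f‖ₑ := by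
    intro f
    have hfm := (Lp.stronglyMeasurable f).measurable
    have hm : Measurable fun v => (starRingEnd ℂ) (f v) / (‖f v‖ : ℂ) :=
      (Complex.continuous_conj.measurable.comp hfm).div
        (Complex.measurable_ofReal.comp hfm.norm)
    have hle : ∀ v, ‖(starRingEnd ℂ) (f v) / (‖f v‖ : ℂ)‖ ≤ 1 := fun v => by
      rw [norm_div, RCLike.norm_conj, Complex.norm_real, norm_norm]
      exact div_self_le_one _
    have hmem : MemLp (fun v => (starRingEnd ℂ) (f v) / (‖f v‖ : ℂ)) ∞ m :=
      memLp_top_of_bound hm.aestronglyMeasurable 1 (Eventually.of_forall hle)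
    refine ⟨hmem.toLp, ?_, ?_⟩
    · rw [Lp.enorm_toLp, eLpNorm_exponent_top]
      refine eLpNormEssSup_le_of_ae_enorm_bound (Eventually.of_forall fun v => ?_)
      rw [← ofReal_norm]
      exact ENNReal.ofReal_le_one.2 (hle v)
    · have h1 : ∫ v, f v * hmem.toLp _ v ∂m = ((∫ v, ‖f v‖ ∂m : ℝ) : ℂ) := by
        rw [← integral_complex_ofReal]
        refine integral_congr_ae (hmem.coeFn_toLp.mono fun v hv => ?_)
        beta_reduce
        rw [hv, ← mul_div_assoc, Complex.mul_conj']
        rcases eq_or_ne (f v) 0 with h0 | h0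
        · simp [h0]
        · have : (‖f v‖ : ℂ) ≠ 0 := by simpa using h0
          field_simp
      rw [h1, ← L1.norm_eq_integral_norm, ← ofReal_norm, Complex.norm_real, norm_norm, ofReal_norm]
  choose σ hσ1 hσ2 using hsgn
  obtain ⟨t, -, htf, hcov⟩ := EMetric.totallyBounded_iff'.1 hS (η / 2 : ℝ≥0)
    (by exact_mod_cast half_pos hη)
  refine ⟨htf.toFinset.image σ, fun f hf => ?_⟩
  obtain ⟨f', hf', hdist⟩ := Set.mem_iUnion₂.1 (hcov hf)
  have hd : ‖f - f'‖ₑ ≤ (η / 2 : ℝ≥0) := by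
    rw [← edist_eq_enorm_sub]
    exact (Metric.mem_eball.1 hdist).le
  have h1 : ∫ v, f' v * σ f' v ∂m = ∫ v, f v * σ f' v ∂m - ∫ v, (f - f' : Lp ℂ 1 m) v * σ f' v ∂m := by
    rw [← integral_sub (integrable_mul_Lp _ _) (integrable_mul_Lp _ _)]
    refine integral_congr_ae ((Lp.coeFn_sub f f').mono fun v hv => ?_)
    beta_reduce
    rw [hv, Pi.sub_apply]
    ring
  have h2 : ‖f'‖ₑ ≤ ‖∫ v, f v * σ f' v ∂m‖ₑ + (η / 2 : ℝ≥0) := by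
    rw [← hσ2 f', h1]
    refine (enorm_sub_le).trans (add_le_add le_rfl ?_)
    refine (enorm_integral_mul_le _ _).trans ?_
    exact (mul_le_of_le_one_left' (hσ1 f')).trans hd
  have h3 : ‖∫ v, f v * σ f' v ∂m‖ₑ ≤ ∑ ψ ∈ htf.toFinset.image σ, ‖∫ v, f v * ψ v ∂m‖ₑ :=
    Finset.single_le_sum (f := fun ψ : Lp ℂ ∞ m => ‖∫ v, f v * ψ v ∂m‖ₑ) (fun _ _ => zero_le)
      (Finset.mem_image_of_mem σ (htf.mem_toFinset.2 hf'))
  calc ‖f‖ₑ = ‖(f - f') + f'‖ₑ := by rw [sub_add_cancel]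
    _ ≤ ‖f - f'‖ₑ + ‖f'‖ₑ := enorm_add_le _ _
    _ ≤ (η / 2 : ℝ≥0) + (‖∫ v, f v * σ f' v ∂m‖ₑ + (η / 2 : ℝ≥0)) := add_le_add hd h2
    _ = η + ‖∫ v, f v * σ f' v ∂m‖ₑ := by
        rw [add_comm (‖∫ v, f v * σ f' v ∂m‖ₑ), ← add_assoc, ← ENNReal.coe_add, add_halves]
    _ ≤ _ := add_le_add le_rfl h3

/-- A collectively compact family with relatively compact dual images is controlled, up to a small
multiple of the norm, by finitely many bounded functionals. -/
theorem exists_finset_enorm_le {α : Type*} {S : Set α} {K : α → Lp ℂ 1 m →L[ℂ] Lp ℂ 1 m}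
    (hK : CollectivelyCompact S K) (hdual : DualImagesRelCompact S K)
    (hadj : ∀ x ∈ S, ∀ ψ : Lp ℂ ∞ m, ∃ g : Lp ℂ ∞ m, IsAdjointImage (K x) ψ g) {η : ℝ≥0}
    (hη : 0 < η) :
    ∃ (G : Finset (Lp ℂ ∞ m)) (N : ℕ), ∀ x ∈ S, ∀ φ : Lp ℂ 1 m,
      ‖K x φ‖ₑ ≤ η * ‖φ‖ₑ + N * ∑ g ∈ G, ‖∫ v, φ v * g v ∂m‖ₑ := by
  classical
  have hKtb : TotallyBounded (⋃ x ∈ S, K x '' Metric.closedBall (0 : Lp ℂ 1 m) 1) :=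
    hK.totallyBounded.subset subset_closure
  obtain ⟨t, ht⟩ := exists_norming_finset hKtb (half_pos hη)
  have hunit : ∀ x ∈ S, ∀ φ : Lp ℂ 1 m,
      ‖K x φ‖ₑ ≤ (η / 2 : ℝ≥0) * ‖φ‖ₑ + ∑ ψ ∈ t, ‖∫ v, K x φ v * ψ v ∂m‖ₑ := by
    intro x hx φ
    rcases eq_or_ne φ 0 with rfl | hφ
    · simp
    have hφ' : ‖φ‖ ≠ 0 := norm_ne_zero_iff.2 hφ
    have hφ'' : ‖(‖φ‖ : ℂ)‖ₑ = ‖φ‖ₑ := by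
      rw [← ofReal_norm, Complex.norm_real, norm_norm, ofReal_norm]
    set φ₁ : Lp ℂ 1 m := ((‖φ‖ : ℂ)⁻¹) • φ with hφ₁
    have hφeq : φ = (‖φ‖ : ℂ) • φ₁ := by
      rw [hφ₁, smul_smul, mul_inv_cancel₀ (by exact_mod_cast hφ'), one_smul]
    have hmem : K x φ₁ ∈ ⋃ x ∈ S, K x '' Metric.closedBall (0 : Lp ℂ 1 m) 1 := by
      refine Set.mem_iUnion₂.2 ⟨x, hx, φ₁, ?_, rfl⟩
      rw [mem_closedBall_zero_iff, hφ₁, norm_smul, norm_inv, Complex.norm_real, norm_norm,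
        inv_mul_cancel₀ hφ']
    have h1 := ht _ hmem
    have h2 : K x φ = (‖φ‖ : ℂ) • K x φ₁ := by rw [← map_smul, ← hφeq]
    have h3 : ∀ ψ : Lp ℂ ∞ m, ‖∫ v, K x φ v * ψ v ∂m‖ₑ = ‖φ‖ₑ * ‖∫ v, K x φ₁ v * ψ v ∂m‖ₑ := by
      intro ψ
      rw [← hφ'', ← enorm_mul, ← integral_const_mul]
      congr 1
      rw [h2]
      refine integral_congr_ae ((Lp.coeFn_smul (‖φ‖ : ℂ) (K x φ₁)).mono fun v hv => ?_)
      beta_reduce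
      rw [hv, Pi.smul_apply, smul_eq_mul, mul_assoc]
    simp_rw [h3]
    rw [← Finset.mul_sum, mul_comm _ ‖φ‖ₑ, ← mul_add, h2, enorm_smul, hφ'']
    exact mul_le_mul' le_rfl h1
  set N := t.card with hN
  set δ : ℝ≥0 := η / (2 * (N + 1)) with hδ
  have hδpos : 0 < δ := by positivity
  have hnet : ∀ ψ : Lp ℂ ∞ m, ∃ G : Finset (Lp ℂ ∞ m), ∀ x ∈ S, ∀ g, IsAdjointImage (K x) ψ g →
      ∃ g' ∈ G, ‖g - g'‖ₑ ≤ δ := by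
    intro ψ
    have htb := (hdual ψ).totallyBounded.subset subset_closure
    obtain ⟨G, -, hGf, hcov⟩ := EMetric.totallyBounded_iff'.1 htb δ (by exact_mod_cast hδpos)
    refine ⟨hGf.toFinset, fun x hx g hg => ?_⟩
    obtain ⟨g', hg', hdist⟩ := Set.mem_iUnion₂.1 (hcov ⟨x, hx, hg⟩)
    refine ⟨g', hGf.mem_toFinset.2 hg', ?_⟩
    rw [← edist_eq_enorm_sub]
    exact (Metric.mem_eball.1 hdist).le
  choose G hG using hnet
  refine ⟨t.biUnion G, N, fun x hx φ => ?_⟩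
  have hterm : ∀ ψ ∈ t, ‖∫ v, K x φ v * ψ v ∂m‖ₑ ≤
      ∑ g ∈ t.biUnion G, ‖∫ v, φ v * g v ∂m‖ₑ + δ * ‖φ‖ₑ := by
    intro ψ hψ
    obtain ⟨g, hg⟩ := hadj x hx ψ
    obtain ⟨g', hg', hgg'⟩ := hG ψ x hx g hg
    have h1 : ∫ v, φ v * g v ∂m = ∫ v, φ v * g' v ∂m + ∫ v, φ v * (g - g' : Lp ℂ ∞ m) v ∂m := by
      rw [← integral_add (integrable_mul_Lp _ _) (integrable_mul_Lp _ _)]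
      refine integral_congr_ae ((Lp.coeFn_sub g g').mono fun v hv => ?_)
      beta_reduce
      rw [hv, Pi.sub_apply]
      ring
    rw [hg φ, h1]
    refine (enorm_add_le _ _).trans (add_le_add ?_ ?_)
    · exact Finset.single_le_sum (f := fun g : Lp ℂ ∞ m => ‖∫ v, φ v * g v ∂m‖ₑ)
        (fun _ _ => zero_le) (Finset.mem_biUnion.2 ⟨ψ, hψ, hg'⟩)
    · exact (enorm_integral_mul_le _ _).trans (mul_le_mul' hgg' le_rfl)
  have hNδ : (N : ℝ≥0) * δ ≤ η / 2 := by
    rw [hδ, ← NNReal.coe_le_coe]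
    push_cast
    rw [mul_div_assoc', div_le_div_iff₀ (by positivity) (by positivity)]
    have hη' : (0 : ℝ) < η := hη
    nlinarith
  calc ‖K x φ‖ₑ ≤ (η / 2 : ℝ≥0) * ‖φ‖ₑ + ∑ ψ ∈ t, ‖∫ v, K x φ v * ψ v ∂m‖ₑ := hunit x hx φ
    _ ≤ (η / 2 : ℝ≥0) * ‖φ‖ₑ +
        N * (∑ g ∈ t.biUnion G, ‖∫ v, φ v * g v ∂m‖ₑ + δ * ‖φ‖ₑ) := by
        refine add_le_add le_rfl ((Finset.sum_le_sum hterm).trans ?_)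
        rw [Finset.sum_const, nsmul_eq_mul]
    _ = ((η / 2 : ℝ≥0) + ((N * δ : ℝ≥0) : ℝ≥0∞)) * ‖φ‖ₑ +
        N * ∑ g ∈ t.biUnion G, ‖∫ v, φ v * g v ∂m‖ₑ := by
        push_cast
        ring
    _ ≤ _ := by
        refine add_le_add (mul_le_mul' ?_ le_rfl) le_rfl
        rw [← ENNReal.coe_add, ENNReal.coe_le_coe]
        calc η / 2 + N * δ ≤ η / 2 + η / 2 := by gcongr
          _ = η := add_halves η

end Adjoint

/-! ### Slices over boundary points -/

section Slices

variable {Ω : Set (E d)} {m : Measure (E d)}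

/-- The function `v ↦ |v · n(x)| ψ(x, v)` on `Γ₊(x)`, extended by `0`. -/
def fluxSlice (Ω : Set (E d)) (ψ : E d × E d → ℂ) (x : E d) : E d → ℂ :=
  (outgoing Ω x).indicator fun v => |⟪v, outwardNormal Ω x⟫| • ψ (x, v)

theorem measurable_fluxSlice (hΩ : IsOpen Ω) (hC : HasC1Boundary Ω) {ψ : E d × E d → ℂ}
    (hψ : Measurable ψ) : Measurable fun p : E d × E d => fluxSlice Ω ψ p.1 p.2 := by
  have hn : Measurable fun p : E d × E d => ⟪p.2, outwardNormal Ω p.1⟫ :=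
    measurable_inner_outwardNormal hΩ hC
  have hs : MeasurableSet {p : E d × E d | 0 < ⟪p.2, outwardNormal Ω p.1⟫} :=
    measurableSet_lt measurable_const hn
  exact ((hn.abs).smul hψ).indicator hs

theorem measurable_fluxSlice_right (hΩ : IsOpen Ω) (hC : HasC1Boundary Ω) {ψ : E d × E d → ℂ}
    (hψ : Measurable ψ) (x : E d) : Measurable (fluxSlice Ω ψ x) :=
  Measurable.comp (g := fun p : E d × E d => fluxSlice Ω ψ p.1 p.2) (f := fun v => (x, v))
    (measurable_fluxSlice hΩ hC hψ) (by fun_prop)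

theorem enorm_abs_inner_smul (x v : E d) (z : ℂ) :
    ‖|⟪v, outwardNormal Ω x⟫| • z‖ₑ = fluxDensity Ω v x * ‖z‖ₑ := by
  rw [enorm_smul, fluxDensity, ← ofReal_norm, Real.norm_eq_abs, abs_abs]

theorem enorm_fluxSlice (ψ : E d × E d → ℂ) (x v : E d) : ‖fluxSlice Ω ψ x v‖ₑ =
    (outgoing Ω x).indicator (fun v => fluxDensity Ω v x * ‖ψ (x, v)‖ₑ) v := by
  by_cases hv : v ∈ outgoing Ω x
  · rw [fluxSlice, Set.indicator_of_mem hv, Set.indicator_of_mem hv, enorm_abs_inner_smul]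
  · rw [fluxSlice, Set.indicator_of_notMem hv, Set.indicator_of_notMem hv, enorm_zero]

theorem lintegral_fluxSlice [SFinite m] (hΩ : IsOpen Ω) (hC : HasC1Boundary Ω)
    {ψ : E d × E d → ℂ} (hψ : Measurable ψ) :
    ∫⁻ x, ∫⁻ v, ‖fluxSlice Ω ψ x v‖ₑ ∂m ∂(surfaceMeasure Ω) = ∫⁻ p, ‖ψ p‖ₑ ∂(fluxPlus Ω m) := by
  rw [lintegral_fluxPlus hΩ hC hψ.enorm]
  refine lintegral_congr fun x => ?_
  rw [← lintegral_indicator (measurableSet_outgoing Ω x)]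
  exact lintegral_congr fun v => enorm_fluxSlice ψ x v

open Classical in
/-- The slice of `ψ` at `x` as an element of `L¹`. -/
def sliceLp (Ω : Set (E d)) (m : Measure (E d)) (ψ : E d × E d → ℂ) (x : E d) : Lp ℂ 1 m :=
  if h : MemLp (fluxSlice Ω ψ x) 1 m then h.toLp else 0

theorem ae_sliceLp_eq [SFinite m] (hΩ : IsOpen Ω) (hC : HasC1Boundary Ω) (ψ : L1Plus Ω m) :
    ∀ᵐ x ∂(surfaceMeasure Ω), sliceLp Ω m ψ x =ᵐ[m] fluxSlice Ω ψ x := by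
  have hψ := (Lp.stronglyMeasurable ψ).measurable
  have h1 : Measurable fun x => ∫⁻ v, ‖fluxSlice Ω ψ x v‖ₑ ∂m :=
    (measurable_fluxSlice hΩ hC hψ).enorm.lintegral_prod_right'
  have h2 : ∫⁻ x, ∫⁻ v, ‖fluxSlice Ω ψ x v‖ₑ ∂m ∂(surfaceMeasure Ω) ≠ ∞ := by
    rw [lintegral_fluxSlice hΩ hC hψ, ← eLpNorm_one_eq_lintegral_enorm]
    exact Lp.eLpNorm_ne_top ψ
  filter_upwards [ae_lt_top h1 h2] with x hx
  have hmem : MemLp (fluxSlice Ω ψ x) 1 m :=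
    ⟨(measurable_fluxSlice_right hΩ hC hψ x).aestronglyMeasurable, by
      rwa [eLpNorm_one_eq_lintegral_enorm]⟩
  rw [sliceLp, dif_pos hmem]
  exact hmem.coeFn_toLp

theorem lintegral_enorm_sliceLp [SFinite m] (hΩ : IsOpen Ω) (hC : HasC1Boundary Ω)
    (ψ : L1Plus Ω m) : ∫⁻ x, ‖sliceLp Ω m ψ x‖ₑ ∂(surfaceMeasure Ω) = ‖ψ‖ₑ := by
  rw [Lp.enorm_def, eLpNorm_one_eq_lintegral_enorm,
    ← lintegral_fluxSlice hΩ hC (Lp.stronglyMeasurable ψ).measurable]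
  refine lintegral_congr_ae ((ae_sliceLp_eq hΩ hC ψ).mono fun x hx => ?_)
  beta_reduce
  rw [Lp_one_enorm_eq_lintegral]
  exact lintegral_congr_ae (hx.mono fun v hv => congrArg enorm hv)

theorem ae_ae_of_ae_boundaryFlux [SFinite m] (hΩ : IsOpen Ω) (hC : HasC1Boundary Ω)
    {P : E d × E d → Prop} (hP : ∀ᵐ p ∂(boundaryFlux Ω m), P p) :
    ∀ᵐ x ∂(surfaceMeasure Ω), ∀ᵐ v ∂m, ⟪v, outwardNormal Ω x⟫ ≠ 0 → P (x, v) := by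
  rw [boundaryFlux_eq, ae_withDensity_iff (measurable_fluxDensity hΩ hC)] at hP
  filter_upwards [Measure.ae_ae_of_ae_prod hP] with x hx
  filter_upwards [hx] with v hv h0
  refine hv ?_
  simpa [fluxDensity] using h0

theorem ae_ae_of_ae_fluxMinus [SFinite m] (hΩ : IsOpen Ω) (hC : HasC1Boundary Ω)
    {P : E d × E d → Prop} (hP : ∀ᵐ p ∂(fluxMinus Ω m), P p) :
    ∀ᵐ x ∂(surfaceMeasure Ω), ∀ᵐ v ∂m, v ∈ incoming Ω x → P (x, v) := by
  rw [fluxMinus, ae_restrict_iff' (measurableSet_gammaMinus hΩ hC)] at hP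
  have hx : ∀ᵐ x ∂(surfaceMeasure Ω), x ∈ frontier Ω :=
    ae_restrict_mem isClosed_frontier.measurableSet
  filter_upwards [ae_ae_of_ae_boundaryFlux hΩ hC hP, hx] with x h1 hx
  filter_upwards [h1] with v hv hin
  exact hv (ne_of_lt hin) ⟨hx, hin⟩

theorem ae_ae_of_ae_fluxPlus [SFinite m] (hΩ : IsOpen Ω) (hC : HasC1Boundary Ω)
    {P : E d × E d → Prop} (hP : ∀ᵐ p ∂(fluxPlus Ω m), P p) :
    ∀ᵐ x ∂(surfaceMeasure Ω), ∀ᵐ v ∂m, v ∈ outgoing Ω x → P (x, v) := by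
  rw [fluxPlus, ae_restrict_iff' (measurableSet_gammaPlus hΩ hC)] at hP
  have hx : ∀ᵐ x ∂(surfaceMeasure Ω), x ∈ frontier Ω :=
    ae_restrict_mem isClosed_frontier.measurableSet
  filter_upwards [ae_ae_of_ae_boundaryFlux hΩ hC hP, hx] with x h1 hx
  filter_upwards [h1] with v hv hin
  exact hv (ne_of_gt hin) ⟨hx, hin⟩

theorem ae_fluxSlice_eq_of_ae_fluxPlus [SFinite m] (hΩ : IsOpen Ω) (hC : HasC1Boundary Ω)
    {ψ φ : E d × E d → ℂ} (h : ψ =ᵐ[fluxPlus Ω m] φ) :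
    ∀ᵐ x ∂(surfaceMeasure Ω), fluxSlice Ω ψ x =ᵐ[m] fluxSlice Ω φ x := by
  filter_upwards [ae_ae_of_ae_fluxPlus hΩ hC h] with x hx
  filter_upwards [hx] with v hv
  by_cases hin : v ∈ outgoing Ω x
  · rw [fluxSlice, fluxSlice, Set.indicator_of_mem hin, Set.indicator_of_mem hin, hv hin]
  · rw [fluxSlice, fluxSlice, Set.indicator_of_notMem hin, Set.indicator_of_notMem hin]

variable {h : E d → E d → E d → ℝ} {H : L1Plus Ω m →L[ℂ] L1Minus Ω m}
  {K : E d → Lp ℂ 1 m →L[ℂ] Lp ℂ 1 m}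

/-- The boundary operator acts on slices through the operators `K x`. -/
theorem IsStochasticDiffuse.ae_smul_apply_eq [SFinite m] (hΩ : IsOpen Ω) (hC : HasC1Boundary Ω)
    (hH : IsStochasticDiffuse Ω m h H)
    (hK : ∀ x ∈ frontier Ω, IsIntegralOperator m (kernelK Ω h x) (K x)) (ψ : L1Plus Ω m) :
    ∀ᵐ x ∂(surfaceMeasure Ω), ∀ᵐ v ∂m, v ∈ incoming Ω x →
      |⟪v, outwardNormal Ω x⟫| • H ψ (x, v) = K x (sliceLp Ω m ψ x) v := by
  have hx : ∀ᵐ x ∂(surfaceMeasure Ω), x ∈ frontier Ω :=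
    ae_restrict_mem isClosed_frontier.measurableSet
  filter_upwards [ae_ae_of_ae_fluxMinus hΩ hC (hH.apply_eq ψ), ae_sliceLp_eq hΩ hC ψ, hx]
    with x h1 h2 hx
  filter_upwards [h1, (hK x hx (sliceLp Ω m ψ x)).2] with v h3 h4 hin
  have hq : Measurable fun v' : E d => fluxDensity Ω v' x :=
    Measurable.comp (g := fun p : E d × E d => fluxDensity Ω p.2 p.1) (f := fun v' => (x, v'))
      (measurable_fluxDensity hΩ hC) (by fun_prop)
  have h5 : fluxMeasure Ω m x = m.withDensity fun v' => fluxDensity Ω v' x := rfl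
  rw [h3 hin, h4, ← integral_smul, h5, setIntegral_withDensity_eq_setIntegral_toReal_smul hq
    (Eventually.of_forall fun _ => ENNReal.ofReal_lt_top) _ (measurableSet_outgoing Ω x),
    ← integral_indicator (measurableSet_outgoing Ω x)]
  refine integral_congr_ae (h2.mono fun v' hv' => ?_)
  beta_reduce
  rw [hv', fluxSlice]
  by_cases hout : v' ∈ outgoing Ω x
  · rw [Set.indicator_of_mem hout, Set.indicator_of_mem hout, fluxDensity,
      ENNReal.toReal_ofReal (abs_nonneg _), kernelK, mul_smul, smul_comm (h x v v'),
      smul_comm |⟪v, outwardNormal Ω x⟫| |⟪v', outwardNormal Ω x⟫|]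
  · rw [Set.indicator_of_notMem hout, Set.indicator_of_notMem hout, smul_zero]

/-- A fiberwise bound for the boundary operator. -/
theorem IsStochasticDiffuse.enorm_apply_le [SFinite m] (hΩ : IsOpen Ω) (hC : HasC1Boundary Ω)
    (hH : IsStochasticDiffuse Ω m h H)
    (hK : ∀ x ∈ frontier Ω, IsIntegralOperator m (kernelK Ω h x) (K x)) (ψ : L1Plus Ω m) :
    ‖H ψ‖ₑ ≤ ∫⁻ x, ‖K x (sliceLp Ω m ψ x)‖ₑ ∂(surfaceMeasure Ω) := by
  rw [Lp.enorm_def, eLpNorm_one_eq_lintegral_enorm,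
    lintegral_fluxMinus hΩ hC (Lp.stronglyMeasurable (H ψ)).measurable.enorm]
  refine lintegral_mono_ae ((hH.ae_smul_apply_eq hΩ hC hK ψ).mono fun x hx => ?_)
  beta_reduce
  rw [Lp_one_enorm_eq_lintegral]
  refine le_trans ?_ (setLIntegral_le_lintegral (incoming Ω x) _)
  refine lintegral_mono_ae ((ae_restrict_iff' (measurableSet_incoming Ω x)).2
    (hx.mono fun v hv hin => ?_))
  rw [← enorm_abs_inner_smul, hv hin]

end Slices

/-! ### Averaging the composition of boundary and transfer operators -/

section Averaging

variable {Ω : Set (E d)} {ϖ : ℝ → ℝ≥0}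

instance : SigmaFinite (velocityMeasure d ϖ) := by
  unfold velocityMeasure; infer_instance

theorem enorm_integral_velocityMeasure_le (hd : 1 ≤ d) (hϖ : Measurable ϖ) {F : E d → ℂ}
    (hF : Measurable F) :
    ‖∫ v, F v ∂(velocityMeasure d ϖ)‖ₑ ≤
      ∫⁻ w, ‖∫ ρ, F (ρ • w) ∂(radialMeasure d ϖ)‖ₑ ∂(sphereMeasure d) := by
  by_cases hi : Integrable F (velocityMeasure d ϖ)
  · have hm : Measurable fun p : E d × ℝ => p.2 • p.1 := by fun_prop
    rw [velocityMeasure_eq_map hd hϖ] at hi ⊢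
    have hi' := (integrable_map_measure hF.aestronglyMeasurable hm.aemeasurable).1 hi
    rw [integral_map hm.aemeasurable hF.aestronglyMeasurable]
    have h1 : ∫ p : E d × ℝ, F (p.2 • p.1) ∂((sphereMeasure d).prod (radialMeasure d ϖ)) =
        ∫ w, ∫ ρ, F (ρ • w) ∂(radialMeasure d ϖ) ∂(sphereMeasure d) := integral_prod _ hi'
    rw [h1]
    exact enorm_integral_le_lintegral_enorm _
  · rw [integral_undef hi, enorm_zero]
    exact zero_le

/-- The radial integrals of a transported slice. -/
theorem enorm_radial_integral_fluxSlice (hΩ : IsOpen Ω) (hb : Bornology.IsBounded Ω)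
    (hC : HasC1Boundary Ω) (l : ℂ) (u : E d × E d → ℂ) (g : E d → ℂ) {x : E d}
    (hx : x ∈ frontier Ω) {w : E d} (hw : ‖w‖ = 1) :
    ‖∫ ρ, fluxSlice Ω (fun p => u (footMap Ω p) * phase Ω l p) x (ρ • w) * g (ρ • w)
      ∂(radialMeasure d ϖ)‖ₑ = (outgoing Ω x).indicator (fun w => fluxDensity Ω w x *
        ‖∫ ρ, g (ρ • (footMap Ω (x, w)).2) *
          (‖ρ • (footMap Ω (x, w)).2‖ • u ((footMap Ω (x, w)).1, ρ • (footMap Ω (x, w)).2)) *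
            Complex.exp (-l * ((travelTime Ω (footMap Ω (x, w)).1 (-(footMap Ω (x, w)).2) / ρ : ℝ) : ℂ))
              ∂(radialMeasure d ϖ)‖ₑ) w := by
  by_cases hout : w ∈ outgoing Ω x
  · rw [Set.indicator_of_mem hout, ← enorm_abs_inner_smul, ← integral_smul]
    congr 1
    refine integral_congr_ae (ae_pos_radialMeasure.mono fun ρ hρ => ?_)
    have hρout : ρ • w ∈ outgoing Ω x := by
      change 0 < ⟪ρ • w, outwardNormal Ω x⟫
      rw [real_inner_smul_left]
      exact mul_pos hρ hout
    have h1 : footMap Ω (x, ρ • w) = (backFoot Ω x w, ρ • w) := by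
      rw [footMap]
      exact Prod.ext (sub_travelTime_smul x w hρ) rfl
    have h2 : phase Ω l (x, ρ • w) = Complex.exp (-l * ((travelTime Ω x w / ρ : ℝ) : ℂ)) := by
      rw [phase, travelTime_smul x w hρ]
    beta_reduce
    rw [fluxSlice, Set.indicator_of_mem hρout]
    beta_reduce
    rw [h1, h2, footMap]
    dsimp only
    rw [travelTime_backFoot_neg hΩ hb hC hx hout, real_inner_smul_left, abs_mul, norm_smul, hw,
      mul_one, Real.norm_eq_abs]
    simp only [Complex.real_smul, Complex.ofReal_mul]
    ring
  · rw [Set.indicator_of_notMem hout, integral_congr_ae (g := fun _ => 0), integral_zero,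
      enorm_zero]
    refine ae_pos_radialMeasure.mono fun ρ hρ => ?_
    have hρout : ρ • w ∉ outgoing Ω x := fun h => hout <| by
      change 0 < ⟪ρ • w, outwardNormal Ω x⟫ at h
      rw [real_inner_smul_left] at h
      exact (mul_pos_iff_of_pos_left hρ).1 h
    beta_reduce
    rw [fluxSlice, Set.indicator_of_notMem hρout, zero_mul]

/-- Pairings of transported slices with a bounded function are controlled by phase averages. -/
theorem lintegral_enorm_integral_fluxSlice_le (hd : 1 ≤ d) (hΩ : IsOpen Ω)
    (hb : Bornology.IsBounded Ω) (hC : HasC1Boundary Ω) (hϖ : Measurable ϖ) {k : ℝ≥0}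
    (hk : (fluxPlus Ω (sphereMeasure d)).map (footMap Ω) ≤ k • fluxMinus Ω (sphereMeasure d))
    (l : ℂ) {u : E d × E d → ℂ} (hu : Measurable u) {g : E d → ℂ} (hg : Measurable g) :
    ∫⁻ x, ‖∫ v, fluxSlice Ω (fun p => u (footMap Ω p) * phase Ω l p) x v * g v
      ∂(velocityMeasure d ϖ)‖ₑ ∂(surfaceMeasure Ω) ≤
      k * ∫⁻ y, phaseAverage Ω ϖ l y (fun v => g v * (|⟪v, outwardNormal Ω y⟫| • u (y, v)))
        ∂(surfaceMeasure Ω) := by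
  set ξ : E d × E d → ℂ := fun p => u (footMap Ω p) * phase Ω l p with hξ
  have hξm : Measurable ξ :=
    (hu.comp (measurable_footMap hΩ hb)).mul (measurable_phase hΩ hb l)
  set G : E d × E d → ℝ≥0∞ := fun p => ‖∫ ρ, g (ρ • p.2) * (‖ρ • p.2‖ • u (p.1, ρ • p.2)) *
    Complex.exp (-l * ((travelTime Ω p.1 (-p.2) / ρ : ℝ) : ℂ)) ∂(radialMeasure d ϖ)‖ₑ with hG
  have hu1 : Measurable fun p : E d × E d => g p.2 * (‖p.2‖ • u p) :=
    (hg.comp measurable_snd).mul (measurable_snd.norm.smul hu)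
  have hGm : Measurable G := measurable_radial_integral (ϖ := ϖ)
    (u := fun p : E d × E d => g p.2 * (‖p.2‖ • u p)) hΩ hb l hu1
  have hx : ∀ᵐ x ∂(surfaceMeasure Ω), x ∈ frontier Ω :=
    ae_restrict_mem isClosed_frontier.measurableSet
  calc ∫⁻ x, ‖∫ v, fluxSlice Ω ξ x v * g v ∂(velocityMeasure d ϖ)‖ₑ ∂(surfaceMeasure Ω)
    _ ≤ ∫⁻ x, ∫⁻ w in outgoing Ω x, fluxDensity Ω w x * G (footMap Ω (x, w))
        ∂(sphereMeasure d) ∂(surfaceMeasure Ω) := by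
        refine lintegral_mono_ae ?_
        filter_upwards [hx] with x hx
        have hF : Measurable fun v => fluxSlice Ω ξ x v * g v :=
          (measurable_fluxSlice_right hΩ hC hξm x).mul hg
        refine (enorm_integral_velocityMeasure_le hd hϖ hF).trans (le_of_eq ?_)
        rw [← lintegral_indicator (measurableSet_outgoing Ω x)]
        exact lintegral_congr_ae (ae_norm_eq_one_sphereMeasure.mono fun w hw =>
          enorm_radial_integral_fluxSlice hΩ hb hC l u g hx hw)
    _ = ∫⁻ p, G (footMap Ω p) ∂(fluxPlus Ω (sphereMeasure d)) :=
        (lintegral_fluxPlus hΩ hC (hGm.comp (measurable_footMap hΩ hb))).symm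
    _ = ∫⁻ p, G p ∂((fluxPlus Ω (sphereMeasure d)).map (footMap Ω)) :=
        (lintegral_map hGm (measurable_footMap hΩ hb)).symm
    _ ≤ ∫⁻ p, G p ∂(k • fluxMinus Ω (sphereMeasure d)) := lintegral_mono' hk le_rfl
    _ = k * ∫⁻ y, ∫⁻ w in incoming Ω y, fluxDensity Ω w y * G (y, w) ∂(sphereMeasure d)
          ∂(surfaceMeasure Ω) := by
        rw [lintegral_smul_measure, lintegral_fluxMinus hΩ hC hGm]
        rfl
    _ = k * ∫⁻ y, phaseAverage Ω ϖ l y (fun v => g v * (|⟪v, outwardNormal Ω y⟫| • u (y, v)))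
          ∂(surfaceMeasure Ω) := by
        congr 1
        refine lintegral_congr fun y => ?_
        rw [phaseAverage]
        refine lintegral_congr_ae (ae_restrict_of_ae
          (ae_norm_eq_one_sphereMeasure.mono fun w hw => ?_))
        beta_reduce
        rw [← enorm_abs_inner_smul, ← integral_smul]
        congr 1
        refine integral_congr_ae (ae_pos_radialMeasure.mono fun ρ hρ => ?_)
        beta_reduce
        rw [real_inner_smul_left, abs_mul, norm_smul, hw, mul_one, Real.norm_eq_abs]
        simp only [Complex.real_smul, Complex.ofReal_mul]
        ring

variable {h : E d → E d → E d → ℝ}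
  {H : L1Plus Ω (velocityMeasure d ϖ) →L[ℂ] L1Minus Ω (velocityMeasure d ϖ)}
  {K : E d → Lp ℂ 1 (velocityMeasure d ϖ) →L[ℂ] Lp ℂ 1 (velocityMeasure d ϖ)}

/-- Phase averages of the bounded multiples of `|v · n(y)| u(y, v)`, where `u` is a boundary value
`H ψ`, from those over the image of the unit ball. -/
theorem ae_phaseAverage_le (hd : 1 ≤ d) (hΩ : IsOpen Ω) (hb : Bornology.IsBounded Ω)
    (hC : HasC1Boundary Ω) (hϖ : Measurable ϖ) (hH : IsStochasticDiffuse Ω (velocityMeasure d ϖ) h H)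
    (hK : ∀ x ∈ frontier Ω, IsIntegralOperator (velocityMeasure d ϖ) (kernelK Ω h x) (K x))
    {g : E d → ℂ} (hg : Measurable g) {c : ℝ≥0} (hgc : ∀ v, ‖g v‖ₑ ≤ c) {l : ℂ} (hl : 0 ≤ l.re)
    {η : ℝ≥0} (hη : ∀ y ∈ frontier Ω, ∀ F ∈ ⋃ x ∈ frontier Ω, K x '' Metric.closedBall 0 1,
      phaseAverage Ω ϖ l y (fun v => g v * F v) ≤ η) (ψ : L1Plus Ω (velocityMeasure d ϖ)) :
    ∀ᵐ y ∂(surfaceMeasure Ω),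
      phaseAverage Ω ϖ l y (fun v => g v * (|⟪v, outwardNormal Ω y⟫| • H ψ (y, v))) ≤
        η * ‖sliceLp Ω (velocityMeasure d ϖ) ψ y‖ₑ := by
  have hx : ∀ᵐ x ∂(surfaceMeasure Ω), x ∈ frontier Ω :=
    ae_restrict_mem isClosed_frontier.measurableSet
  filter_upwards [hH.ae_smul_apply_eq hΩ hC hK ψ, hx] with y h1 hy
  generalize sliceLp Ω (velocityMeasure d ϖ) ψ y = φ at h1 ⊢
  have hf : Measurable fun v => g v * (|⟪v, outwardNormal Ω y⟫| • H ψ (y, v)) := by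
    have hu : Measurable fun v => H ψ (y, v) :=
      Measurable.comp (g := H ψ) (f := fun v => (y, v))
        (Lp.stronglyMeasurable (H ψ)).measurable (by fun_prop)
    have hq : Measurable fun v : E d => |⟪v, outwardNormal Ω y⟫| :=
      (measurable_id.inner measurable_const).abs
    exact hg.mul (hq.smul hu)
  obtain ⟨a, φ₁, hφ₁, hφ, ha⟩ : ∃ (a : ℂ) (φ₁ : Lp ℂ 1 (velocityMeasure d ϖ)),
      φ₁ ∈ Metric.closedBall 0 1 ∧ φ = a • φ₁ ∧ ‖a‖ₑ = ‖φ‖ₑ := by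
    rcases eq_or_ne φ 0 with rfl | h0
    · exact ⟨0, 0, by simp, by simp, by simp⟩
    have h0' : ‖φ‖ ≠ 0 := norm_ne_zero_iff.2 h0
    refine ⟨(‖φ‖ : ℂ), (‖φ‖ : ℂ)⁻¹ • φ, ?_, ?_, ?_⟩
    · rw [mem_closedBall_zero_iff, norm_smul, norm_inv, Complex.norm_real, norm_norm,
        inv_mul_cancel₀ h0']
    · rw [smul_smul, mul_inv_cancel₀ (by exact_mod_cast h0'), one_smul]
    · rw [← ofReal_norm, Complex.norm_real, norm_norm, ofReal_norm]
  have hFm : Measurable (K y φ₁) := (Lp.stronglyMeasurable (K y φ₁)).measurable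
  have hagm : Measurable fun v => a * (g v * K y φ₁ v) := (hg.mul hFm).const_mul a
  have hgi : ∫⁻ v, ‖a * (g v * K y φ₁ v)‖ₑ ∂(velocityMeasure d ϖ) ≠ ∞ := by
    have h2 : ∫⁻ v, ‖a * (g v * K y φ₁ v)‖ₑ ∂(velocityMeasure d ϖ) ≤
        ‖a‖ₑ * c * ‖K y φ₁‖ₑ := by
      rw [Lp_one_enorm_eq_lintegral,
        ← lintegral_const_mul' _ _ (ENNReal.mul_ne_top enorm_ne_top ENNReal.coe_ne_top)]
      refine lintegral_mono fun v => ?_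
      rw [enorm_mul, enorm_mul, ← mul_assoc]
      exact mul_le_mul' (mul_le_mul' le_rfl (hgc v)) le_rfl
    exact ne_top_of_le_ne_top (ENNReal.mul_ne_top
      (ENNReal.mul_ne_top enorm_ne_top ENNReal.coe_ne_top) enorm_ne_top) h2
  have hzero : ∫⁻ v in incoming Ω y, ‖g v * (|⟪v, outwardNormal Ω y⟫| • H ψ (y, v)) -
      a * (g v * K y φ₁ v)‖ₑ ∂(velocityMeasure d ϖ) = 0 := by
    have hKa : K y φ =ᵐ[velocityMeasure d ϖ] fun v => a * K y φ₁ v := by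
      rw [hφ, map_smul]
      exact Lp.coeFn_smul a (K y φ₁)
    rw [← lintegral_zero]
    refine lintegral_congr_ae ((ae_restrict_iff' (measurableSet_incoming Ω y)).2 ?_)
    filter_upwards [h1, hKa] with v h3 h4 hin
    rw [h3 hin, h4, mul_left_comm, sub_self, enorm_zero]
  refine (phaseAverage_le_add hd hΩ hb hϖ hl y hf hagm hgi).trans ?_
  have hscale : phaseAverage Ω ϖ l y (fun v => a * (g v * K y φ₁ v)) =
      ‖a‖ₑ * phaseAverage Ω ϖ l y (fun v => g v * K y φ₁ v) := by
    rw [phaseAverage, phaseAverage, ← lintegral_const_mul' _ _ enorm_ne_top]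
    refine lintegral_congr fun w => ?_
    rw [← enorm_mul, ← integral_const_mul]
    simp_rw [mul_assoc]
  rw [hzero, add_zero, hscale, ha, mul_comm]
  exact mul_le_mul' (hη y hy _ (Set.mem_iUnion₂.2 ⟨y, hy, φ₁, hφ₁, rfl⟩)) le_rfl

/-- Pairings of the slices of `M_l H ψ` with a bounded function tend to `0` as the imaginary part
of `l` tends to infinity. -/
theorem exists_lintegral_enorm_integral_sliceLp_le (hd : 1 ≤ d) (hΩ : IsOpen Ω)
    (hb : Bornology.IsBounded Ω) (hC : HasC1Boundary Ω) (hϖ : Measurable ϖ) {k : ℝ≥0}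
    (hk : (fluxPlus Ω (sphereMeasure d)).map (footMap Ω) ≤ k • fluxMinus Ω (sphereMeasure d))
    (hH : IsStochasticDiffuse Ω (velocityMeasure d ϖ) h H)
    (hK : ∀ x ∈ frontier Ω, IsIntegralOperator (velocityMeasure d ϖ) (kernelK Ω h x) (K x))
    (hKc : CollectivelyCompact (frontier Ω) K) (g : Lp ℂ ∞ (velocityMeasure d ϖ))
    {ε : ℝ} (hε : 0 ≤ ε) {η : ℝ≥0} (hη : 0 < η) :
    ∃ R : ℝ, ∀ s : ℝ, R ≤ |s| →
      ∀ M : L1Minus Ω (velocityMeasure d ϖ) →L[ℂ] L1Plus Ω (velocityMeasure d ϖ),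
      IsTransferOperator Ω (velocityMeasure d ϖ) (ε + s * Complex.I) M →
      ∀ ψ : L1Plus Ω (velocityMeasure d ϖ),
        ∫⁻ x, ‖∫ v, sliceLp Ω (velocityMeasure d ϖ) (M (H ψ)) x v * g v ∂(velocityMeasure d ϖ)‖ₑ
          ∂(surfaceMeasure Ω) ≤ k * (η * ‖ψ‖ₑ) := by
  obtain ⟨g', c, hg'm, hg'c, hgg'⟩ := exists_bounded_representative g
  obtain ⟨R, hR⟩ := exists_phaseAverage_le_of_totallyBounded hd hΩ hb hC hϖ
    (hKc.totallyBounded.subset subset_closure) hg'm hg'c hε hη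
  refine ⟨R, fun s hs M hM ψ => ?_⟩
  have hl : 0 ≤ (ε + s * Complex.I : ℂ).re := by simpa using hε
  have hae := ae_phaseAverage_le hd hΩ hb hC hϖ hH hK hg'm hg'c hl (hR s hs) ψ
  have hMu := hM (H ψ) _ (ae_eq_refl _)
  have hum := (Lp.stronglyMeasurable (H ψ)).measurable
  have h1 : ∫⁻ x, ‖∫ v, sliceLp Ω (velocityMeasure d ϖ) (M (H ψ)) x v * g v
      ∂(velocityMeasure d ϖ)‖ₑ ∂(surfaceMeasure Ω) =
      ∫⁻ x, ‖∫ v, fluxSlice Ω (fun p => H ψ (footMap Ω p) * phase Ω (ε + s * Complex.I) p) x v *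
        g' v ∂(velocityMeasure d ϖ)‖ₑ ∂(surfaceMeasure Ω) := by
    refine lintegral_congr_ae ?_
    filter_upwards [ae_sliceLp_eq hΩ hC (M (H ψ)), ae_fluxSlice_eq_of_ae_fluxPlus hΩ hC hMu]
      with x h1 h2
    congr 1
    refine integral_congr_ae ?_
    filter_upwards [h1, h2, hgg'] with v h3 h4 h5
    rw [h3, h4, h5]
    rfl
  rw [h1]
  refine (lintegral_enorm_integral_fluxSlice_le hd hΩ hb hC hϖ hk _ hum hg'm).trans
    (mul_le_mul' le_rfl ((lintegral_mono_ae hae).trans (le_of_eq ?_)))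
  rw [lintegral_const_mul' (η : ℝ≥0∞) (fun y => ‖sliceLp Ω (velocityMeasure d ϖ) ψ y‖ₑ)
    ENNReal.coe_ne_top, lintegral_enorm_sliceLp hΩ hC ψ]

end Averaging

/-! ### The composition `H M_l H` for large imaginary part -/

section Composition

variable {Ω : Set (E d)} {ϖ : ℝ → ℝ≥0}

theorem aemeasurable_enorm_sliceLp {m : Measure (E d)} [SFinite m] (hΩ : IsOpen Ω)
    (hC : HasC1Boundary Ω) (ψ : L1Plus Ω m) :
    AEMeasurable (fun x => ‖sliceLp Ω m ψ x‖ₑ) (surfaceMeasure Ω) := by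
  refine ⟨fun x => ∫⁻ v, ‖fluxSlice Ω ψ x v‖ₑ ∂m,
    (measurable_fluxSlice hΩ hC (Lp.stronglyMeasurable ψ).measurable).enorm.lintegral_prod_right',
    (ae_sliceLp_eq hΩ hC ψ).mono fun x hx => ?_⟩
  beta_reduce
  rw [Lp_one_enorm_eq_lintegral]
  exact lintegral_congr_ae (hx.mono fun v hv => congrArg enorm hv)

theorem aemeasurable_enorm_integral_sliceLp {m : Measure (E d)} [SFinite m] (hΩ : IsOpen Ω)
    (hC : HasC1Boundary Ω) (ψ : L1Plus Ω m) (g : Lp ℂ ∞ m) :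
    AEMeasurable (fun x => ‖∫ v, sliceLp Ω m ψ x v * g v ∂m‖ₑ) (surfaceMeasure Ω) := by
  have h1 : Measurable fun p : E d × E d => fluxSlice Ω ψ p.1 p.2 * g p.2 :=
    (measurable_fluxSlice hΩ hC (Lp.stronglyMeasurable ψ).measurable).mul
      ((Lp.stronglyMeasurable g).measurable.comp measurable_snd)
  refine ⟨fun x => ‖∫ v, fluxSlice Ω ψ x v * g v ∂m‖ₑ,
    h1.stronglyMeasurable.integral_prod_right'.enorm,
    (ae_sliceLp_eq hΩ hC ψ).mono fun x hx => ?_⟩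
  beta_reduce
  congr 1
  refine integral_congr_ae (hx.mono fun v hv => ?_)
  beta_reduce
  rw [hv]

variable {h : E d → E d → E d → ℝ}
  {H : L1Plus Ω (velocityMeasure d ϖ) →L[ℂ] L1Minus Ω (velocityMeasure d ϖ)}
  {K : E d → Lp ℂ 1 (velocityMeasure d ϖ) →L[ℂ] Lp ℂ 1 (velocityMeasure d ϖ)}

/-- Up to a small multiple of the norm, `H` is controlled by the pairings of slices with finitely
many bounded functions. -/
theorem exists_finset_enorm_apply_le (hΩ : IsOpen Ω) (hC : HasC1Boundary Ω)
    (hH : IsStochasticDiffuse Ω (velocityMeasure d ϖ) h H)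
    (hK : ∀ x ∈ frontier Ω, IsIntegralOperator (velocityMeasure d ϖ) (kernelK Ω h x) (K x))
    (hKc : CollectivelyCompact (frontier Ω) K) (hKd : DualImagesRelCompact (frontier Ω) K)
    {η : ℝ≥0} (hη : 0 < η) :
    ∃ (G : Finset (Lp ℂ ∞ (velocityMeasure d ϖ))) (N : ℕ),
      ∀ ξ : L1Plus Ω (velocityMeasure d ϖ), ‖H ξ‖ₑ ≤ η * ‖ξ‖ₑ + N * ∑ g ∈ G,
        ∫⁻ x, ‖∫ v, sliceLp Ω (velocityMeasure d ϖ) ξ x v * g v ∂(velocityMeasure d ϖ)‖ₑ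
          ∂(surfaceMeasure Ω) := by
  have hadj : ∀ x ∈ frontier Ω, ∀ ψ : Lp ℂ ∞ (velocityMeasure d ϖ),
      ∃ g : Lp ℂ ∞ (velocityMeasure d ϖ), IsAdjointImage (K x) ψ g := by
    intro x hx ψ
    have hh : Measurable fun p : E d × E d => h x p.1 p.2 :=
      Measurable.comp (g := fun p : E d × E d × E d => h p.1 p.2.1 p.2.2)
        (f := fun p : E d × E d => (x, p.1, p.2)) hH.measurable (by fun_prop)
    have hq : Measurable fun p : E d × E d => |⟪p.1, outwardNormal Ω x⟫| :=
      (measurable_fst.inner measurable_const).abs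
    exact (hK x hx).exists_isAdjointImage (hq.mul hh)
      (fun v v' => mul_nonneg (abs_nonneg _) (hH.nonneg x v v')) ψ
  obtain ⟨G, N, hGN⟩ := exists_finset_enorm_le hKc hKd hadj hη
  refine ⟨G, N, fun ξ => (hH.enorm_apply_le hΩ hC hK ξ).trans ?_⟩
  have hx : ∀ᵐ x ∂(surfaceMeasure Ω), x ∈ frontier Ω :=
    ae_restrict_mem isClosed_frontier.measurableSet
  refine (lintegral_mono_ae (hx.mono fun x hx =>
    hGN x hx (sliceLp Ω (velocityMeasure d ϖ) ξ x))).trans (le_of_eq ?_)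
  have hm := aemeasurable_enorm_sliceLp hΩ hC ξ
  rw [lintegral_add_left' (hm.const_mul _), lintegral_const_mul' _ _ ENNReal.coe_ne_top,
    lintegral_enorm_sliceLp hΩ hC, lintegral_const_mul' _ _ (ENNReal.natCast_ne_top N),
    lintegral_finsetSum' _ fun g _ => aemeasurable_enorm_integral_sliceLp hΩ hC ξ g]

/-- `H M_l H` tends to `0` in norm as the imaginary part of `l` tends to infinity. -/
theorem exists_enorm_apply_transfer_apply_le (hd : 1 ≤ d) (hΩ : IsOpen Ω)
    (hb : Bornology.IsBounded Ω) (hC : HasC1Boundary Ω) (hϖ : Measurable ϖ) (k : ℝ≥0)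
    (hH : IsStochasticDiffuse Ω (velocityMeasure d ϖ) h H)
    (hK : ∀ x ∈ frontier Ω, IsIntegralOperator (velocityMeasure d ϖ) (kernelK Ω h x) (K x))
    (hKc : CollectivelyCompact (frontier Ω) K) (hKd : DualImagesRelCompact (frontier Ω) K)
    {ε : ℝ} (hε : 0 ≤ ε) {δ : ℝ≥0} (hδ : 0 < δ) :
    ∃ R : ℝ, ∀ s : ℝ, R ≤ |s| →
      ∀ M : L1Minus Ω (velocityMeasure d ϖ) →L[ℂ] L1Plus Ω (velocityMeasure d ϖ),
      IsTransferOperator Ω (velocityMeasure d ϖ) (ε + s * Complex.I) M → ‖M‖₊ ≤ k →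
      ∀ ψ : L1Plus Ω (velocityMeasure d ϖ), ‖H (M (H ψ))‖ₑ ≤ δ * ‖ψ‖ₑ := by
  obtain ⟨k', hk'⟩ := exists_map_footMap_le hd hΩ hb hC
  set η : ℝ≥0 := δ / 2 / (k * ‖H‖₊ + 1) with hη
  obtain ⟨G, N, hGN⟩ := exists_finset_enorm_apply_le hΩ hC hH hK hKc hKd
    (show 0 < η by positivity)
  set η' : ℝ≥0 := δ / 2 / (N * G.card * k' + 1) with hη'
  have hR := fun g => exists_lintegral_enorm_integral_sliceLp_le hd hΩ hb hC hϖ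
    (hk' (sphereMeasure d)) hH hK hKc g hε (show 0 < η' by positivity)
  choose R hR using hR
  obtain ⟨R₀, hR₀⟩ := (G.image R).exists_le
  refine ⟨R₀, fun s hs M hM hMk ψ => (hGN (M (H ψ))).trans ?_⟩
  have h1 : ‖M (H ψ)‖ₑ ≤ k * (‖H‖₊ * ‖ψ‖ₑ) :=
    (M.le_opENorm _).trans (mul_le_mul' (ENNReal.coe_le_coe.2 hMk) (H.le_opENorm ψ))
  have h2 := Finset.sum_le_card_nsmul G _ _ fun g hg =>
    hR g s ((hR₀ _ (Finset.mem_image_of_mem R hg)).trans hs) M hM ψ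
  have h3 : η * (k * ‖H‖₊) ≤ δ / 2 := by
    rw [hη, div_mul_eq_mul_div, div_le_iff₀ (by positivity)]
    exact mul_le_mul' le_rfl (le_add_of_nonneg_right zero_le_one)
  have h4 : (N * G.card * k') * η' ≤ δ / 2 := by
    rw [hη', mul_div_assoc', div_le_iff₀ (by positivity), mul_comm]
    exact mul_le_mul' le_rfl (le_add_of_nonneg_right zero_le_one)
  calc _ ≤ η * (k * (‖H‖₊ * ‖ψ‖ₑ)) + N * (G.card • (k' * (η' * ‖ψ‖ₑ))) :=
        add_le_add (mul_le_mul' le_rfl h1) (mul_le_mul' le_rfl h2)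
    _ = ((η * (k * ‖H‖₊) + (N * G.card * k') * η' : ℝ≥0) : ℝ≥0∞) * ‖ψ‖ₑ := by
        rw [nsmul_eq_mul]
        push_cast
        ring
    _ ≤ δ * ‖ψ‖ₑ := by
        refine mul_le_mul' (ENNReal.coe_le_coe.2 ?_) le_rfl
        calc _ ≤ δ / 2 + δ / 2 := add_le_add h3 h4
          _ = δ := add_halves δ

/-- `(M_l H)²` tends to `0` in norm as the imaginary part of `l` tends to infinity. -/
theorem tendsto_norm_transfer_comp_sq (hd : 1 ≤ d) (hΩ : IsOpen Ω)
    (hb : Bornology.IsBounded Ω) (hC : HasC1Boundary Ω) (hϖ : Measurable ϖ) {k : ℝ≥0}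
    (hH : IsStochasticDiffuse Ω (velocityMeasure d ϖ) h H)
    (hK : ∀ x ∈ frontier Ω, IsIntegralOperator (velocityMeasure d ϖ) (kernelK Ω h x) (K x))
    (hKc : CollectivelyCompact (frontier Ω) K) (hKd : DualImagesRelCompact (frontier Ω) K)
    {M : ℂ → L1Minus Ω (velocityMeasure d ϖ) →L[ℂ] L1Plus Ω (velocityMeasure d ϖ)}
    (hM : ∀ l : ℂ, 0 ≤ l.re → IsTransferOperator Ω (velocityMeasure d ϖ) l (M l))
    (hMk : ∀ l : ℂ, 0 ≤ l.re → ‖M l‖ ≤ k) {ε : ℝ} (hε : 0 ≤ ε) :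
    Tendsto (fun s : ℝ => ‖((M (ε + s * Complex.I)).comp H) ^ 2‖)
      (comap (fun s : ℝ => |s|) atTop) (𝓝 0) := by
  rw [Metric.tendsto_nhds]
  intro r hr
  obtain ⟨δ, hδ, hδr⟩ : ∃ δ : ℝ≥0, 0 < δ ∧ k * (δ : ℝ) < r := by
    refine ⟨Real.toNNReal (r / (k + 1)), Real.toNNReal_pos.2 (by positivity), ?_⟩
    rw [Real.coe_toNNReal _ (by positivity), mul_div_assoc', div_lt_iff₀ (by positivity)]
    nlinarith
  obtain ⟨R, hR⟩ := exists_enorm_apply_transfer_apply_le hd hΩ hb hC hϖ k hH hK hKc hKd hε hδ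
  filter_upwards [preimage_mem_comap (Ici_mem_atTop R)] with s hs
  have hl : 0 ≤ (ε + s * Complex.I : ℂ).re := by simpa using hε
  have h1 := hMk _ hl
  have h2 := hR s hs (M _) (hM _ hl) h1
  rw [dist_zero_right, norm_norm]
  refine lt_of_le_of_lt (ContinuousLinearMap.opNorm_le_bound _ (by positivity) fun ψ => ?_) hδr
  have h3 : ‖H (M (ε + s * Complex.I) (H ψ))‖ ≤ δ * ‖ψ‖ := by
    have h5 : ((‖H (M (ε + s * Complex.I) (H ψ))‖₊ : ℝ≥0) : ℝ≥0∞) ≤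
        (δ : ℝ≥0∞) * (‖ψ‖₊ : ℝ≥0) := h2 ψ
    exact_mod_cast h5
  have h4 : (((M (ε + s * Complex.I)).comp H) ^ 2) ψ =
      M (ε + s * Complex.I) (H (M (ε + s * Complex.I) (H ψ))) := by
    rw [pow_two]
    rfl
  rw [h4, mul_assoc]
  exact (ContinuousLinearMap.le_opNorm _ _).trans (mul_le_mul h1 h3 (norm_nonneg _) k.2)

end Composition

end Kinetic

end

theorem theoremA6 {d : ℕ} (hd : 2 ≤ d)
    (Ω : Set (Kinetic.E d)) (hΩ_open : IsOpen Ω) (hΩ_bdd : Bornology.IsBounded Ω)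
    (hΩ_C1 : Kinetic.HasC1Boundary Ω)
    (ϖ : ℝ → ℝ≥0) (hϖ : Measurable ϖ)
    (m : Measure (Kinetic.E d)) (hm : m = Kinetic.velocityMeasure d ϖ)
    (h : Kinetic.E d → Kinetic.E d → Kinetic.E d → ℝ)
    (H : Kinetic.L1Plus Ω m →L[ℂ] Kinetic.L1Minus Ω m)
    (hH : Kinetic.IsStochasticDiffuse Ω m h H)
    (K : Kinetic.E d → Lp ℂ 1 m →L[ℂ] Lp ℂ 1 m)
    (hK : ∀ x ∈ frontier Ω, Kinetic.IsIntegralOperator m (Kinetic.kernelK Ω h x) (K x))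
    (hK_compact : Kinetic.CollectivelyCompact (frontier Ω) K)
    (hK_dual : Kinetic.DualImagesRelCompact (frontier Ω) K) :
    ∃ M : ℂ → (Kinetic.L1Minus Ω m →L[ℂ] Kinetic.L1Plus Ω m),
      (∀ l : ℂ, 0 ≤ l.re → Kinetic.IsTransferOperator Ω m l (M l)) ∧
      ∀ ε : ℝ, 0 ≤ ε →
        Tendsto (fun s : ℝ => ‖((M (ε + s * Complex.I)).comp H) ^ 2‖)
          (comap (fun s : ℝ => |s|) atTop) (𝓝 0) := by
  subst hm
  have hd' : 1 ≤ d := by omega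
  obtain ⟨k, hk⟩ := Kinetic.exists_map_footMap_le hd' hΩ_open hΩ_bdd hΩ_C1
  have hM : ∀ l : ℂ, ∃ M : Kinetic.L1Minus Ω (Kinetic.velocityMeasure d ϖ) →L[ℂ]
      Kinetic.L1Plus Ω (Kinetic.velocityMeasure d ϖ), 0 ≤ l.re →
        Kinetic.IsTransferOperator Ω (Kinetic.velocityMeasure d ϖ) l M ∧ ‖M‖ ≤ k := fun l => by
    by_cases hl : 0 ≤ l.re
    · obtain ⟨M, hM⟩ := Kinetic.exists_transferOperator hΩ_open hΩ_bdd (hk (Kinetic.velocityMeasure d ϖ)) hl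
      exact ⟨M, fun _ => hM⟩
    · exact ⟨0, fun h => absurd h hl⟩
  choose M hM using hM
  exact ⟨M, fun l hl => (hM l hl).1, fun ε hε =>
    Kinetic.tendsto_norm_transfer_comp_sq hd' hΩ_open hΩ_bdd hΩ_C1 hϖ hH hK hK_compact hK_dual
      (fun l hl => (hM l hl).1) (fun l hl => (hM l hl).2) hε⟩
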